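/- **Setting.** Let $a,X,T>0$, $I=(0,X)$, $I_T=(0,T)$, $Q=I\times I_T$, and $\|g\|_{L^{2,1}(Q)}=\int_0^T\|g(\cdot,t)\|_{L^2(I)}\,dt$. Let $u_0\in H_0^1(I)$, $u_1\in L^2(I)$, $f\in L^{2,1}(Q)$, and let $u$, with $u\in C([0,T];H_0^1(I))$ and $\partial_tu\in C([0,T];L^2(I))$, be the weak solution of $$\partial_t^2u-a^2\partial_x^2u=f\ \text{ in } Q,\qquad u|_{x=0,X}=0,\quad u|_{t=0}=u_0,\quad \partial_tu|_{t=0}=u_1 .$$ Assume that the weak derivatives $\partial_x^2u,\ \partial_t^2u,\ \partial_x^4u,\ \partial_t^4u,\ \partial_x^4\partial_t^2u,\ \partial_x^2\partial_t^4u$ exist and belong to $L^{2,1}(Q)$; $u$ and $u_1$ are identified with their continuous representatives on $\bar Q$ and $[0,X]$. **Scheme.** For integers $N,M\ge 1$ let $h=X/N$, $\tau=T/M$, $x_i=ih$, $t_m=m\tau$, and $$\Lambda_xw_i=\tfrac{w_{i-1}-2w_i+w_{i+1}}{h^2},\quad s_Nw_i=\tfrac{w_{i-1}+10w_i+w_{i+1}}{12},\quad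 Bw_i=\tfrac{w_{i-1}+4w_i+w_{i+1}}{6},$$ $$\delta_tv^m=\tfrac{v^{m+1}-v^m}{\tau},\quad \bar\delta_tv^m=\tfrac{v^m-v^{m-1}}{\tau},\quad \bar s_tv^m=\tfrac{v^m+v^{m-1}}2,\quad \Lambda_tv^m=\tfrac{v^{m+1}-2v^m+v^{m-1}}{\tau^2}.$$ With $e_i^h(x)=\max\{1-|x/h-i|,0\}$ and $e^{\tau,m}(t)=\max\{1-|t/\tau-m|,0\}$ let $$q_hw_i=\tfrac1h\int_{x_{i-1}}^{x_{i+1}}w\,e_i^h\,dx,\qquad q_\tau z^0=\tfrac2\tau\int_0^\tau z\,e^{\tau,0}\,dt,\qquad q_\tau z^m=\tfrac1\tau\int_{t_{m-1}}^{t_{m+1}}z\,e^{\tau,m}\,dt\ (m\ge1).$$ Let $f_h^m=(q_hq_\tau f)^m$, $0\le m\le M-1$, and let $v$ solve the compact scheme $$\big(s_N-\tfrac{\tau^2a^2}{12}\Lambda_x\big)\Lambda_tv-a^2\Lambda_xv=f_h\quad(1\le i\le N-1,\ 1\le m\le M-1),$$ $$\big(s_N-\tfrac{\tau^2a^2}{12}\Lambda_x\big)\delta_tv^0-\tfrac\tau2a^2\Lambda_xv^0=u_{1h}+\tfrac\tau2f_h^0\quad(1\le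 i\le N-1),$$ $$v_i^0=u_0(x_i)\ (0\le i\le N),\qquad v_0^m=v_N^m=0\ (1\le m\le M).$$ **Energy norm.** For mesh functions vanishing at $i=0,N$ let $\|w\|_B^2=h\sum_{i=1}^{N-1}(Bw_i)w_i$, $\|w\|_{-\Lambda_x}^2=-h\sum_{i=1}^{N-1}(\Lambda_xw_i)w_i$, $\sigma_N=\frac1{12}\big(1+\frac{h^2}{a^2\tau^2}\big)$ and $$\|\{v^{m-1},v^m\}\|_{E}=\Big(\|\bar\delta_tv^m\|_B^2+(\sigma_N-\tfrac14)\tau^2a^2\|\bar\delta_tv^m\|_{-\Lambda_x}^2+a^2\|\bar s_tv^m\|_{-\Lambda_x}^2\Big)^{1/2}.$$ **Theorem.** Let $0<\varepsilon_0\le1$. Under the above regularity assumptions also $\partial_x^2\partial_t^3u\in L^{2,1}(Q)$ and $\partial_x^4u_1\in L^2(I)$. There is a constant $c>0$ depending only on $a,X,T,\varepsilon_0$ (not on $N$, $M$ or the data) such that, whenever the stability condition $a^2\tau^2\le(1-\varepsilon_0^2/2)h^2$ holds, for $u_{1h}=q_hu_1+\frac{\tau^2}{12}a^2\Lambda_xu_1$,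 $$\max_{1\le m\le M}\|\{(u-v)^{m-1},(u-v)^m\}\|_{E}\le c\,h^4\Big(\|\partial_x^4\partial_t^2u\|_{L^{2,1}(Q)}+\|\partial_x^2\partial_t^4u\|_{L^{2,1}(Q)}+\|\partial_x^2\partial_t^3u\|_{L^{2,1}(Q)}+\|\partial_x^4u_1\|_{L^2(I)}\Big).$$ The same bound holds for $u_{1h}=s_Nu_1+\frac{\tau^2}{12}a^2\Lambda_xu_1$ and, if $u_1|_{x=0,X}=\partial_x^2u_1|_{x=0,X}=0$, also for $u_{1h}=\big(\mathbf I+\frac{\tau^2}{12}a^2\Lambda_x\big)q_hu_1$ with $q_hu_1|_{i=0,N}:=0$. -/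

import Mathlib

open MeasureTheory Set

namespace CompactWave

noncomputable section

/-! ### Lebesgue and Sobolev notions on `I = (0, X)` and `Q = (0, X) × (0, T)`

Functions of `(x, t)` are written in curried form, `u x t`. -/

/-- Lebesgue measure on the interval `I = (0, X)`. -/
abbrev muI (X : ℝ) : Measure ℝ := volume.restrict (Ioo 0 X)

/-- The space-time domain `Q = (0, X) × (0, T)`. -/
def domQ (X T : ℝ) : Set (ℝ × ℝ) := Ioo 0 X ×ˢ Ioo 0 T

/-- The norm of `L²(I)`, as an extended nonnegative number. -/
def normL2 (X : ℝ) (w : ℝ → ℝ) : ENNReal := eLpNorm w 2 (muI X)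

/-- The norm of `L^{2,1}(Q)`: the `L¹(0,T)` norm of `t ↦ ‖g(·,t)‖_{L²(I)}`. -/
def normL21 (X T : ℝ) (g : ℝ → ℝ → ℝ) : ENNReal :=
  ∫⁻ t in Ioo 0 T, normL2 X (fun x => g x t)

/-- `g ∈ L^{2,1}(Q)`. -/
def MemL21 (X T : ℝ) (g : ℝ → ℝ → ℝ) : Prop :=
  AEStronglyMeasurable (fun p : ℝ × ℝ => g p.1 p.2) (volume.restrict (domQ X T)) ∧
    normL21 X T g < ⊤

/-- Test functions on `I`: the elements of `C_c^∞(I)`. -/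
structure IsTestI (X : ℝ) (φ : ℝ → ℝ) : Prop where
  smooth : ContDiff ℝ (⊤ : ℕ∞) φ
  compact : HasCompactSupport φ
  supp : tsupport φ ⊆ Ioo 0 X

/-- Test functions on `Q`: the elements of `C_c^∞(Q)`. -/
structure IsTestQ (X T : ℝ) (φ : ℝ → ℝ → ℝ) : Prop where
  smooth : ContDiff ℝ (⊤ : ℕ∞) (fun p : ℝ × ℝ => φ p.1 p.2)
  compact : HasCompactSupport (fun p : ℝ × ℝ => φ p.1 p.2)
  supp : tsupport (fun p : ℝ × ℝ => φ p.1 p.2) ⊆ domQ X T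

/-- The classical mixed partial derivative `∂_x^k ∂_t^l φ (x, t)`. -/
def partialXT (k l : ℕ) (φ : ℝ → ℝ → ℝ) (x t : ℝ) : ℝ :=
  iteratedDeriv k (fun y => iteratedDeriv l (φ y) t) x

/-- `g` is the weak derivative `∂_x^k w` on `I`. -/
structure HasWeakDerivI (X : ℝ) (k : ℕ) (w g : ℝ → ℝ) : Prop where
  locInt : LocallyIntegrableOn w (Ioo 0 X)
  locInt_deriv : LocallyIntegrableOn g (Ioo 0 X)
  eq : ∀ φ : ℝ → ℝ, IsTestI X φ →
    ∫ x in Ioo 0 X, w x * iteratedDeriv k φ x = (-1) ^ k * ∫ x in Ioo 0 X, g x * φ x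

/-- `g` is the weak derivative `∂_x^k ∂_t^l w` on `Q`. -/
structure HasWeakDerivQ (X T : ℝ) (k l : ℕ) (w g : ℝ → ℝ → ℝ) : Prop where
  locInt : LocallyIntegrableOn (fun p : ℝ × ℝ => w p.1 p.2) (domQ X T)
  locInt_deriv : LocallyIntegrableOn (fun p : ℝ × ℝ => g p.1 p.2) (domQ X T)
  eq : ∀ φ : ℝ → ℝ → ℝ, IsTestQ X T φ →
    ∫ p in domQ X T, w p.1 p.2 * partialXT k l φ p.1 p.2 =
      (-1) ^ (k + l) * ∫ p in domQ X T, g p.1 p.2 * φ p.1 p.2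

/-- `g = ∂_x^k w` weakly on `I`, and `g ∈ L²(I)`. -/
def IsL2DerivI (X : ℝ) (k : ℕ) (w g : ℝ → ℝ) : Prop :=
  HasWeakDerivI X k w g ∧ MemLp g 2 (muI X)

/-- `g = ∂_x^k ∂_t^l w` weakly on `Q`, and `g ∈ L^{2,1}(Q)`. -/
def IsL21DerivQ (X T : ℝ) (k l : ℕ) (w g : ℝ → ℝ → ℝ) : Prop :=
  HasWeakDerivQ X T k l w g ∧ MemL21 X T g

/-- `w ∈ H_0^1(I)`, where `w` is the representative that is continuous on `[0, X]`. -/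
structure MemH10 (X : ℝ) (w : ℝ → ℝ) : Prop where
  cont : ContinuousOn w (Icc 0 X)
  left : w 0 = 0
  right : w X = 0
  deriv : ∃ g, IsL2DerivI X 1 w g

/-! ### The initial-boundary value problem -/

/-- `u` is the weak solution from the energy class of
`∂_t²u - a²∂_x²u = f` in `Q`, `u|_{x=0,X} = 0`, `u|_{t=0} = u0`, `∂_t u|_{t=0} = u1`. That is:
`u ∈ C([0,T]; H_0^1(I))` (each `u(·,t)` being the continuous representative),
`∂_t u ∈ C([0,T]; L²(I))`, the initial conditions hold, and the equation holds in the
sense of distributions on `Q`. -/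
structure IsEnergySolution (a X T : ℝ) (u0 u1 : ℝ → ℝ) (f u : ℝ → ℝ → ℝ) : Prop where
  memH10 : ∀ t ∈ Icc 0 T, MemH10 X (fun x => u x t)
  /-- `t ↦ ∂_x u(·,t)` is continuous from `[0,T]` to `L²(I)`. -/
  cont_dx : ∃ W : ℝ → Lp ℝ 2 (muI X), ContinuousOn W (Icc 0 T) ∧
    ∀ t ∈ Icc 0 T, HasWeakDerivI X 1 (fun x => u x t) (W t)
  /-- `t ↦ u(·,t)` is continuously differentiable from `[0,T]` to `L²(I)`, and its
  derivative at `t = 0` is `u1`. -/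
  cont_dt : ∃ U V : ℝ → Lp ℝ 2 (muI X),
    (∀ t ∈ Icc 0 T, U t =ᵐ[muI X] fun x => u x t) ∧
    (∀ t ∈ Icc 0 T, HasDerivWithinAt U (V t) (Icc 0 T) t) ∧
    ContinuousOn V (Icc 0 T) ∧ V 0 =ᵐ[muI X] u1
  init : ∀ x ∈ Icc 0 X, u x 0 = u0 x
  eqn : ∀ φ : ℝ → ℝ → ℝ, IsTestQ X T φ →
    ∫ p in domQ X T, u p.1 p.2 * (partialXT 0 2 φ p.1 p.2 - a ^ 2 * partialXT 2 0 φ p.1 p.2) =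
      ∫ p in domQ X T, f p.1 p.2 * φ p.1 p.2

/-! ### Mesh operators

A mesh function in `x` is `w : ℕ → ℝ`, with `w i` its value at `x_i = i h`; only the indices
`0 ≤ i ≤ N` matter, and the three-point operators are applied at `1 ≤ i ≤ N - 1` only.
A mesh function in `(x, t)` is `v : ℕ → ℕ → ℝ`, with `v m i` its value at `(x_i, t_m)`. -/

/-- `Λ_x w_i = (w_{i-1} - 2 w_i + w_{i+1}) / h²`. -/
def lamX (h : ℝ) (w : ℕ → ℝ) (i : ℕ) : ℝ := (w (i - 1) - 2 * w i + w (i + 1)) / h ^ 2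

/-- The Numerov average `s_N w_i = (w_{i-1} + 10 w_i + w_{i+1}) / 12`. -/
def sN (w : ℕ → ℝ) (i : ℕ) : ℝ := (w (i - 1) + 10 * w i + w (i + 1)) / 12

/-- The average `B w_i = (w_{i-1} + 4 w_i + w_{i+1}) / 6`. -/
def avB (w : ℕ → ℝ) (i : ℕ) : ℝ := (w (i - 1) + 4 * w i + w (i + 1)) / 6

/-- `δ_t v^m = (v^{m+1} - v^m) / τ`. -/
def deltaT (τ : ℝ) (v : ℕ → ℕ → ℝ) (m i : ℕ) : ℝ := (v (m + 1) i - v m i) / τ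

/-- `Λ_t v^m = (v^{m+1} - 2 v^m + v^{m-1}) / τ²`, applied at `m ≥ 1` only. -/
def lamT (τ : ℝ) (v : ℕ → ℕ → ℝ) (m i : ℕ) : ℝ :=
  (v (m + 1) i - 2 * v m i + v (m - 1) i) / τ ^ 2

/-- The inner product `(v, w)_h = ∑_{i=1}^{N-1} v_i w_i h`. -/
def innerH (h : ℝ) (N : ℕ) (v w : ℕ → ℝ) : ℝ := ∑ i ∈ Finset.Icc 1 (N - 1), v i * w i * h

/-- `‖w‖_B² = (B w, w)_h`. -/
def normSqB (h : ℝ) (N : ℕ) (w : ℕ → ℝ) : ℝ := innerH h N (avB w) w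

/-- `‖w‖_{-Λ_x}² = (-Λ_x w, w)_h`. -/
def normSqLam (h : ℝ) (N : ℕ) (w : ℕ → ℝ) : ℝ := innerH h N (fun i => -lamX h w i) w

/-- The weight `σ_N = (1 + h² / (a² τ²)) / 12`. -/
def sigmaN (a h τ : ℝ) : ℝ := (1 + h ^ 2 / (a ^ 2 * τ ^ 2)) / 12

/-- The level energy norm of the pair `{y, w}` of mesh functions on two consecutive
time levels (`y` on the earlier one):
`(‖δ‖_B² + (σ_N - 1/4) τ² a² ‖δ‖_{-Λ_x}² + a² ‖s‖_{-Λ_x}²)^{1/2}`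
with `δ = (w - y) / τ` and `s = (w + y) / 2`. -/
def energyNorm (a h τ : ℝ) (N : ℕ) (y w : ℕ → ℝ) : ℝ :=
  Real.sqrt (normSqB h N (fun i => (w i - y i) / τ)
    + (sigmaN a h τ - 1 / 4) * τ ^ 2 * a ^ 2 * normSqLam h N (fun i => (w i - y i) / τ)
    + a ^ 2 * normSqLam h N (fun i => (w i + y i) / 2))

/-- The hat function `max {1 - |s / d - j|, 0}` of the mesh with step `d`. -/
def hat (d : ℝ) (j : ℕ) (s : ℝ) : ℝ := max (1 - |s / d - j|) 0

/-- `q_h w_i = (1/h) ∫_{x_{i-1}}^{x_{i+1}} w(x) e_i^h(x) dx`, for `1 ≤ i ≤ N - 1`. -/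
def qH (h : ℝ) (w : ℝ → ℝ) (i : ℕ) : ℝ :=
  (1 / h) * ∫ x in (((i : ℝ) - 1) * h)..(((i : ℝ) + 1) * h), w x * hat h i x

/-- `q_τ z^0 = (2/τ) ∫_0^τ z(t) e^{τ,0}(t) dt` and
`q_τ z^m = (1/τ) ∫_{t_{m-1}}^{t_{m+1}} z(t) e^{τ,m}(t) dt` for `1 ≤ m ≤ M - 1`. -/
def qTau (τ : ℝ) (z : ℝ → ℝ) (m : ℕ) : ℝ :=
  if m = 0 then (2 / τ) * ∫ t in (0 : ℝ)..τ, z t * hat τ 0 t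
  else (1 / τ) * ∫ t in (((m : ℝ) - 1) * τ)..(((m : ℝ) + 1) * τ), z t * hat τ m t

/-- The mesh free term `f_h = q_h q_τ f`. -/
def fMesh (h τ : ℝ) (f : ℝ → ℝ → ℝ) (m i : ℕ) : ℝ :=
  qH h (fun x => qTau τ (f x) m) i

/-- `q_h w` as a mesh function that vanishes at the end nodes `i = 0, N`. -/
def qH0 (h : ℝ) (N : ℕ) (w : ℝ → ℝ) (i : ℕ) : ℝ := if 1 ≤ i ∧ i < N then qH h w i else 0

/-- The restriction of a function on `[0, X]` to the mesh. -/
def nodal (h : ℝ) (w : ℝ → ℝ) (i : ℕ) : ℝ := w (i * h)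

/-- `s_N u_1 + (τ²/12) a² Λ_x u_1`. -/
def u1Mesh0 (a h τ : ℝ) (u1 : ℝ → ℝ) (i : ℕ) : ℝ :=
  sN (nodal h u1) i + τ ^ 2 / 12 * a ^ 2 * lamX h (nodal h u1) i

/-- `q_h u_1 + (τ²/12) a² Λ_x u_1`. -/
def u1Mesh1 (a h τ : ℝ) (u1 : ℝ → ℝ) (i : ℕ) : ℝ :=
  qH h u1 i + τ ^ 2 / 12 * a ^ 2 * lamX h (nodal h u1) i

/-- `(I + (τ²/12) a² Λ_x) q_h u_1` with `q_h u_1 = 0` at the end nodes. -/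
def u1Mesh2 (a h τ : ℝ) (N : ℕ) (u1 : ℝ → ℝ) (i : ℕ) : ℝ :=
  qH0 h N u1 i + τ ^ 2 / 12 * a ^ 2 * lamX h (qH0 h N u1) i

/-- `u_1` and the continuous representative of `∂_x² u_1` vanish at `x = 0` and `x = X`. -/
def VanishU1 (X : ℝ) (u1 : ℝ → ℝ) : Prop :=
  u1 0 = 0 ∧ u1 X = 0 ∧
    ∃ w : ℝ → ℝ, ContinuousOn w (Icc 0 X) ∧ HasWeakDerivI X 2 u1 w ∧ w 0 = 0 ∧ w X = 0

/-- The admissible choices of `u_{1h}` on the inner mesh nodes; the third one is only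
admitted when `u_1` and `∂_x² u_1` vanish at `x = 0, X`. -/
def IsU1Choice (a X h τ : ℝ) (N : ℕ) (u1 : ℝ → ℝ) (u1h : ℕ → ℝ) : Prop :=
  (∀ i, 1 ≤ i → i < N → u1h i = u1Mesh1 a h τ u1 i) ∨
  (∀ i, 1 ≤ i → i < N → u1h i = u1Mesh0 a h τ u1 i) ∨
  (VanishU1 X u1 ∧ ∀ i, 1 ≤ i → i < N → u1h i = u1Mesh2 a h τ N u1 i)

/-- `v` is a solution of the three-level compact scheme with the steps `h`, `τ`, with
`N` and `M` mesh intervals in `x` and `t`. -/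
structure IsSchemeSolution (a h τ : ℝ) (N M : ℕ) (u0 : ℝ → ℝ) (u1h : ℕ → ℝ)
    (fh : ℕ → ℕ → ℝ) (v : ℕ → ℕ → ℝ) : Prop where
  /-- `(s_N - τ²a²Λ_x/12) Λ_t v - a² Λ_x v = f_h` at the inner nodes. -/
  main : ∀ m, 1 ≤ m → m < M → ∀ i, 1 ≤ i → i < N →
    (sN (lamT τ v m) i - τ ^ 2 * a ^ 2 / 12 * lamX h (lamT τ v m) i)
      - a ^ 2 * lamX h (v m) i = fh m i
  /-- `(s_N - τ²a²Λ_x/12) δ_t v^0 - (τ/2) a² Λ_x v^0 = u_{1h} + (τ/2) f_h^0`. -/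
  first : ∀ i, 1 ≤ i → i < N →
    (sN (deltaT τ v 0) i - τ ^ 2 * a ^ 2 / 12 * lamX h (deltaT τ v 0) i)
      - τ / 2 * a ^ 2 * lamX h (v 0) i = u1h i + τ / 2 * fh 0 i
  init : ∀ i, i ≤ N → v 0 i = nodal h u0 i
  bdry : ∀ m, 1 ≤ m → m ≤ M → v m 0 = 0 ∧ v m N = 0

/-- The error `u - v` at the mesh nodes. -/
def meshError (h τ : ℝ) (u : ℝ → ℝ → ℝ) (v : ℕ → ℕ → ℝ) (m i : ℕ) : ℝ :=
  u (i * h) (m * τ) - v m i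

end

end CompactWave

open CompactWave

open MeasureTheory Set

namespace CompactWave

/-! ### Test functions on an interval -/

/-! The nodal error `r = u - v` solves the compact scheme with zero initial and boundary values and
with the truncation error `ψ` of `u` as free term. The estimate combines stability of the scheme
with a fourth-order bound of `ψ` that uses only the assumed weak derivatives.

Stability (`energy_stability`). Pairing the three-level equation with `r^{m+1} - r^{m-1}` and
summing by parts gives an exact energy balance (`energySq_step`). The stability condition and the
inverse inequality `dirH_self_le` make the energy control the `L²_h` norm of the difference quotient
(`energySq_coercive`). The root of the energy therefore grows by at most `(2/ε) τ ‖ψ^m‖` per step,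
while the first step contributes `(2/ε) ‖ψ^0‖` without the factor `τ`.

Truncation error. The averages satisfy `q_h ∂_x² = Λ_x` and `q_τ ∂_t² = Λ_t` (`represents_lamX`, in
either variable). Substituting `f = ∂_t² u - a² ∂_x² u` collapses the error to `Λ_t (s_N - q_h) u -
a² (s_τ - q_τ) Λ_x u` with `s_τ = 1 + (τ²/12) Λ_t` (`truncation_main`). The defect `s_N - q_h` kills
cubics, so it is an integral of the fourth derivative against a Peano kernel of size `h³` supported
in two mesh cells; this gives `h⁴ ∂_x⁴∂_t² u` and `τ⁴ ∂_x²∂_t⁴ u`, and `a² τ² ≤ h²`. In the first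
equation (`truncation_first`) the quadrature `startDefect` leaves a term `-(τ²/12) Λ_x u_1`, which
`u_{1h}` is designed to compensate, and a remainder `τ⁴ sup_t ‖∂_x²∂_t³ u‖`.

Weak derivatives. Nothing is differentiated pointwise. A functional in `x` that integrates `∂_x^k`
against a kernel turns a weak equation on `Q` into one in time (`WeakEqQ.weakEq_time`), to which the
one-dimensional Taylor formula `WeakEq.taylor` applies. The derivative `∂_x²∂_t³ u` is built as a
time primitive of `∂_x²∂_t⁴ u` plus a function of `x` (`WeakEqQ.midDeriv`), which also bounds its
slices uniformly in `t`. The derivative `∂_x⁴ u_1` is found by expressing the initial slope of a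
function of time through the function and its second derivative (`weakEq_initSlope`). -/

theorem IsTestI.of_vanish {X α β : ℝ} {φ : ℝ → ℝ} (h : ContDiff ℝ (⊤ : ℕ∞) φ) (hα : 0 < α)
    (hβ : β < X) (hv : ∀ x, x ∉ Icc α β → φ x = 0) : IsTestI X φ := by
  have hs : tsupport φ ⊆ Icc α β := by
    apply closure_minimal _ isClosed_Icc
    intro x hx
    by_contra hc
    exact hx (hv x hc)
  refine ⟨h, HasCompactSupport.of_support_subset_isCompact isCompact_Icc
    ((subset_tsupport φ).trans hs), fun x hx => ?_⟩
  have := hs hx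
  exact ⟨hα.trans_le this.1, this.2.trans_lt hβ⟩

theorem exists_Icc_of_compact_subset_Ioo {X : ℝ} (hX : 0 < X) {K : Set ℝ} (hK : IsCompact K)
    (hs : K ⊆ Ioo 0 X) : ∃ α β, 0 < α ∧ β < X ∧ K ⊆ Icc α β := by
  have hK' : IsCompact (insert (X / 2) K) := hK.insert _
  have hs' : insert (X / 2) K ⊆ Ioo 0 X := by
    rw [insert_subset_iff]
    exact ⟨⟨by positivity, by linarith⟩, hs⟩
  obtain ⟨α, hα, hα'⟩ := hK'.exists_isLeast (insert_nonempty _ _)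
  obtain ⟨β, hβ, hβ'⟩ := hK'.exists_isGreatest (insert_nonempty _ _)
  exact ⟨α, β, (hs' hα).1, (hs' hβ).2, fun x hx =>
    ⟨hα' (mem_insert_of_mem _ hx), hβ' (mem_insert_of_mem _ hx)⟩⟩

theorem IsTestI.exists_vanish {X : ℝ} (hX : 0 < X) {φ : ℝ → ℝ} (h : IsTestI X φ) :
    ∃ α β, 0 < α ∧ β < X ∧ ∀ x, x ∉ Icc α β → φ x = 0 := by
  obtain ⟨α, β, h1, h2, h3⟩ := exists_Icc_of_compact_subset_Ioo hX h.compact h.supp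
  refine ⟨α, β, h1, h2, fun x hx => image_eq_zero_of_notMem_tsupport fun hc => hx (h3 hc)⟩

theorem IsTestI.zero_of_notMem {X : ℝ} {φ : ℝ → ℝ} (h : IsTestI X φ) {x : ℝ}
    (hx : x ∉ Ioo 0 X) : φ x = 0 :=
  image_eq_zero_of_notMem_tsupport fun hc => hx (h.supp hc)

theorem IsTestI.deriv {X : ℝ} {φ : ℝ → ℝ} (h : IsTestI X φ) : IsTestI X (deriv φ) := by
  refine ⟨?_, h.compact.deriv, (closure_mono (support_deriv_subset)).trans ?_⟩
  · exact (contDiff_infty_iff_deriv.1 h.smooth).2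
  · rw [isClosed_tsupport _ |>.closure_eq]; exact h.supp

theorem IsTestI.iteratedDeriv {X : ℝ} {φ : ℝ → ℝ} (h : IsTestI X φ) (k : ℕ) :
    IsTestI X (iteratedDeriv k φ) := by
  induction k with
  | zero => simpa using h
  | succ k ih => rw [iteratedDeriv_succ]; exact ih.deriv

theorem IsTestI.continuous {X : ℝ} {φ : ℝ → ℝ} (h : IsTestI X φ) : Continuous φ :=
  h.smooth.continuous

theorem IsTestI.hasDerivAt {X : ℝ} {φ : ℝ → ℝ} (h : IsTestI X φ) (k : ℕ) (x : ℝ) :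
    HasDerivAt (_root_.iteratedDeriv k φ) (_root_.iteratedDeriv (k + 1) φ x) x := by
  rw [iteratedDeriv_succ]
  exact ((h.iteratedDeriv k).smooth.differentiable (by simp) x).hasDerivAt

theorem IsTestI.const_mul {X : ℝ} {φ : ℝ → ℝ} (h : IsTestI X φ) (c : ℝ) :
    IsTestI X (fun x => c * φ x) := by
  refine ⟨contDiff_const.mul h.smooth, h.compact.mul_left, ?_⟩
  exact (closure_mono (Function.support_mul_subset_right _ _)).trans h.supp

theorem IsTestI.sub {X : ℝ} {φ ψ : ℝ → ℝ} (h : IsTestI X φ) (h' : IsTestI X ψ) :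
    IsTestI X (fun x => φ x - ψ x) := by
  refine ⟨h.smooth.sub h'.smooth, ?_, ?_⟩
  · have := h.compact.add (h'.const_mul (-1)).compact
    simpa [sub_eq_add_neg, Pi.add_def] using this
  · refine (closure_mono (t := tsupport φ ∪ tsupport ψ) ?_).trans ?_
    · intro x hx
      by_contra hc
      simp only [mem_union, not_or] at hc
      apply hx
      simp [image_eq_zero_of_notMem_tsupport hc.1, image_eq_zero_of_notMem_tsupport hc.2]
    · rw [((isClosed_tsupport _).union (isClosed_tsupport _)).closure_eq]
      exact union_subset h.supp h'.supp

theorem exists_test_integral_one {X : ℝ} (hX : 0 < X) :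
    ∃ χ, IsTestI X χ ∧ ∫ x in Ioo 0 X, χ x = 1 := by
  let b : ContDiffBump (X / 2) := ⟨X / 8, X / 4, by positivity, by linarith⟩
  have hb : IsTestI X (b.normed volume) := by
    refine IsTestI.of_vanish (α := X / 4) (β := 3 * X / 4) b.contDiff_normed (by positivity)
      (by linarith) fun x hx => ?_
    have : x ∉ Function.support (b.normed volume) := by
      rw [b.support_normed_eq, Real.ball_eq_Ioo]
      intro hc
      apply hx
      have h1 : X / 2 - X / 4 < x := hc.1
      have h2 : x < X / 2 + X / 4 := hc.2
      constructor <;> linarith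
    simpa using this
  refine ⟨_, hb, ?_⟩
  rw [setIntegral_eq_integral_of_forall_compl_eq_zero fun x hx => hb.zero_of_notMem hx]
  exact b.integral_normed

theorem IsTestI.integrable {X : ℝ} {φ : ℝ → ℝ} (h : IsTestI X φ) : Integrable φ :=
  h.continuous.integrable_of_hasCompactSupport h.compact

/-- The primitive from `0` vanishes to the left of the support of `φ` and is constant to the right
of it; the zero mean makes that constant zero. -/
theorem IsTestI.exists_primitive {X : ℝ} (hX : 0 < X) {φ : ℝ → ℝ} (h : IsTestI X φ)
    (h0 : ∫ x in Ioo 0 X, φ x = 0) : ∃ Φ, IsTestI X Φ ∧ _root_.deriv Φ = φ := by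
  obtain ⟨α, β, hα, hβ, hv⟩ := h.exists_vanish hX
  have hd : ∀ x, HasDerivAt (fun x => ∫ s in (0 : ℝ)..x, φ s) (φ x) x := fun x =>
    intervalIntegral.integral_hasDerivAt_right (h.continuous.intervalIntegrable _ _)
      (h.continuous.stronglyMeasurableAtFilter _ _) h.continuous.continuousAt
  have hd' : _root_.deriv (fun x => ∫ s in (0 : ℝ)..x, φ s) = φ := funext fun x => (hd x).deriv
  refine ⟨fun x => ∫ s in (0 : ℝ)..x, φ s, ?_, hd'⟩
  refine IsTestI.of_vanish ?_ hα hβ fun x hx => ?_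
  · rw [contDiff_infty_iff_deriv, hd']
    exact ⟨fun x => (hd x).differentiableAt, h.smooth⟩
  · rw [mem_Icc, not_and_or, not_le, not_le] at hx
    rcases hx with hx | hx
    · rw [intervalIntegral.integral_congr (g := fun _ => 0)]
      · simp
      · intro s hs
        apply hv
        intro hc
        rw [mem_uIcc] at hs
        have := hc.1
        rcases hs with hs | hs <;> linarith [hs.1, hs.2]
    · have e : ∫ s in (0 : ℝ)..X, φ s = 0 := by
        rw [intervalIntegral.integral_of_le hX.le, integral_Ioc_eq_integral_Ioo, h0]
      have e2 : ∫ s in x..X, φ s = 0 := by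
        rw [intervalIntegral.integral_congr (g := fun _ => 0)]
        · simp
        · intro s hs
          apply hv
          intro hc
          rw [mem_uIcc] at hs
          have := hc.2
          rcases hs with hs | hs <;> linarith [hs.1, hs.2]
      have := intervalIntegral.integral_add_adjacent_intervals
        (h.continuous.intervalIntegrable (μ := volume) 0 x) (h.continuous.intervalIntegrable x X)
      simp only [e, e2] at this
      linarith

/-! ### The weak equation in one dimension -/

/-- The weak equation `∂^k w = g` tested with `C_c^∞(0, X)`. -/
def WeakEq (X : ℝ) (k : ℕ) (w g : ℝ → ℝ) : Prop :=
  ∀ φ : ℝ → ℝ, IsTestI X φ →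
    ∫ x in Ioo 0 X, w x * iteratedDeriv k φ x = (-1) ^ k * ∫ x in Ioo 0 X, g x * φ x

theorem integrable_mul_test {X : ℝ} {w φ : ℝ → ℝ} (hw : IntegrableOn w (Ioo 0 X))
    (h : IsTestI X φ) : IntegrableOn (fun x => w x * φ x) (Ioo 0 X) := by
  obtain ⟨C, hC⟩ := h.continuous.bounded_above_of_compact_support h.compact
  exact hw.mul_bdd (c := C) h.continuous.aestronglyMeasurable (Filter.Eventually.of_forall hC)

theorem ae_eq_of_weakEq_zero {X : ℝ} {w g : ℝ → ℝ} (hw : IntegrableOn w (Ioo 0 X))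
    (hg : IntegrableOn g (Ioo 0 X)) (h : WeakEq X 0 w g) :
    w =ᵐ[volume.restrict (Ioo 0 X)] g := by
  have := isOpen_Ioo.ae_eq_zero_of_integral_contDiff_smul_eq_zero (U := Ioo 0 X) (μ := volume)
    (f := fun x => w x - g x) ((hw.sub hg).locallyIntegrableOn) (fun φ h1 h2 h3 => by
      have ht : IsTestI X φ := ⟨h1, h2, h3⟩
      rw [← setIntegral_eq_integral_of_forall_compl_eq_zero (s := Ioo 0 X)]
      · have := h φ ht
        simp only [iteratedDeriv_zero, pow_zero, one_mul] at this
        simp only [smul_eq_mul, mul_sub]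
        rw [integral_sub]
        · simp only [mul_comm (φ _)]
          rw [this, sub_self]
        · exact (integrable_mul_test hw ht).congr (.of_forall fun x => mul_comm _ _)
        · exact (integrable_mul_test hg ht).congr (.of_forall fun x => mul_comm _ _)
      · intro x hx
        simp [ht.zero_of_notMem hx])
  rw [Filter.EventuallyEq, ae_restrict_iff' measurableSet_Ioo]
  filter_upwards [this] with x hx hx'
  linarith [hx hx']

theorem eqOn_of_ae_eq_Ioo {X : ℝ} (hX : 0 < X) {v w : ℝ → ℝ} (hv : ContinuousOn v (Icc 0 X))
    (hw : ContinuousOn w (Icc 0 X)) (h : v =ᵐ[volume.restrict (Ioo 0 X)] w) :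
    EqOn v w (Icc 0 X) := by
  have h1 : EqOn v w (Ioo 0 X) :=
    Measure.eqOn_open_of_ae_eq h isOpen_Ioo (hv.mono Ioo_subset_Icc_self)
      (hw.mono Ioo_subset_Icc_self)
  exact h1.of_subset_closure hv hw Ioo_subset_Icc_self (by rw [closure_Ioo hX.ne])

/-- Repeated integration by parts without boundary terms. It isolates the leading coefficient in
`eq_polynomial_of_weakEq`. -/
theorem iteratedDeriv_pow_test {X : ℝ} (k : ℕ) {φ : ℝ → ℝ} (h : IsTestI X φ) :
    ∫ x in Ioo 0 X, x ^ k * iteratedDeriv k φ x = (-1) ^ k * k.factorial * ∫ x in Ioo 0 X, φ x := by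
  have key : ∀ (j : ℕ) {ψ : ℝ → ℝ}, IsTestI X ψ → ∫ x in Ioo 0 X, x ^ (j + 1) * deriv ψ x =
      - (j + 1) * ∫ x in Ioo 0 X, x ^ j * ψ x := by
    intro j ψ hψ
    rw [setIntegral_eq_integral_of_forall_compl_eq_zero
        (fun x hx => by simp [hψ.deriv.zero_of_notMem hx]),
      setIntegral_eq_integral_of_forall_compl_eq_zero
        (fun x hx => by simp [hψ.zero_of_notMem hx])]
    have i1 : ∀ (j : ℕ) {ψ : ℝ → ℝ}, IsTestI X ψ → Integrable fun x => x ^ j * ψ x := by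
      intro j ψ hψ
      exact ((continuous_pow j).mul hψ.continuous).integrable_of_hasCompactSupport
        hψ.compact.mul_left
    rw [integral_mul_deriv_eq_deriv_mul_of_integrable (u' := fun x => (j + 1) * x ^ j) (v := ψ)]
    · rw [← integral_const_mul, ← integral_neg]
      congr 1; ext x; ring
    · intro x _
      simpa using hasDerivAt_pow (j + 1) x
    · intro x _
      exact (hψ.smooth.differentiable (by simp) x).hasDerivAt
    · exact i1 _ hψ.deriv
    · have := (i1 j hψ).const_mul (j + 1)
      refine this.congr (Filter.Eventually.of_forall fun x => ?_)
      simp only [Pi.mul_apply]; ring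
    · exact i1 _ hψ
  induction k generalizing φ with
  | zero => simp
  | succ k ih =>
    rw [iteratedDeriv_succ, key k (h.iteratedDeriv k), ih h, Nat.factorial_succ]
    push_cast; ring

theorem iteratedDeriv_test_sub {X : ℝ} {φ ψ : ℝ → ℝ} (h : IsTestI X φ) (h' : IsTestI X ψ)
    (c : ℝ) (k : ℕ) (x : ℝ) : iteratedDeriv k (fun x => φ x - c * ψ x) x =
      iteratedDeriv k φ x - c * iteratedDeriv k ψ x := by
  rw [iteratedDeriv_fun_sub, iteratedDeriv_const_mul_field]
  · exact (h.smooth.of_le (by exact_mod_cast le_top)).contDiffAt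
  · exact ((h'.const_mul c).smooth.of_le (by exact_mod_cast le_top)).contDiffAt

/-- Du Bois-Reymond by induction. Any test function `ψ` is a derivative of a test function up to a
multiple of a fixed `χ` of integral one, so the weak equation of order `k + 1` determines `w`
against `ψ^{(k)}` up to the number `C`, and a monomial of degree `k` absorbs that number. -/
theorem eq_polynomial_of_weakEq {X : ℝ} (hX : 0 < X) (k : ℕ) {w : ℝ → ℝ}
    (hw : ContinuousOn w (Icc 0 X)) (h : WeakEq X k w 0) :
    ∃ c : ℕ → ℝ, ∀ x ∈ Icc 0 X, w x = ∑ j ∈ Finset.range k, c j * x ^ j := by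
  induction k generalizing w with
  | zero =>
    refine ⟨0, fun x hx => ?_⟩
    have hwi : IntegrableOn w (Ioo 0 X) :=
      (hw.integrableOn_compact isCompact_Icc).mono_set Ioo_subset_Icc_self
    have := ae_eq_of_weakEq_zero hwi integrableOn_zero h
    simpa using eqOn_of_ae_eq_Ioo hX hw continuousOn_const this hx
  | succ k ih =>
    obtain ⟨χ, hχ, hχ1⟩ := exists_test_integral_one hX
    set C := ∫ x in Ioo 0 X, w x * iteratedDeriv k χ x with hC
    have hwi : IntegrableOn w (Ioo 0 X) :=
      (hw.integrableOn_compact isCompact_Icc).mono_set Ioo_subset_Icc_self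
    have hpi : ∀ c : ℝ, IntegrableOn (fun x : ℝ => c * x ^ k) (Ioo 0 X) := fun c =>
      ((by fun_prop : ContinuousOn (fun x : ℝ => c * x ^ k) (Icc 0 X)).integrableOn_compact
        isCompact_Icc).mono_set Ioo_subset_Icc_self
    -- The coefficient of `x ^ k` is forced: against `χ^{(k)}` lower powers integrate to zero and `x
    -- ^ k` gives `(-1)^k k!`, since `χ` has integral one.
    set d := (-1) ^ k * C / k.factorial with hd
    have hw' : WeakEq X k (fun x => w x - d * x ^ k) 0 := by
      intro ψ hψ
      set c := ∫ x in Ioo 0 X, ψ x with hc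
      have h0 : ∫ x in Ioo 0 X, (ψ x - c * χ x) = 0 := by
        rw [integral_sub hψ.integrable.integrableOn (hχ.const_mul c).integrable.integrableOn,
          integral_const_mul, hχ1, mul_one, sub_self]
      obtain ⟨Φ, hΦ, hΦd⟩ := (hψ.sub (hχ.const_mul c)).exists_primitive hX h0
      have e1 := h Φ hΦ
      rw [iteratedDeriv_succ', hΦd] at e1
      simp only [iteratedDeriv_test_sub hψ hχ, Pi.zero_apply, zero_mul, integral_zero, mul_zero,
        mul_sub] at e1
      rw [integral_sub (integrable_mul_test hwi (hψ.iteratedDeriv k))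
        (integrable_mul_test hwi ((hχ.iteratedDeriv k).const_mul c))] at e1
      simp only [mul_left_comm (w _) c, integral_const_mul] at e1
      simp only [Pi.zero_apply, zero_mul, integral_zero, mul_zero, sub_mul]
      rw [integral_sub (integrable_mul_test hwi (hψ.iteratedDeriv k))
        (integrable_mul_test (hpi d) (hψ.iteratedDeriv k))]
      simp only [mul_assoc d, integral_const_mul]
      rw [iteratedDeriv_pow_test k hψ, ← hc, hd]
      have e2 : ((-1 : ℝ) ^ k) * (-1) ^ k = 1 := by rw [← mul_pow]; simp
      have hf : (k.factorial : ℝ) ≠ 0 := by positivity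
      field_simp
      rw [← hC] at e1
      linear_combination e1 - c * C * e2
    obtain ⟨c, hcc⟩ := ih (by fun_prop) hw'
    refine ⟨Function.update c k d, fun x hx => ?_⟩
    rw [Finset.sum_range_succ, Function.update_self]
    have := hcc x hx
    rw [Finset.sum_congr rfl (g := fun j => c j * x ^ j)]
    · linarith
    · intro j hj
      rw [Function.update_of_ne (Finset.mem_range.1 hj).ne]

/-- The truncated power `(x - s)_+^k / k!`, with the value `0` at `x = s` also for `k = 0`. -/
noncomputable def kern (k : ℕ) (x s : ℝ) : ℝ := if s < x then (x - s) ^ k / k.factorial else 0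

theorem measurable_kern (k : ℕ) : Measurable fun p : ℝ × ℝ => kern k p.1 p.2 := by
  unfold kern
  exact Measurable.ite (measurableSet_lt measurable_snd measurable_fst) (by fun_prop) (by fun_prop)

theorem measurable_kern_right (k : ℕ) (x : ℝ) : Measurable (kern k x) :=
  (measurable_kern k).comp measurable_prodMk_left

theorem abs_kern_le {k : ℕ} {x s d : ℝ} (h : x - s ≤ d) (hd : 0 ≤ d) : |kern k x s| ≤ d ^ k := by
  unfold kern
  split_ifs with hs
  · rw [abs_div, abs_of_pos (a := (k.factorial : ℝ)) (by positivity), abs_pow,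
      abs_of_pos (sub_pos.2 hs)]
    have h1 : (1 : ℝ) ≤ k.factorial := by exact_mod_cast Nat.factorial_pos k
    calc (x - s) ^ k / k.factorial ≤ (x - s) ^ k := div_le_self (by
          have := sub_pos.2 hs; positivity) h1
      _ ≤ d ^ k := pow_le_pow_left₀ (sub_pos.2 hs).le h k
  · simp; positivity

theorem integrable_kern_mul {X : ℝ} (k : ℕ) {g : ℝ → ℝ} (hg : IntegrableOn g (Ioo 0 X)) {x : ℝ}
    (hx : x ∈ Icc 0 X) : IntegrableOn (fun s => kern k x s * g s) (Ioo 0 X) := by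
  refine hg.bdd_mul (c := X ^ k) (measurable_kern_right k x).aestronglyMeasurable ?_
  filter_upwards [ae_restrict_mem measurableSet_Ioo] with s hs
  exact abs_kern_le (by linarith [hs.1, hx.2]) (hx.1.trans hx.2)

theorem continuousAt_kern (k : ℕ) {x s : ℝ} (h : s ≠ x) : ContinuousAt (fun x => kern k x s) x := by
  rcases lt_or_gt_of_ne h with h | h
  · have : (fun x => kern k x s) =ᶠ[nhds x] fun x => (x - s) ^ k / k.factorial := by
      filter_upwards [lt_mem_nhds h] with y hy
      simp [kern, hy]
    rw [continuousAt_congr this]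
    fun_prop
  · have : (fun x => kern k x s) =ᶠ[nhds x] fun x => 0 := by
      filter_upwards [gt_mem_nhds h] with y hy
      simp only [kern, if_neg (not_lt.2 (le_of_lt hy))]
    rw [continuousAt_congr this]
    fun_prop

theorem continuousOn_integral_kern {X : ℝ} (k : ℕ) {g : ℝ → ℝ} (hg : IntegrableOn g (Ioo 0 X)) :
    ContinuousOn (fun x => ∫ s in Ioo 0 X, kern k x s * g s) (Icc 0 X) := by
  intro x hx
  refine continuousWithinAt_of_dominated (bound := fun s => X ^ k * ‖g s‖) ?_ ?_ ?_ ?_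
  · exact Filter.Eventually.of_forall fun y =>
      (measurable_kern_right k y).aestronglyMeasurable.mul hg.aestronglyMeasurable
  · filter_upwards [self_mem_nhdsWithin] with y hy
    filter_upwards [ae_restrict_mem measurableSet_Ioo] with s hs
    rw [norm_mul]
    exact mul_le_mul_of_nonneg_right
      (abs_kern_le (by linarith [hs.1, hy.2]) (hx.1.trans hx.2)) (norm_nonneg _)
  · exact hg.norm.const_mul _
  · have : ∀ᵐ s ∂(volume : Measure ℝ), s ≠ x := by simp [ae_iff, measure_singleton]
    filter_upwards [ae_restrict_of_ae this] with s hs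
    exact ((continuousAt_kern k hs).mul continuousAt_const).continuousWithinAt

theorem setIntegral_ite_lt {X s : ℝ} (hs : s ∈ Icc 0 X) (f : ℝ → ℝ) :
    ∫ x in Ioo 0 X, (if s < x then f x else 0) = ∫ x in s..X, f x := by
  have : (fun x => if s < x then f x else 0) = (Ioi s).indicator f := by
    ext x; simp [indicator]
  rw [this, setIntegral_indicator measurableSet_Ioi, intervalIntegral.integral_of_le hs.2,
    integral_Ioc_eq_integral_Ioo]
  congr 2
  ext x
  simp only [mem_inter_iff, mem_Ioo, mem_Ioi]
  constructor
  · rintro ⟨⟨_, h2⟩, h3⟩; exact ⟨h3, h2⟩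
  · rintro ⟨h1, h2⟩; exact ⟨⟨hs.1.trans_lt h1, h2⟩, h1⟩

/-- The truncated power is a fundamental solution of the derivative of order `k + 1`: each
integration by parts lowers the power by one, with no boundary term, since the power vanishes at `s`
and the test function at `X`. -/
theorem integral_kern_mul_test {X : ℝ} (k : ℕ) {φ : ℝ → ℝ} (h : IsTestI X φ) {s : ℝ}
    (hs : s ∈ Icc 0 X) :
    ∫ x in Ioo 0 X, kern k x s * iteratedDeriv (k + 1) φ x = (-1) ^ (k + 1) * φ s := by
  have e : ∀ k : ℕ, ∫ x in Ioo 0 X, kern k x s * iteratedDeriv (k + 1) φ x =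
      ∫ x in s..X, (x - s) ^ k / k.factorial * iteratedDeriv (k + 1) φ x := by
    intro k
    rw [← setIntegral_ite_lt hs]
    simp only [kern, ite_mul, zero_mul]
  rw [e]
  have hφX : ∀ k : ℕ, iteratedDeriv k φ X = 0 := fun k =>
    (h.iteratedDeriv k).zero_of_notMem (by simp)
  have hc : ∀ k : ℕ, Continuous (iteratedDeriv k φ) := fun k => (h.iteratedDeriv k).continuous
  induction k with
  | zero =>
    simp only [pow_zero, Nat.factorial_zero, Nat.cast_one, div_one, one_mul, zero_add]
    rw [intervalIntegral.integral_eq_sub_of_hasDerivAt (f := φ)]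
    · have := hφX 0; simp at this; simp [this]
    · intro x _
      simpa using h.hasDerivAt 0 x
    · exact (hc 1).intervalIntegrable _ _
  | succ k ih =>
    rw [intervalIntegral.integral_mul_deriv_eq_deriv_mul (v := iteratedDeriv (k + 1) φ)
      (u' := fun x => (x - s) ^ k / k.factorial)]
    · rw [hφX, ih]
      simp [pow_succ]
    · intro x _
      have h1 := (((hasDerivAt_id' x).sub_const s).fun_pow (k + 1)).div_const
        ((k + 1).factorial : ℝ)
      refine h1.congr_deriv ?_
      have : (k.factorial : ℝ) ≠ 0 := by positivity
      simp only [Nat.factorial_succ, Nat.add_sub_cancel]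
      push_cast
      field_simp
    · intro x _; exact h.hasDerivAt (k + 1) x
    · exact Continuous.intervalIntegrable (by fun_prop) _ _
    · exact (hc _).intervalIntegrable _ _

/-- Fubini reduces the claim to `integral_kern_mul_test` for each fixed `s`. -/
theorem weakEq_integral_kern {X : ℝ} (k : ℕ) {g : ℝ → ℝ} (hg : IntegrableOn g (Ioo 0 X)) :
    WeakEq X (k + 1) (fun x => ∫ s in Ioo 0 X, kern k x s * g s) g := by
  intro φ hφ
  have hψ := hφ.iteratedDeriv (k + 1)
  obtain ⟨C, hC⟩ := hψ.continuous.bounded_above_of_compact_support hψ.compact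
  calc ∫ x in Ioo 0 X, (∫ s in Ioo 0 X, kern k x s * g s) * iteratedDeriv (k + 1) φ x
      = ∫ x in Ioo 0 X, ∫ s in Ioo 0 X, kern k x s * g s * iteratedDeriv (k + 1) φ x := by
        simp only [integral_mul_const]
    _ = ∫ s in Ioo 0 X, ∫ x in Ioo 0 X, kern k x s * g s * iteratedDeriv (k + 1) φ x := by
        apply integral_integral_swap
        have h1 : Integrable (fun p : ℝ × ℝ => g p.2)
            ((volume.restrict (Ioo 0 X)).prod (volume.restrict (Ioo 0 X))) :=
          Integrable.comp_snd hg _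
        have h2 : Integrable (fun p : ℝ × ℝ => (kern k p.1 p.2 * iteratedDeriv (k + 1) φ p.1) *
            g p.2) ((volume.restrict (Ioo 0 X)).prod (volume.restrict (Ioo 0 X))) := by
          refine h1.bdd_mul (c := |X| ^ k * C) ?_ ?_
          · exact ((measurable_kern k).mul
              (hψ.continuous.measurable.comp measurable_fst)).aestronglyMeasurable
          · rw [Measure.prod_restrict]
            filter_upwards [ae_restrict_mem (measurableSet_Ioo.prod measurableSet_Ioo)] with p hp
            rw [norm_mul]
            have := hp.1.2
            have := hp.2.1
            refine mul_le_mul (abs_kern_le ?_ (abs_nonneg _)) (hC _) (norm_nonneg _) (by positivity)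
            linarith [le_abs_self X]
        refine h2.congr (Filter.Eventually.of_forall fun p => ?_)
        simp only [Function.uncurry]; ring
    _ = ∫ s in Ioo 0 X, (-1) ^ (k + 1) * (g s * φ s) := by
        refine setIntegral_congr_fun measurableSet_Ioo fun s hs => ?_
        simp only [mul_right_comm _ (g s), integral_mul_const]
        rw [integral_kern_mul_test k hφ (Ioo_subset_Icc_self hs)]
        ring
    _ = _ := integral_const_mul _ _

theorem WeakEq.sub {X : ℝ} {k : ℕ} {w g w' g' : ℝ → ℝ} (h : WeakEq X k w g)
    (h' : WeakEq X k w' g') (hw : IntegrableOn w (Ioo 0 X)) (hg : IntegrableOn g (Ioo 0 X))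
    (hw' : IntegrableOn w' (Ioo 0 X)) (hg' : IntegrableOn g' (Ioo 0 X)) :
    WeakEq X k (fun x => w x - w' x) (fun x => g x - g' x) := by
  intro φ hφ
  simp only [sub_mul]
  rw [integral_sub (integrable_mul_test hw (hφ.iteratedDeriv k))
    (integrable_mul_test hw' (hφ.iteratedDeriv k)),
    integral_sub (integrable_mul_test hg hφ) (integrable_mul_test hg' hφ), h φ hφ, h' φ hφ, mul_sub]

theorem _root_.ContinuousOn.integrableOn_Ioo {X : ℝ} {w : ℝ → ℝ} (hw : ContinuousOn w (Icc 0 X)) :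
    IntegrableOn w (Ioo 0 X) :=
  (hw.integrableOn_compact isCompact_Icc).mono_set Ioo_subset_Icc_self

/-- Taylor's formula for a continuous function with an integrable weak derivative. -/
theorem WeakEq.taylor {X : ℝ} (hX : 0 < X) {k : ℕ} {w g : ℝ → ℝ} (hw : ContinuousOn w (Icc 0 X))
    (hg : IntegrableOn g (Ioo 0 X)) (h : WeakEq X (k + 1) w g) :
    ∃ c : ℕ → ℝ, ∀ x ∈ Icc 0 X, w x = ∑ j ∈ Finset.range (k + 1), c j * x ^ j +
      ∫ s in Ioo 0 X, kern k x s * g s := by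
  have hJ := continuousOn_integral_kern k hg
  have := h.sub (weakEq_integral_kern k hg) hw.integrableOn_Ioo hg hJ.integrableOn_Ioo hg
  obtain ⟨c, hc⟩ := eq_polynomial_of_weakEq hX (k + 1) (hw.sub hJ) (by
    simpa only [sub_self] using! this)
  exact ⟨c, fun x hx => eq_add_of_sub_eq (hc x hx)⟩

/-! ### Continuous functionals on `C[0, X]` and their Peano kernels -/

/-- `L` acts on functions continuous on `[0, X]` as a continuous linear functional on `C[0, X]`. -/
def IsFun (X : ℝ) (L : (ℝ → ℝ) → ℝ) : Prop :=
  ∃ Λ : C(Icc (0 : ℝ) X, ℝ) →L[ℝ] ℝ, ∀ (W : ℝ → ℝ) (hW : ContinuousOn W (Icc 0 X)),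
    L W = Λ ⟨(Icc 0 X).domRestrict W, hW.domRestrict⟩

theorem isFun_eval {X p : ℝ} (hp : p ∈ Icc 0 X) : IsFun X (fun W => W p) :=
  ⟨ContinuousMap.evalCLM ℝ ⟨p, hp⟩, fun _ _ => rfl⟩

theorem isFun_integral {X : ℝ} (hX : 0 ≤ X) {ρ : ℝ → ℝ} (hρ : IntegrableOn ρ (Ioo 0 X)) :
    IsFun X (fun W => ∫ x in Ioo 0 X, ρ x * W x) := by
  have hi : ∀ w : C(Icc (0 : ℝ) X, ℝ), IntegrableOn (fun x => ρ x * IccExtend hX w x) (Ioo 0 X) :=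
    fun w => hρ.mul_bdd (c := ‖w‖) (w.continuous.Icc_extend' (h := hX)).aestronglyMeasurable
      (Filter.Eventually.of_forall fun x => w.norm_coe_le_norm _)
  refine ⟨LinearMap.mkContinuous
    { toFun := fun w => ∫ x in Ioo 0 X, ρ x * IccExtend hX w x
      map_add' := fun v w => ?_
      map_smul' := fun c w => ?_ } (∫ x in Ioo 0 X, ‖ρ x‖) fun w => ?_, fun W hW => ?_⟩
  · rw [← integral_add (hi v) (hi w)]
    congr 1; ext x
    simp only [IccExtend, Function.comp, ContinuousMap.coe_add, Pi.add_apply]; ring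
  · simp only [RingHom.id_apply, smul_eq_mul]
    rw [← integral_const_mul]
    congr 1; ext x
    simp only [IccExtend, Function.comp, ContinuousMap.coe_smul, Pi.smul_apply, smul_eq_mul]; ring
  · rw [← integral_mul_const]
    refine norm_integral_le_of_norm_le (hρ.norm.mul_const _) (Filter.Eventually.of_forall fun x => ?_)
    rw [norm_mul]
    exact mul_le_mul_of_nonneg_left (w.norm_coe_le_norm _) (norm_nonneg _)
  · refine setIntegral_congr_fun measurableSet_Ioo fun x hx => ?_
    simp only [IccExtend, Function.comp]
    rw [projIcc_of_mem _ (Ioo_subset_Icc_self hx)]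
    rfl

theorem IsFun.add {X : ℝ} {L L' : (ℝ → ℝ) → ℝ} (h : IsFun X L) (h' : IsFun X L') :
    IsFun X (fun W => L W + L' W) := by
  obtain ⟨Λ, hΛ⟩ := h
  obtain ⟨Λ', hΛ'⟩ := h'
  exact ⟨Λ + Λ', fun W hW => by simp only [hΛ W hW, hΛ' W hW, _root_.add_apply]⟩

theorem IsFun.const_mul {X : ℝ} {L : (ℝ → ℝ) → ℝ} (h : IsFun X L) (c : ℝ) :
    IsFun X (fun W => c * L W) := by
  obtain ⟨Λ, hΛ⟩ := h
  exact ⟨c • Λ, fun W hW => by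
    simp only [hΛ W hW, _root_.smul_apply, smul_eq_mul]⟩

theorem IsFun.sub {X : ℝ} {L L' : (ℝ → ℝ) → ℝ} (h : IsFun X L) (h' : IsFun X L') :
    IsFun X (fun W => L W - L' W) := by
  simpa [sub_eq_add_neg] using! h.add (h'.const_mul (-1))

theorem IsFun.congr {X : ℝ} {L : (ℝ → ℝ) → ℝ} (h : IsFun X L) {V W : ℝ → ℝ}
    (hV : ContinuousOn V (Icc 0 X)) (hVW : EqOn V W (Icc 0 X)) : L V = L W := by
  obtain ⟨Λ, hΛ⟩ := h
  rw [hΛ V hV, hΛ W (hV.congr hVW.symm)]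
  congr 1
  ext x
  exact hVW x.2

theorem IsFun.map_add {X : ℝ} {L : (ℝ → ℝ) → ℝ} (h : IsFun X L) {V W : ℝ → ℝ}
    (hV : ContinuousOn V (Icc 0 X)) (hW : ContinuousOn W (Icc 0 X)) :
    L (fun x => V x + W x) = L V + L W := by
  obtain ⟨Λ, hΛ⟩ := h
  rw [hΛ V hV, hΛ W hW, hΛ (fun x => V x + W x) (hV.add hW), ← _root_.map_add]
  rfl

theorem IsFun.map_const_mul {X : ℝ} {L : (ℝ → ℝ) → ℝ} (h : IsFun X L) {V : ℝ → ℝ}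
    (hV : ContinuousOn V (Icc 0 X)) (c : ℝ) : L (fun x => c * V x) = c * L V := by
  obtain ⟨Λ, hΛ⟩ := h
  rw [hΛ V hV, hΛ (fun x => c * V x) (continuousOn_const.mul hV), ← smul_eq_mul, ← _root_.map_smul]
  rfl

theorem IsFun.map_sub {X : ℝ} {L : (ℝ → ℝ) → ℝ} (h : IsFun X L) {V W : ℝ → ℝ}
    (hV : ContinuousOn V (Icc 0 X)) (hW : ContinuousOn W (Icc 0 X)) :
    L (fun x => V x - W x) = L V - L W := by
  obtain ⟨Λ, hΛ⟩ := h
  rw [hΛ V hV, hΛ W hW, hΛ (fun x => V x - W x) (hV.sub hW), ← _root_.map_sub]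
  rfl

/-- A functional commutes with integrals of families of continuous functions. -/
theorem IsFun.map_integral {X : ℝ} {L : (ℝ → ℝ) → ℝ} (h : IsFun X L) {μ : Measure ℝ}
    {w : ℝ → C(Icc (0 : ℝ) X, ℝ)} (hw : Integrable w μ) {W : ℝ → ℝ → ℝ}
    (hW : ∀ᵐ s ∂μ, ∀ x : Icc (0 : ℝ) X, W s x = w s x) :
    ContinuousOn (fun x => ∫ s, W s x ∂μ) (Icc 0 X) ∧
      L (fun x => ∫ s, W s x ∂μ) = ∫ s, L (W s) ∂μ := by
  have e : ∀ x : Icc (0 : ℝ) X, ∫ s, W s x ∂μ = (∫ s, w s ∂μ) x := by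
    intro x
    rw [← ContinuousMap.evalCLM_apply ℝ x (∫ s, w s ∂μ), ← ContinuousLinearMap.integral_comp_comm _ hw]
    refine integral_congr_ae ?_
    filter_upwards [hW] with s hs
    simp [hs x]
  have hc : ContinuousOn (fun x => ∫ s, W s x ∂μ) (Icc 0 X) := by
    rw [continuousOn_iff_continuous_domRestrict]
    exact (∫ s, w s ∂μ).continuous.congr fun x => (e x).symm
  refine ⟨hc, ?_⟩
  obtain ⟨Λ, hΛ⟩ := h
  rw [hΛ _ hc]
  have : (⟨(Icc 0 X).domRestrict fun x => ∫ s, W s x ∂μ, hc.domRestrict⟩ : C(Icc (0 : ℝ) X, ℝ)) =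
      ∫ s, w s ∂μ := by
    ext x; exact e x
  rw [this, ← ContinuousLinearMap.integral_comp_comm _ hw]
  refine integral_congr_ae ?_
  filter_upwards [hW] with s hs
  have hcs : ContinuousOn (W s) (Icc 0 X) := by
    rw [continuousOn_iff_continuous_domRestrict]
    exact (w s).continuous.congr fun x => (hs x).symm
  rw [hΛ _ hcs]
  congr 1
  ext x; exact (hs x).symm

/-- The functional `L` is the integral of the weak `k`-th derivative against the kernel `K`. -/
def Represents (X : ℝ) (k : ℕ) (L : (ℝ → ℝ) → ℝ) (K : ℝ → ℝ) : Prop :=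
  ∀ W g : ℝ → ℝ, ContinuousOn W (Icc 0 X) → IntegrableOn g (Ioo 0 X) → WeakEq X k W g →
    L W = ∫ x in Ioo 0 X, K x * g x

theorem represents_test {X : ℝ} (k : ℕ) {φ : ℝ → ℝ} (hφ : IsTestI X φ) :
    Represents X k (fun W => ∫ x in Ioo 0 X, iteratedDeriv k φ x * W x)
      (fun x => (-1) ^ k * φ x) := by
  intro W g _ _ h
  have := h φ hφ
  simp only [mul_assoc, integral_const_mul]
  simp only [mul_comm _ (W _), mul_comm _ (g _), this]

theorem represents_zero {X : ℝ} (ρ : ℝ → ℝ) :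
    Represents X 0 (fun W => ∫ x in Ioo 0 X, ρ x * W x) ρ := by
  intro W g hW hg h
  refine integral_congr_ae ?_
  filter_upwards [ae_eq_of_weakEq_zero hW.integrableOn_Ioo hg h] with x hx
  rw [hx]

theorem continuous_kern {k : ℕ} (hk : k ≠ 0) : Continuous fun p : ℝ × ℝ => kern k p.1 p.2 := by
  have : (fun p : ℝ × ℝ => kern k p.1 p.2) =
      fun p : ℝ × ℝ => (max (p.1 - p.2) 0) ^ k / k.factorial := by
    ext p
    unfold kern
    split_ifs with h
    · rw [max_eq_left (by linarith)]
    · rw [max_eq_right (by linarith), zero_pow hk, zero_div]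
  rw [this]
  fun_prop

/-- The functional `L` vanishes on polynomials of degree less than `k`. -/
def KillsPoly (k : ℕ) (L : (ℝ → ℝ) → ℝ) : Prop :=
  ∀ c : ℕ → ℝ, L (fun x => ∑ j ∈ Finset.range k, c j * x ^ j) = 0

/-- The curve `s ↦ (· - s)_+^k / k!` in `C[0, X]`. -/
noncomputable def kernCurve (X : ℝ) {k : ℕ} (hk : k ≠ 0) : C(ℝ, C(Icc (0 : ℝ) X, ℝ)) :=
  ContinuousMap.curry ⟨fun p : ℝ × Icc (0 : ℝ) X => kern k p.2 p.1,
    (continuous_kern hk).comp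
      ((continuous_subtype_val.comp continuous_snd).prodMk continuous_fst)⟩

theorem continuous_kern_left {k : ℕ} (hk : k ≠ 0) (s : ℝ) : Continuous fun x => kern k x s :=
  (continuous_kern hk).comp (Continuous.prodMk_left s)

/-- For `k ≠ 0` the truncated powers form a continuous curve in `C[0, X]`; for `k = 0` they jump and
are not even elements of that space. -/
theorem IsFun.continuous_peano {X : ℝ} {L : (ℝ → ℝ) → ℝ} (h : IsFun X L) {k : ℕ} (hk : k ≠ 0) :
    Continuous fun s => L (fun x => kern k x s) := by
  obtain ⟨Λ, hΛ⟩ := h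
  exact (Λ.continuous.comp (kernCurve X hk).continuous).congr fun s =>
    (hΛ (fun x => kern k x s) (continuous_kern_left hk s).continuousOn).symm

theorem IsFun.map_integral_kern {X : ℝ} (hX : 0 ≤ X) {L : (ℝ → ℝ) → ℝ} (h : IsFun X L) {k : ℕ}
    (hk : k ≠ 0) {g : ℝ → ℝ} (hg : IntegrableOn g (Ioo 0 X)) :
    L (fun x => ∫ s in Ioo 0 X, kern k x s * g s) =
      ∫ s in Ioo 0 X, L (fun x => kern k x s) * g s := by
  have hint : IntegrableOn (fun s => g s • kernCurve X hk s) (Ioo 0 X) := by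
    refine Integrable.mono' (g := fun s => X ^ k * ‖g s‖) (hg.norm.const_mul _)
      (hg.aestronglyMeasurable.smul (kernCurve X hk).continuous.aestronglyMeasurable) ?_
    filter_upwards [ae_restrict_mem measurableSet_Ioo] with s hs
    rw [norm_smul, mul_comm]
    refine mul_le_mul_of_nonneg_right ?_ (norm_nonneg _)
    rw [ContinuousMap.norm_le _ (by positivity)]
    intro x
    exact abs_kern_le (by linarith [x.2.2, hs.1]) hX
  rw [(h.map_integral hint (W := fun s x => kern k x s * g s)
    (Filter.Eventually.of_forall fun s x => mul_comm _ _)).2]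
  congr 1; ext s
  simp only [mul_comm _ (g s)]
  rw [h.map_const_mul (continuous_kern_left hk s).continuousOn]

/-- Peano's kernel theorem: `L` is applied to the Taylor formula, kills the polynomial part and
passes under the integral of the remainder. -/
theorem IsFun.represents_peano {X : ℝ} (hX : 0 < X) {L : (ℝ → ℝ) → ℝ} (h : IsFun X L) {k : ℕ}
    (hk : k ≠ 0) (hL : KillsPoly (k + 1) L) :
    Represents X (k + 1) L (fun s => L (fun x => kern k x s)) := by
  intro W g hW hg hWg
  obtain ⟨c, hc⟩ := hWg.taylor hX hW hg
  have hp : ContinuousOn (fun x : ℝ => ∑ j ∈ Finset.range (k + 1), c j * x ^ j) (Icc 0 X) := by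
    fun_prop
  rw [h.congr hW hc, h.map_add hp (continuousOn_integral_kern k hg), hL c, zero_add,
    h.map_integral_kern hX.le hk hg]

/-- The value of `L` is bounded by `C` times the maximum over `[α, β]`. -/
def WindowBound (α β C : ℝ) (L : (ℝ → ℝ) → ℝ) : Prop :=
  ∀ (W : ℝ → ℝ) (m : ℝ), (∀ x ∈ Icc α β, |W x| ≤ m) → |L W| ≤ C * m

/-- The kernel is local on both sides. For `s` to the right of the window the truncated power
vanishes there; for `s` to the left it coincides on the window with a full polynomial of degree `k`,
which `L` kills. Inside, the truncated power is at most `(β - α)^k`. -/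
theorem IsFun.peano_bound {X α β C : ℝ} {L : (ℝ → ℝ) → ℝ} (h : IsFun X L) {k : ℕ}
    (hk : k ≠ 0) (hL : KillsPoly (k + 1) L) (hb : WindowBound α β C L) (hαβ : α ≤ β)
    (s : ℝ) :
    |L (fun x => kern k x s)| ≤ (Icc α β).indicator (fun _ => C * (β - α) ^ k) s := by
  by_cases hs : s ∈ Icc α β
  · rw [indicator_of_mem hs]
    refine hb _ _ fun x hx => abs_kern_le ?_ (by linarith)
    linarith [hs.1, hx.2]
  · rw [indicator_of_notMem hs]
    rw [mem_Icc, not_and_or, not_le, not_le] at hs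
    have hz : ∀ W : ℝ → ℝ, (∀ x ∈ Icc α β, W x = 0) → L W = 0 := fun W hW => by
      simpa using hb W 0 fun x hx => by simp [hW x hx]
    rw [abs_nonpos_iff]
    rcases hs with hs | hs
    · have e : ∀ x : ℝ, (x - s) ^ k / k.factorial = ∑ j ∈ Finset.range (k + 1),
          ((-s) ^ (k - j) * k.choose j / k.factorial) * x ^ j := by
        intro x
        rw [sub_eq_add_neg, add_pow, Finset.sum_div]
        refine Finset.sum_congr rfl fun j _ => by ring
      have h0 := hL fun j => (-s) ^ (k - j) * k.choose j / k.factorial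
      simp only [← e] at h0
      have h1 := h.map_sub (V := fun x => kern k x s) (W := fun x => (x - s) ^ k / k.factorial)
        (continuous_kern_left hk s).continuousOn (by fun_prop)
      rw [h0, sub_zero, hz] at h1
      · exact h1.symm
      · intro x hx
        rw [kern, if_pos (by linarith [hx.1]), sub_self]
    · refine hz _ fun x hx => ?_
      rw [kern, if_neg (by linarith [hx.2])]

/-! ### The mesh functionals -/

theorem hat_nonneg (d : ℝ) (j : ℕ) (s : ℝ) : 0 ≤ hat d j s := le_max_right _ _

theorem hat_le_one (d : ℝ) (j : ℕ) (s : ℝ) : hat d j s ≤ 1 :=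
  max_le (by linarith [abs_nonneg (s / d - j)]) zero_le_one

theorem continuous_hat (d : ℝ) (j : ℕ) : Continuous (hat d j) := by
  unfold hat
  fun_prop

theorem hat_eq_zero {d : ℝ} (hd : 0 < d) {j : ℕ} {s : ℝ}
    (hs : s ∉ Ioo (((j : ℝ) - 1) * d) (((j : ℝ) + 1) * d)) : hat d j s = 0 := by
  unfold hat
  apply max_eq_right
  by_contra hc
  apply hs
  have h1 : |s / d - j| < 1 := by linarith
  rw [abs_lt] at h1
  constructor
  · rw [← lt_div_iff₀ hd]; linarith
  · rw [← div_lt_iff₀ hd]; linarith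

theorem qH_eq_setIntegral {X h : ℝ} (hh : 0 < h) {i : ℕ} (hi : 1 ≤ i)
    (hX : ((i : ℝ) + 1) * h ≤ X) (W : ℝ → ℝ) :
    qH h W i = ∫ x in Ioo 0 X, hat h i x / h * W x := by
  have hi' : (1 : ℝ) ≤ i := by exact_mod_cast hi
  have hsub : Ioo (((i : ℝ) - 1) * h) (((i : ℝ) + 1) * h) ⊆ Ioo 0 X :=
    Ioo_subset_Ioo (mul_nonneg (by linarith) hh.le) hX
  rw [qH, intervalIntegral.integral_of_le (by nlinarith), integral_Ioc_eq_integral_Ioo,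
    ← integral_const_mul]
  have e := setIntegral_eq_of_subset_of_forall_sdiff_eq_zero (μ := volume) measurableSet_Ioo hsub
    (f := fun x => hat h i x / h * W x) fun x hx => by rw [hat_eq_zero hh hx.2]; simp
  rw [e]
  refine setIntegral_congr_fun measurableSet_Ioo fun x _ => ?_
  ring

theorem isFun_qH {X h : ℝ} (hh : 0 < h) {i : ℕ} (hi : 1 ≤ i) (hX : ((i : ℝ) + 1) * h ≤ X) :
    IsFun X (fun W => qH h W i) := by
  have hX0 : 0 ≤ X := le_trans (by positivity) hX
  simp only [qH_eq_setIntegral hh hi hX]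
  refine isFun_integral hX0 (ContinuousOn.integrableOn_Ioo ?_)
  exact ((continuous_hat h i).div_const h).continuousOn

theorem isFun_node {X h : ℝ} (hh : 0 < h) {j : ℕ} (hX : (j : ℝ) * h ≤ X) :
    IsFun X (fun W => nodal h W j) :=
  isFun_eval ⟨by positivity, hX⟩

theorem node_le {X h : ℝ} (hh : 0 < h) {i j : ℕ} (hX : ((i : ℝ) + 1) * h ≤ X) (hj : j ≤ i + 1) :
    (j : ℝ) * h ≤ X := by
  have : (j : ℝ) ≤ i + 1 := by exact_mod_cast hj
  nlinarith

theorem isFun_lamX {X h : ℝ} (hh : 0 < h) {i : ℕ} (hX : ((i : ℝ) + 1) * h ≤ X) :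
    IsFun X (fun W => lamX h (nodal h W) i) := by
  have h1 := isFun_node hh (node_le hh hX (show i - 1 ≤ i + 1 by omega))
  have h2 := isFun_node hh (node_le hh hX (show i ≤ i + 1 by omega))
  have h3 := isFun_node hh (node_le hh hX (show i + 1 ≤ i + 1 by omega))
  have := ((h1.sub (h2.const_mul 2)).add h3).const_mul (1 / h ^ 2)
  convert this using 2 with W
  unfold lamX; ring

theorem isFun_sN {X h : ℝ} (hh : 0 < h) {i : ℕ} (hX : ((i : ℝ) + 1) * h ≤ X) :
    IsFun X (fun W => sN (nodal h W) i) := by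
  have h1 := isFun_node hh (node_le hh hX (show i - 1 ≤ i + 1 by omega))
  have h2 := isFun_node hh (node_le hh hX (show i ≤ i + 1 by omega))
  have h3 := isFun_node hh (node_le hh hX (show i + 1 ≤ i + 1 by omega))
  have := ((h1.add (h2.const_mul 10)).add h3).const_mul (1 / 12)
  convert this using 2 with W
  unfold sN; ring

/-- The Numerov defect `s_N - q_h` at the node `i`. -/
noncomputable def numDefect (h : ℝ) (i : ℕ) (W : ℝ → ℝ) : ℝ := sN (nodal h W) i - qH h W i

theorem isFun_numDefect {X h : ℝ} (hh : 0 < h) {i : ℕ} (hi : 1 ≤ i)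
    (hX : ((i : ℝ) + 1) * h ≤ X) : IsFun X (numDefect h i) :=
  (isFun_sN hh hX).sub (isFun_qH hh hi hX)

/-- Rescaling to the unit cell and folding at the node removes the absolute value in the hat
function, so that moments become polynomial integrals. -/
theorem qH_eq_unit {h : ℝ} (hh : 0 < h) (i : ℕ) {W : ℝ → ℝ} (hW : Continuous W) :
    qH h W i = ∫ y in (0 : ℝ)..1, (W ((i + y) * h) + W ((i - y) * h)) * (1 - y) := by
  have hc : Continuous fun y : ℝ => W ((i + y) * h) * max (1 - |y|) 0 := by fun_prop
  have e1 : qH h W i = ∫ y in (-1 : ℝ)..1, W ((i + y) * h) * max (1 - |y|) 0 := by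
    have := intervalIntegral.integral_comp_add_mul (a := -1) (b := 1)
      (fun x => W x * hat h i x) hh.ne' ((i : ℝ) * h)
    rw [qH, one_div, ← smul_eq_mul, show ((i : ℝ) - 1) * h = i * h + h * (-1) by ring,
      show ((i : ℝ) + 1) * h = i * h + h * 1 by ring, ← this]
    refine intervalIntegral.integral_congr fun y _ => ?_
    simp only [hat]
    rw [show (i * h + h * y) / h - i = y by field_simp; ring,
      show (i : ℝ) * h + h * y = (i + y) * h by ring]
  have e2 : ∫ y in (-1 : ℝ)..0, W ((i + y) * h) * max (1 - |y|) 0 =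
      ∫ y in (0 : ℝ)..1, W ((i - y) * h) * (1 - y) := by
    have := intervalIntegral.integral_comp_neg (a := 0) (b := 1)
      (fun y : ℝ => W ((i + y) * h) * max (1 - |y|) 0)
    rw [neg_zero] at this
    rw [← this]
    refine intervalIntegral.integral_congr fun y hy => ?_
    rw [uIcc_of_le zero_le_one] at hy
    simp only [abs_neg, abs_of_nonneg hy.1, ← sub_eq_add_neg]
    rw [max_eq_left (by linarith [hy.2])]
  have e3 : ∫ y in (0 : ℝ)..1, W ((i + y) * h) * max (1 - |y|) 0 =
      ∫ y in (0 : ℝ)..1, W ((i + y) * h) * (1 - y) := by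
    refine intervalIntegral.integral_congr fun y hy => ?_
    rw [uIcc_of_le zero_le_one] at hy
    simp only [abs_of_nonneg hy.1]
    rw [max_eq_left (by linarith [hy.2])]
  rw [e1, ← intervalIntegral.integral_add_adjacent_intervals (b := 0)
    (hc.intervalIntegrable _ _) (hc.intervalIntegrable _ _), e2, e3,
    ← intervalIntegral.integral_add]
  · refine intervalIntegral.integral_congr fun y _ => ?_
    ring
  · exact Continuous.intervalIntegrable (by fun_prop) _ _
  · exact Continuous.intervalIntegrable (by fun_prop) _ _

theorem qH_cubic {h : ℝ} (hh : 0 < h) (i : ℕ) (a b c d : ℝ) :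
    qH h (fun x => a + b * x + c * x ^ 2 + d * x ^ 3) i =
      a + b * (i * h) + c * ((i : ℝ) ^ 2 + 1 / 6) * h ^ 2 + d * ((i : ℝ) ^ 3 + i / 2) * h ^ 3 := by
  rw [qH_eq_unit hh i (by fun_prop)]
  have : ∀ y : ℝ, (a + b * ((i + y) * h) + c * ((i + y) * h) ^ 2 + d * ((i + y) * h) ^ 3 +
      (a + b * ((i - y) * h) + c * ((i - y) * h) ^ 2 + d * ((i - y) * h) ^ 3)) * (1 - y) =
      (2 * a + 2 * b * i * h + 2 * c * h ^ 2 * (i : ℝ) ^ 2 + 2 * d * h ^ 3 * (i : ℝ) ^ 3) +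
      (-(2 * a + 2 * b * i * h + 2 * c * h ^ 2 * (i : ℝ) ^ 2 + 2 * d * h ^ 3 * (i : ℝ) ^ 3)) * y ^ 1 +
      (2 * c * h ^ 2 + 6 * d * h ^ 3 * i) * y ^ 2 +
      (-(2 * c * h ^ 2 + 6 * d * h ^ 3 * i)) * y ^ 3 := fun y => by ring
  simp only [this]
  rw [intervalIntegral.integral_add, intervalIntegral.integral_add, intervalIntegral.integral_add]
  · simp only [intervalIntegral.integral_const, intervalIntegral.integral_const_mul, integral_pow,
      smul_eq_mul]
    norm_num
    ring
  all_goals exact Continuous.intervalIntegrable (by fun_prop) _ _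

theorem killsPoly_of_cubic {L : (ℝ → ℝ) → ℝ}
    (h : ∀ a b c d : ℝ, L (fun x => a + b * x + c * x ^ 2 + d * x ^ 3) = 0) : KillsPoly 4 L := by
  intro c
  have := h (c 0) (c 1) (c 2) (c 3)
  simpa [Finset.sum_range_succ] using this

theorem killsPoly_of_linear {L : (ℝ → ℝ) → ℝ}
    (h : ∀ a b : ℝ, L (fun x => a + b * x) = 0) : KillsPoly 2 L := by
  intro c
  have := h (c 0) (c 1)
  simpa [Finset.sum_range_succ] using this

theorem lamX_cubic {h : ℝ} (hh : 0 < h) {i : ℕ} (hi : 1 ≤ i) (a b c d : ℝ) :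
    lamX h (nodal h fun x => a + b * x + c * x ^ 2 + d * x ^ 3) i = 2 * c + 6 * d * (i * h) := by
  obtain ⟨j, rfl⟩ : ∃ j, i = j + 1 := ⟨i - 1, by omega⟩
  simp only [lamX, nodal, Nat.add_sub_cancel]
  push_cast
  field_simp
  ring

theorem sN_eq {h : ℝ} (hh : 0 < h) (w : ℕ → ℝ) (i : ℕ) :
    sN w i = w i + h ^ 2 / 12 * lamX h w i := by
  unfold sN lamX
  field_simp
  ring

/-- This is the source of the fourth order: on cubics both `s_N` and `q_h` act as `W ↦ W + (h²/12)
W''` at the node. -/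
theorem killsPoly_numDefect {h : ℝ} (hh : 0 < h) {i : ℕ} (hi : 1 ≤ i) :
    KillsPoly 4 (numDefect h i) := by
  refine killsPoly_of_cubic fun a b c d => ?_
  rw [numDefect, sN_eq hh, lamX_cubic hh hi, qH_cubic hh]
  simp only [nodal]
  ring

theorem killsPoly_lamX {h : ℝ} (hh : 0 < h) {i : ℕ} (hi : 1 ≤ i) :
    KillsPoly 2 (fun W => lamX h (nodal h W) i) := by
  refine killsPoly_of_linear fun a b => ?_
  simpa using lamX_cubic hh hi a b 0 0

theorem kern_one (x s : ℝ) : kern 1 x s = max (x - s) 0 := by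
  unfold kern
  split_ifs with h
  · rw [max_eq_left (by linarith)]; simp
  · rw [max_eq_right (by linarith)]

/-- The second difference of a ramp is a hat function. -/
theorem peano_lamX {h : ℝ} (hh : 0 < h) {i : ℕ} (hi : 1 ≤ i) (s : ℝ) :
    lamX h (nodal h fun x => kern 1 x s) i = hat h i s / h := by
  obtain ⟨j, rfl⟩ : ∃ j, i = j + 1 := ⟨i - 1, by omega⟩
  obtain ⟨y, rfl⟩ : ∃ y, s = (j + 1 + y) * h := ⟨s / h - j - 1, by field_simp; ring⟩
  have e : ∀ z : ℝ, max (z * h) 0 = max z 0 * h := fun z => by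
    rw [max_mul_of_nonneg _ _ hh.le, zero_mul]
  simp only [lamX, nodal, Nat.add_sub_cancel, kern_one, hat]
  push_cast
  rw [show (j : ℝ) * h - (j + 1 + y) * h = (-1 - y) * h by ring,
    show ((j : ℝ) + 1) * h - (j + 1 + y) * h = (-y) * h by ring,
    show ((j : ℝ) + 1 + 1) * h - (j + 1 + y) * h = (1 - y) * h by ring,
    show ((j : ℝ) + 1 + y) * h / h - (j + 1) = y by field_simp; ring, e, e, e]
  have key : max (-1 - y) 0 - 2 * max (-y) 0 + max (1 - y) 0 = max (1 - |y|) 0 := by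
    rcases le_total 0 y with hy | hy
    · rw [abs_of_nonneg hy, max_eq_right (by linarith : -1 - y ≤ 0),
        max_eq_right (by linarith : -y ≤ 0)]
      ring
    · rw [abs_of_nonpos hy, max_eq_left (by linarith : 0 ≤ -y),
        max_eq_left (by linarith : 0 ≤ 1 - y)]
      rcases le_total (-1) y with h1 | h1
      · rw [max_eq_right (by linarith), max_eq_left (by linarith)]; ring
      · rw [max_eq_left (by linarith), max_eq_right (by linarith)]; ring
  rw [← key]
  field_simp

/-- The identity `Λ_x = q_h ∂_x²`. With `τ`, `T` in place of `h`, `X` it also serves as `Λ_t = q_τ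
∂_t²`. -/
theorem represents_lamX {X h : ℝ} (hh : 0 < h) {i : ℕ} (hi : 1 ≤ i)
    (hX : ((i : ℝ) + 1) * h ≤ X) :
    Represents X 2 (fun W => lamX h (nodal h W) i) (fun s => hat h i s / h) := by
  have hX0 : 0 < X := lt_of_lt_of_le (by positivity) hX
  have := (isFun_lamX hh hX).represents_peano hX0 one_ne_zero (killsPoly_lamX hh hi)
  simpa only [peano_lamX hh hi] using this

theorem abs_qH_le {h : ℝ} (hh : 0 < h) (i : ℕ) {W : ℝ → ℝ} {m : ℝ}
    (hW : ∀ x ∈ Icc (((i : ℝ) - 1) * h) (((i : ℝ) + 1) * h), |W x| ≤ m) : |qH h W i| ≤ 2 * m := by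
  rw [qH, abs_mul, abs_of_pos (by positivity : 0 < 1 / h)]
  have := intervalIntegral.norm_integral_le_of_norm_le_const (a := ((i : ℝ) - 1) * h)
    (b := ((i : ℝ) + 1) * h) (C := m) (f := fun x => W x * hat h i x) (fun x hx => by
      rw [uIoc_of_le (by nlinarith)] at hx
      rw [norm_mul, Real.norm_eq_abs, Real.norm_eq_abs, abs_of_nonneg (hat_nonneg _ _ _)]
      have := hW x (Ioc_subset_Icc_self hx)
      nlinarith [hat_nonneg h i x, hat_le_one h i x, abs_nonneg (W x)])
  rw [show ((i : ℝ) + 1) * h - (i - 1) * h = 2 * h by ring, abs_of_pos (by positivity),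
    Real.norm_eq_abs] at this
  calc 1 / h * _ ≤ 1 / h * (m * (2 * h)) := mul_le_mul_of_nonneg_left this (by positivity)
    _ = 2 * m := by field_simp

/-- The constant is `3 = 1 + 2`: the weights of `s_N` sum to one, and `2` is the crude bound of
`q_h` from a window of length `2h`. -/
theorem windowBound_numDefect {h : ℝ} (hh : 0 < h) {i : ℕ} (hi : 1 ≤ i) :
    WindowBound (((i : ℝ) - 1) * h) (((i : ℝ) + 1) * h) 3 (numDefect h i) := by
  intro W m hW
  have hq := abs_qH_le hh i hW
  obtain ⟨j, rfl⟩ : ∃ j, i = j + 1 := ⟨i - 1, by omega⟩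
  push_cast at hW
  have h1 := abs_le.1 (hW (j * h) ⟨by nlinarith, by nlinarith⟩)
  have h2 := abs_le.1 (hW ((j + 1) * h) ⟨by nlinarith, by nlinarith⟩)
  have h3 := abs_le.1 (hW ((j + 1 + 1) * h) ⟨by nlinarith, by nlinarith⟩)
  have hq' := abs_le.1 hq
  rw [numDefect, abs_le]
  simp only [sN, nodal, Nat.add_sub_cancel]
  push_cast
  constructor <;> linarith [h1.1, h1.2, h2.1, h2.2, h3.1, h3.2, hq'.1, hq'.2]

/-- The Peano kernel of the Numerov defect. -/
noncomputable def defectKern (h : ℝ) (i : ℕ) (s : ℝ) : ℝ := numDefect h i (fun x => kern 3 x s)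

theorem represents_numDefect {X h : ℝ} (hh : 0 < h) {i : ℕ} (hi : 1 ≤ i)
    (hX : ((i : ℝ) + 1) * h ≤ X) : Represents X 4 (numDefect h i) (defectKern h i) :=
  (isFun_numDefect hh hi hX).represents_peano (lt_of_lt_of_le (by positivity) hX) three_ne_zero
    (killsPoly_numDefect hh hi)

theorem continuous_defectKern {h : ℝ} (hh : 0 < h) {i : ℕ} (hi : 1 ≤ i) :
    Continuous (defectKern h i) :=
  -- The kernel does not depend on the ambient interval, so the smallest admissible right end `(i +
  -- 1) h` is taken.
  (isFun_numDefect hh hi le_rfl).continuous_peano three_ne_zero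

theorem abs_defectKern_le {h : ℝ} (hh : 0 < h) {i : ℕ} (hi : 1 ≤ i) (s : ℝ) :
    |defectKern h i s| ≤
      (Icc (((i : ℝ) - 1) * h) (((i : ℝ) + 1) * h)).indicator (fun _ => 24 * h ^ 3) s := by
  have := (isFun_numDefect hh hi le_rfl).peano_bound three_ne_zero (killsPoly_numDefect hh hi)
    (windowBound_numDefect hh hi) (by nlinarith) s
  rwa [show 3 * (((i : ℝ) + 1) * h - (i - 1) * h) ^ 3 = 24 * h ^ 3 by ring] at this

/-- The functional `q_h - 1` at the node `i`. -/
noncomputable def avgDefect (h : ℝ) (i : ℕ) (W : ℝ → ℝ) : ℝ := qH h W i - nodal h W i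

theorem isFun_avgDefect {X h : ℝ} (hh : 0 < h) {i : ℕ} (hi : 1 ≤ i)
    (hX : ((i : ℝ) + 1) * h ≤ X) : IsFun X (avgDefect h i) :=
  (isFun_qH hh hi hX).sub (isFun_node hh (node_le hh hX (show i ≤ i + 1 by omega)))

theorem killsPoly_avgDefect {h : ℝ} (hh : 0 < h) (i : ℕ) : KillsPoly 2 (avgDefect h i) := by
  refine killsPoly_of_linear fun a b => ?_
  have := qH_cubic hh i a b 0 0
  simp only [zero_mul, add_zero] at this
  rw [avgDefect, this]
  simp [nodal]

theorem windowBound_avgDefect {h : ℝ} (hh : 0 < h) (i : ℕ) :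
    WindowBound (((i : ℝ) - 1) * h) (((i : ℝ) + 1) * h) 3 (avgDefect h i) := by
  intro W m hW
  have hq := abs_le.1 (abs_qH_le hh i hW)
  have h2 := abs_le.1 (hW (i * h) ⟨by nlinarith, by nlinarith⟩)
  rw [avgDefect, abs_le]
  simp only [nodal]
  constructor <;> linarith [hq.1, hq.2, h2.1, h2.2]

/-- `Λ_x` minus a combination of averages that has the same value on cubic polynomials. -/
noncomputable def lamDefect (h : ℝ) (i : ℕ) (W : ℝ → ℝ) : ℝ :=
  lamX h (nodal h W) i - 16 / h ^ 2 * (qH h W i - qH (h / 2) W (2 * i))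

theorem half_node_le {X h : ℝ} (hh : 0 < h) {i : ℕ} (hX : ((i : ℝ) + 1) * h ≤ X) :
    (((2 * i : ℕ) : ℝ) + 1) * (h / 2) ≤ X := by
  push_cast; nlinarith

theorem isFun_lamDefect {X h : ℝ} (hh : 0 < h) {i : ℕ} (hi : 1 ≤ i)
    (hX : ((i : ℝ) + 1) * h ≤ X) : IsFun X (lamDefect h i) :=
  (isFun_lamX hh hX).sub (((isFun_qH hh hi hX).sub
    (isFun_qH (half_pos hh) (show 1 ≤ 2 * i by omega) (half_node_le hh hX))).const_mul _)

/-- On cubics `q_h - 1` equals `(h²/12) ∂²` at the node, hence `q_h - q_{h/2}` equals `(h²/16) ∂²`;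
this explains the factor `16 / h²`. The averages can be differentiated in time in `L²`, and the rest
is accessible through the fourth space derivative; see `hasDerivWithinAt_lamX`. -/
theorem killsPoly_lamDefect {h : ℝ} (hh : 0 < h) {i : ℕ} (hi : 1 ≤ i) :
    KillsPoly 4 (lamDefect h i) := by
  refine killsPoly_of_cubic fun a b c d => ?_
  rw [lamDefect, lamX_cubic hh hi, qH_cubic hh, qH_cubic (half_pos hh)]
  push_cast
  field_simp
  ring

/-! ### Functions in `L^{2,1}(Q)` -/

theorem restrict_domQ (X T : ℝ) :
    (volume.restrict (domQ X T) : Measure (ℝ × ℝ)) = (muI X).prod (muI T) := by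
  rw [domQ, muI, muI, Measure.prod_restrict, Measure.volume_eq_prod]

theorem MemL21.aesm {X T : ℝ} {g : ℝ → ℝ → ℝ} (h : MemL21 X T g) :
    AEStronglyMeasurable (fun p : ℝ × ℝ => g p.1 p.2) ((muI X).prod (muI T)) := by
  rw [← restrict_domQ]; exact h.1

theorem ae_slice_aesm {X T : ℝ} {g : ℝ → ℝ → ℝ}
    (h : AEStronglyMeasurable (fun p : ℝ × ℝ => g p.1 p.2) ((muI X).prod (muI T))) :
    ∀ᵐ t ∂(muI T), AEStronglyMeasurable (fun x => g x t) (muI X) :=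
  AEStronglyMeasurable.prodMk_left h.prod_swap

theorem normL2_eq {X : ℝ} (w : ℝ → ℝ) :
    normL2 X w = (∫⁻ x, ‖w x‖ₑ ^ (2 : ℝ) ∂(muI X)) ^ (1 / (2 : ℝ)) := by
  rw [normL2, eLpNorm_eq_lintegral_rpow_enorm_toReal (by norm_num) (by norm_num)]
  simp

theorem aemeasurable_normL2 {X T : ℝ} {g : ℝ → ℝ → ℝ}
    (h : AEStronglyMeasurable (fun p : ℝ × ℝ => g p.1 p.2) ((muI X).prod (muI T))) :
    AEMeasurable (fun t => normL2 X (fun x => g x t)) (muI T) := by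
  simp only [normL2_eq]
  have h1 : AEMeasurable (fun p : ℝ × ℝ => ‖g p.1 p.2‖ₑ ^ (2 : ℝ)) ((muI X).prod (muI T)) :=
    h.enorm.pow_const _
  exact h1.lintegral_prod_left'.pow_const _

theorem lintegral_enorm_le_normL2 {X : ℝ} {w : ℝ → ℝ} (hw : AEStronglyMeasurable w (muI X)) :
    ∫⁻ x, ‖w x‖ₑ ∂(muI X) ≤ normL2 X w * (ENNReal.ofReal X) ^ (1 / 2 : ℝ) := by
  have := eLpNorm_le_eLpNorm_mul_rpow_measure_univ (p := 1) (q := 2) (by norm_num) hw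
  rw [eLpNorm_one_eq_lintegral_enorm] at this
  refine this.trans_eq ?_
  rw [normL2]
  congr 1
  simp
  norm_num

theorem MemL21.integrable {X T : ℝ} {g : ℝ → ℝ → ℝ} (h : MemL21 X T g) :
    Integrable (fun p : ℝ × ℝ => g p.1 p.2) ((muI X).prod (muI T)) := by
  refine ⟨h.aesm, ?_⟩
  rw [HasFiniteIntegral, lintegral_prod_symm _ h.aesm.enorm]
  calc ∫⁻ t, ∫⁻ x, ‖g x t‖ₑ ∂(muI X) ∂(muI T)
      ≤ ∫⁻ t, normL2 X (fun x => g x t) * (ENNReal.ofReal X) ^ (1 / 2 : ℝ) ∂(muI T) := by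
        refine lintegral_mono_ae ?_
        filter_upwards [ae_slice_aesm h.aesm] with t ht
        exact lintegral_enorm_le_normL2 ht
    _ = normL21 X T g * (ENNReal.ofReal X) ^ (1 / 2 : ℝ) := by
        rw [lintegral_mul_const' _ _ (by simp), normL21]
    _ < ⊤ := ENNReal.mul_lt_top h.2
        (ENNReal.rpow_lt_top_of_nonneg (by norm_num) ENNReal.ofReal_ne_top)

theorem MemL21.ae_memLp {X T : ℝ} {g : ℝ → ℝ → ℝ} (h : MemL21 X T g) :
    ∀ᵐ t ∂(muI T), MemLp (fun x => g x t) 2 (muI X) := by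
  filter_upwards [ae_slice_aesm h.aesm, ae_lt_top' (aemeasurable_normL2 h.aesm) h.2.ne]
    with t h1 h2 using ⟨h1, h2⟩

/-- `t ↦ ‖g(·,t)‖_{L²(I)}` as a real function. -/
noncomputable def sliceNorm (X : ℝ) (g : ℝ → ℝ → ℝ) (t : ℝ) : ℝ :=
  (normL2 X (fun x => g x t)).toReal

theorem sliceNorm_nonneg (X : ℝ) (g : ℝ → ℝ → ℝ) (t : ℝ) : 0 ≤ sliceNorm X g t :=
  ENNReal.toReal_nonneg

theorem MemL21.integrable_sliceNorm {X T : ℝ} {g : ℝ → ℝ → ℝ} (h : MemL21 X T g) :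
    IntegrableOn (sliceNorm X g) (Ioo 0 T) :=
  integrable_toReal_of_lintegral_ne_top (aemeasurable_normL2 h.aesm) h.2.ne

theorem MemL21.integral_sliceNorm {X T : ℝ} {g : ℝ → ℝ → ℝ} (h : MemL21 X T g) :
    ∫ t in Ioo 0 T, sliceNorm X g t = (normL21 X T g).toReal :=
  integral_toReal (aemeasurable_normL2 h.aesm)
    (ae_lt_top' (aemeasurable_normL2 h.aesm) h.2.ne)

/-! ### Test functions on `Q` -/

theorem IsTestQ.of_vanish {X T α β γ δ : ℝ} {φ : ℝ → ℝ → ℝ}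
    (h : ContDiff ℝ (⊤ : ℕ∞) (fun p : ℝ × ℝ => φ p.1 p.2)) (hα : 0 < α) (hβ : β < X)
    (hγ : 0 < γ) (hδ : δ < T) (hv : ∀ x t, ¬(x ∈ Icc α β ∧ t ∈ Icc γ δ) → φ x t = 0) :
    IsTestQ X T φ := by
  have hs : tsupport (fun p : ℝ × ℝ => φ p.1 p.2) ⊆ Icc α β ×ˢ Icc γ δ := by
    apply closure_minimal _ (isClosed_Icc.prod isClosed_Icc)
    intro p hp
    by_contra hc
    exact hp (hv p.1 p.2 hc)
  refine ⟨h, HasCompactSupport.of_support_subset_isCompact (isCompact_Icc.prod isCompact_Icc)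
    ((subset_tsupport _).trans hs), fun p hp => ?_⟩
  have := hs hp
  exact ⟨⟨hα.trans_le this.1.1, this.1.2.trans_lt hβ⟩, ⟨hγ.trans_le this.2.1,
    this.2.2.trans_lt hδ⟩⟩

theorem isTestQ_mul {X T : ℝ} (hX : 0 < X) (hT : 0 < T) {φ η : ℝ → ℝ} (hφ : IsTestI X φ)
    (hη : IsTestI T η) : IsTestQ X T (fun x t => φ x * η t) := by
  obtain ⟨α, β, h1, h2, h3⟩ := hφ.exists_vanish hX
  obtain ⟨γ, δ, h4, h5, h6⟩ := hη.exists_vanish hT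
  refine IsTestQ.of_vanish ?_ h1 h2 h4 h5 fun x t hxt => ?_
  · exact (hφ.smooth.comp contDiff_fst).mul (hη.smooth.comp contDiff_snd)
  · rw [not_and_or] at hxt
    rcases hxt with h | h
    · rw [h3 _ h, zero_mul]
    · rw [h6 _ h, mul_zero]

theorem partialXT_mul (k l : ℕ) (φ η : ℝ → ℝ) (x t : ℝ) :
    partialXT k l (fun x t => φ x * η t) x t = iteratedDeriv k φ x * iteratedDeriv l η t := by
  unfold partialXT
  simp only [iteratedDeriv_const_mul_field]
  simp only [mul_comm (φ _)]
  rw [iteratedDeriv_const_mul_field, mul_comm]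

/-! ### Reduction of weak equations on `Q` to the time variable -/

/-- The curve `t ↦ u(·,t)` is continuous from `[0,T]` to `C[0,X]`. -/
def IsCurve (X T : ℝ) (u : ℝ → ℝ → ℝ) : Prop :=
  ∃ w : ℝ → C(Icc (0 : ℝ) X, ℝ), ContinuousOn w (Icc 0 T) ∧
    ∀ t ∈ Icc 0 T, ∀ x : Icc (0 : ℝ) X, u x t = w t x

theorem IsCurve.continuousOn {X T : ℝ} {u : ℝ → ℝ → ℝ} (h : IsCurve X T u) :
    ContinuousOn (fun p : ℝ × ℝ => u p.1 p.2) (Icc 0 X ×ˢ Icc 0 T) := by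
  obtain ⟨w, hw, hu⟩ := h
  rw [continuousOn_iff_continuous_domRestrict] at hw ⊢
  have h1 : Continuous fun p : (Icc (0 : ℝ) X ×ˢ Icc (0 : ℝ) T : Set (ℝ × ℝ)) =>
      ((Icc 0 T).domRestrict w ⟨p.1.2, p.2.2⟩) (⟨p.1.1, p.2.1⟩ : Icc (0 : ℝ) X) := by
    refine (hw.comp ?_).eval ?_
    · exact (continuous_snd.comp continuous_subtype_val).subtype_mk _
    · exact (continuous_fst.comp continuous_subtype_val).subtype_mk _
  refine h1.congr fun p => ?_
  exact (hu p.1.2 p.2.2 ⟨p.1.1, p.2.1⟩).symm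

theorem IsCurve.continuousOn_slice {X T : ℝ} {u : ℝ → ℝ → ℝ} (h : IsCurve X T u) {t : ℝ}
    (ht : t ∈ Icc 0 T) : ContinuousOn (fun x => u x t) (Icc 0 X) :=
  h.continuousOn.comp (f := fun x : ℝ => (x, t)) (by fun_prop) fun _ hx => ⟨hx, ht⟩

theorem IsCurve.integrable {X T : ℝ} {u : ℝ → ℝ → ℝ} (h : IsCurve X T u) :
    Integrable (fun p : ℝ × ℝ => u p.1 p.2) ((muI X).prod (muI T)) := by
  rw [← restrict_domQ]
  exact (h.continuousOn.integrableOn_compact (isCompact_Icc.prod isCompact_Icc)).mono_set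
    (prod_mono Ioo_subset_Icc_self Ioo_subset_Icc_self)

theorem IsCurve.continuousOn_fun {X T : ℝ} {u : ℝ → ℝ → ℝ} (h : IsCurve X T u)
    {L : (ℝ → ℝ) → ℝ} (hL : IsFun X L) : ContinuousOn (fun t => L (fun x => u x t)) (Icc 0 T) := by
  have hs := fun t ht => h.continuousOn_slice (t := t) ht
  obtain ⟨w, hw, hu⟩ := h
  obtain ⟨Λ, hΛ⟩ := hL
  refine (Λ.continuous.comp_continuousOn hw).congr fun t ht => ?_
  rw [hΛ _ (hs t ht)]
  simp only [Function.comp]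
  congr 1
  ext x
  exact hu t ht x

theorem Integrable.mul_tensor {X T : ℝ} {g : ℝ → ℝ → ℝ}
    (hg : Integrable (fun p : ℝ × ℝ => g p.1 p.2) ((muI X).prod (muI T))) {a b : ℝ → ℝ} {A B : ℝ}
    (ha : AEStronglyMeasurable a (muI X)) (hb : AEStronglyMeasurable b (muI T))
    (hA : ∀ x ∈ Ioo 0 X, |a x| ≤ A) (hB : ∀ t ∈ Ioo 0 T, |b t| ≤ B) :
    Integrable (fun p : ℝ × ℝ => g p.1 p.2 * (a p.1 * b p.2)) ((muI X).prod (muI T)) := by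
  refine hg.mul_bdd (c := A * B) (ha.comp_fst.mul hb.comp_snd) ?_
  rw [← restrict_domQ]
  filter_upwards [ae_restrict_mem (measurableSet_Ioo.prod measurableSet_Ioo)] with p hp
  rw [norm_mul]
  exact mul_le_mul (hA _ hp.1) (hB _ hp.2) (norm_nonneg _) ((abs_nonneg _).trans (hA _ hp.1))

theorem IsTestI.exists_bound {X : ℝ} {φ : ℝ → ℝ} (h : IsTestI X φ) : ∃ C, ∀ x, |φ x| ≤ C :=
  h.continuous.bounded_above_of_compact_support h.compact

/-- The weak equation `∂_x^k ∂_t^l u = g` on `Q`. -/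
def WeakEqQ (X T : ℝ) (k l : ℕ) (u g : ℝ → ℝ → ℝ) : Prop :=
  ∀ φ : ℝ → ℝ → ℝ, IsTestQ X T φ →
    ∫ p in domQ X T, u p.1 p.2 * partialXT k l φ p.1 p.2 =
      (-1) ^ (k + l) * ∫ p in domQ X T, g p.1 p.2 * φ p.1 p.2

theorem integrableOn_integral_kernel {X T : ℝ} {g : ℝ → ℝ → ℝ}
    (hg : Integrable (fun p : ℝ × ℝ => g p.1 p.2) ((muI X).prod (muI T))) {K : ℝ → ℝ} {C : ℝ}
    (hK : AEStronglyMeasurable K (muI X)) (hC : ∀ x ∈ Ioo 0 X, |K x| ≤ C) :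
    IntegrableOn (fun t => ∫ x in Ioo 0 X, K x * g x t) (Ioo 0 T) := by
  have := Integrable.mul_tensor hg hK (b := fun _ => 1) (B := 1) (by fun_prop) hC (by simp)
  refine this.integral_prod_right.congr (Filter.Eventually.of_forall fun t => ?_)
  simp only [mul_one, mul_comm]

/-- A functional that integrates the weak derivative `∂_x^k` against a kernel turns the weak
equation `∂_x^k ∂_t^l u = g` into a weak equation in time. -/
theorem WeakEqQ.weakEq_time {X T : ℝ} (hX : 0 < X) (hT : 0 < T) {k l : ℕ} {u g : ℝ → ℝ → ℝ}
    (h : WeakEqQ X T k l u g) (hu : IsCurve X T u)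
    (hg : Integrable (fun p : ℝ × ℝ => g p.1 p.2) ((muI X).prod (muI T)))
    {L : (ℝ → ℝ) → ℝ} {K : ℝ → ℝ} {C : ℝ} (hL : IsFun X L) (hR : Represents X k L K)
    (hK : AEStronglyMeasurable K (muI X)) (hC : ∀ x ∈ Ioo 0 X, |K x| ≤ C) :
    WeakEq T l (fun t => L (fun x => u x t)) (fun t => ∫ x in Ioo 0 X, K x * g x t) := by
  intro η hη
  have hηl := hη.iteratedDeriv l
  obtain ⟨B, hB⟩ := hη.exists_bound
  obtain ⟨B', hB'⟩ := hηl.exists_bound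
  have hus := fun t ht => hu.continuousOn_slice (t := t) ht
  have huint := hu.integrable
  obtain ⟨w, hw, huw⟩ := hu
  -- The curve is integrated in `C[0, X]`, so that `L` commutes with the time integral.
  have hwint : Integrable (fun t => iteratedDeriv l η t • w t) (muI T) := by
    have : ContinuousOn (fun t => iteratedDeriv l η t • w t) (Icc 0 T) :=
      hηl.continuous.continuousOn.smul hw
    exact (this.integrableOn_compact isCompact_Icc).mono_set Ioo_subset_Icc_self
  obtain ⟨hWc, hWL⟩ := hL.map_integral hwint (W := fun t x => iteratedDeriv l η t * u x t) (by
    filter_upwards [ae_restrict_mem measurableSet_Ioo] with t ht x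
    simp [huw t (Ioo_subset_Icc_self ht) x])
  have e1 : ∫ t, L (fun x => iteratedDeriv l η t * u x t) ∂(muI T) =
      ∫ t in Ioo 0 T, L (fun x => u x t) * iteratedDeriv l η t := by
    refine setIntegral_congr_fun measurableSet_Ioo fun t ht => ?_
    rw [hL.map_const_mul (hus t (Ioo_subset_Icc_self ht)), mul_comm]
  have hgη : Integrable (fun p : ℝ × ℝ => g p.1 p.2 * (1 * η p.2)) ((muI X).prod (muI T)) :=
    Integrable.mul_tensor hg (a := fun _ => 1) (A := 1) (by fun_prop)
      hη.continuous.aestronglyMeasurable (by simp) (fun t _ => hB t)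
  have hgi : IntegrableOn (fun x => (-1) ^ l * ∫ t in Ioo 0 T, g x t * (1 * η t)) (Ioo 0 X) :=
    hgη.integral_prod_left.const_mul _
  -- Testing on `Q` with tensor products `φ ⊗ η`, with `η` fixed, shows that the time average of `u`
  -- against `η^{(l)}` has a weak `k`-th derivative in `x`; `Represents` then evaluates `L` on it.
  have hweak : WeakEq X k (fun x => ∫ t, iteratedDeriv l η t * u x t ∂(muI T))
      (fun x => (-1) ^ l * ∫ t in Ioo 0 T, g x t * (1 * η t)) := by
    intro φ hφ
    have hφk := hφ.iteratedDeriv k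
    obtain ⟨A, hA⟩ := hφ.exists_bound
    obtain ⟨A', hA'⟩ := hφk.exists_bound
    have key := h _ (isTestQ_mul hX hT hφ hη)
    simp only [partialXT_mul] at key
    rw [restrict_domQ, integral_prod, integral_prod] at key
    · simp only [← integral_mul_const]
      calc _ = ∫ x, ∫ t, u x t * (iteratedDeriv k φ x * iteratedDeriv l η t) ∂(muI T) ∂(muI X) := by
            congr 1; ext x; congr 1; ext t; ring
        _ = _ := by
            rw [key, pow_add]
            simp only [mul_assoc, integral_const_mul, ← integral_mul_const, one_mul]
            congr 4; ext x; congr 1; ext t; ring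
    · exact Integrable.mul_tensor hg hφ.continuous.aestronglyMeasurable
        hη.continuous.aestronglyMeasurable (fun x _ => hA x) (fun t _ => hB t)
    · exact Integrable.mul_tensor huint hφk.continuous.aestronglyMeasurable
        hηl.continuous.aestronglyMeasurable (fun x _ => hA' x) (fun t _ => hB' t)
  have e2 := hR _ _ hWc hgi hweak
  rw [← e1, ← hWL, e2]
  simp only [mul_left_comm (K _), integral_const_mul]
  congr 1
  have hsw : Integrable (Function.uncurry fun x t => g x t * (K x * η t))
      ((muI X).prod (muI T)) := Integrable.mul_tensor hg hK hη.continuous.aestronglyMeasurable hC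
        (fun t _ => hB t)
  have := integral_integral_swap hsw
  simp only [← integral_mul_const, ← integral_const_mul]
  calc _ = ∫ x, ∫ t, g x t * (K x * η t) ∂(muI T) ∂(muI X) := by
        congr 1; ext x; congr 1; ext t; ring
    _ = _ := by
        rw [this]; congr 1; ext x; congr 1; ext t; ring

/-! ### Minkowski's integral inequality -/

/-- The squared inner integral is written as a double integral over `t` and `s`; after moving `x`
innermost, Cauchy–Schwarz in `x` for each pair factors the bound. No division takes place, so
infinite values need no separate treatment. -/
theorem lintegral_sq_lintegral_le {α β : Type*} [MeasurableSpace α] [MeasurableSpace β]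
    {μ : Measure α} {ν : Measure β} [SFinite μ] [SFinite ν] {F : α → β → ENNReal}
    (hF : AEMeasurable (Function.uncurry F) (μ.prod ν)) :
    ∫⁻ x, (∫⁻ t, F x t ∂ν) ^ (2 : ℝ) ∂μ ≤
      (∫⁻ t, (∫⁻ x, F x t ^ (2 : ℝ) ∂μ) ^ (1 / (2 : ℝ)) ∂ν) ^ (2 : ℝ) := by
  have hI : AEMeasurable (fun x => ∫⁻ t, F x t ∂ν) μ := hF.lintegral_prod_right'
  have hsl : ∀ᵐ t ∂ν, AEMeasurable (fun x => F x t) μ := by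
    have := hF.prod_swap
    filter_upwards [Measure.ae_ae_of_ae_prod this.ae_eq_mk] with t ht
    exact ⟨_, this.measurable_mk.comp measurable_prodMk_left, ht⟩
  have hsr : ∀ᵐ x ∂μ, AEMeasurable (F x) ν := by
    filter_upwards [Measure.ae_ae_of_ae_prod hF.ae_eq_mk] with x hx
    exact ⟨_, hF.measurable_mk.comp measurable_prodMk_left, hx⟩
  set n : β → ENNReal := fun t => (∫⁻ x, F x t ^ (2 : ℝ) ∂μ) ^ (1 / (2 : ℝ)) with hn
  have hnm : AEMeasurable n ν := by
    have : AEMeasurable (fun p : α × β => F p.1 p.2 ^ (2 : ℝ)) (μ.prod ν) := hF.pow_const _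
    exact this.lintegral_prod_left'.pow_const _
  have h1 : ∀ᵐ x ∂μ, (∫⁻ t, F x t ∂ν) ^ (2 : ℝ) = ∫⁻ t, F x t * ∫⁻ s, F x s ∂ν ∂ν := by
    filter_upwards [hsr] with x hx
    rw [lintegral_mul_const'' _ hx, ENNReal.rpow_two, sq]
  have h2 : AEMeasurable (Function.uncurry fun x t => F x t * ∫⁻ s, F x s ∂ν) (μ.prod ν) :=
    hF.mul (hI.comp_quasiMeasurePreserving Measure.quasiMeasurePreserving_fst)
  rw [lintegral_congr_ae h1, lintegral_lintegral_swap h2]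
  calc ∫⁻ t, ∫⁻ x, F x t * ∫⁻ s, F x s ∂ν ∂μ ∂ν
      ≤ ∫⁻ t, n t * ∫⁻ s, n s ∂ν ∂ν := by
        refine lintegral_mono_ae ?_
        filter_upwards [hsl] with t ht
        have h3 : ∀ᵐ x ∂μ, F x t * ∫⁻ s, F x s ∂ν = ∫⁻ s, F x t * F x s ∂ν := by
          filter_upwards [hsr] with x hx
          rw [lintegral_const_mul'' _ hx]
        have h4 : AEMeasurable (Function.uncurry fun x s => F x t * F x s) (μ.prod ν) :=
          (ht.comp_quasiMeasurePreserving Measure.quasiMeasurePreserving_fst).mul hF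
        rw [lintegral_congr_ae h3, lintegral_lintegral_swap h4, ← lintegral_const_mul'' _ hnm]
        refine lintegral_mono_ae ?_
        filter_upwards [hsl] with s hs
        exact ENNReal.lintegral_mul_le_Lp_mul_Lq μ Real.HolderConjugate.two_two ht hs
    _ = (∫⁻ t, n t ∂ν) ^ (2 : ℝ) := by
        rw [lintegral_mul_const'' _ hnm, ENNReal.rpow_two, sq]

theorem normL2_integral_le {X T B : ℝ} {g : ℝ → ℝ → ℝ} (h : MemL21 X T g) {b : ℝ → ℝ}
    (hb : AEStronglyMeasurable b (muI T)) (hB : ∀ t ∈ Ioo 0 T, |b t| ≤ B) :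
    AEStronglyMeasurable (fun x => ∫ t in Ioo 0 T, b t * g x t) (muI X) ∧
      normL2 X (fun x => ∫ t in Ioo 0 T, b t * g x t) ≤ ENNReal.ofReal B * normL21 X T g := by
  have hm : AEStronglyMeasurable (fun p : ℝ × ℝ => b p.2 * g p.1 p.2) ((muI X).prod (muI T)) :=
    hb.comp_snd.mul h.aesm
  refine ⟨hm.integral_prod_right', ?_⟩
  rw [normL2_eq]
  calc (∫⁻ x, ‖∫ t in Ioo 0 T, b t * g x t‖ₑ ^ (2 : ℝ) ∂(muI X)) ^ (1 / (2 : ℝ))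
      ≤ (∫⁻ x, (∫⁻ t, ‖b t * g x t‖ₑ ∂(muI T)) ^ (2 : ℝ) ∂(muI X)) ^ (1 / (2 : ℝ)) := by
        refine ENNReal.rpow_le_rpow (lintegral_mono fun x => ENNReal.rpow_le_rpow
          (enorm_integral_le_lintegral_enorm _) (by norm_num)) (by norm_num)
    _ ≤ ((∫⁻ t, (∫⁻ x, ‖b t * g x t‖ₑ ^ (2 : ℝ) ∂(muI X)) ^ (1 / (2 : ℝ)) ∂(muI T)) ^ (2 : ℝ)) ^
          (1 / (2 : ℝ)) :=
        ENNReal.rpow_le_rpow (lintegral_sq_lintegral_le hm.enorm) (by norm_num)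
    _ = ∫⁻ t, (∫⁻ x, ‖b t * g x t‖ₑ ^ (2 : ℝ) ∂(muI X)) ^ (1 / (2 : ℝ)) ∂(muI T) := by
        rw [← ENNReal.rpow_mul]; norm_num
    _ ≤ ∫⁻ t, ENNReal.ofReal B * normL2 X (fun x => g x t) ∂(muI T) := by
        refine lintegral_mono_ae ?_
        filter_upwards [ae_restrict_mem measurableSet_Ioo] with t ht
        have : ‖b t‖ₑ ≤ ENNReal.ofReal B := by
          rw [← ofReal_norm]; exact ENNReal.ofReal_le_ofReal (hB t ht)
        rw [normL2_eq]
        calc _ = ‖b t‖ₑ * (∫⁻ x, ‖g x t‖ₑ ^ (2 : ℝ) ∂(muI X)) ^ (1 / (2 : ℝ)) := by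
              simp only [enorm_mul, ENNReal.mul_rpow_of_nonneg _ _ zero_le_two]
              rw [lintegral_const_mul' _ _ (by simp), ENNReal.mul_rpow_of_nonneg _ _ (by norm_num),
                ← ENNReal.rpow_mul]
              norm_num
          _ ≤ _ := mul_le_mul_left this _
    _ = _ := by rw [lintegral_const_mul' _ _ (by simp), normL21]

theorem memLp_integral_mul {X T B : ℝ} {g : ℝ → ℝ → ℝ} (h : MemL21 X T g) {b : ℝ → ℝ}
    (hb : AEStronglyMeasurable b (muI T)) (hB : ∀ t ∈ Ioo 0 T, |b t| ≤ B) :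
    MemLp (fun x => ∫ t in Ioo 0 T, b t * g x t) 2 (muI X) :=
  ⟨(normL2_integral_le h hb hB).1, (normL2_integral_le h hb hB).2.trans_lt
    (ENNReal.mul_lt_top (by simp) h.2)⟩

/-! ### The energy class -/

theorem abs_integral_le_normL2 {X : ℝ} {w : ℝ → ℝ} (hw : MemLp w 2 (muI X)) :
    ∫ x in Ioo 0 X, |w x| ≤ Real.sqrt X * (normL2 X w).toReal := by
  have h1 := lintegral_enorm_le_normL2 hw.1
  have h2 := integral_norm_eq_lintegral_enorm hw.1
  simp only [Real.norm_eq_abs] at h2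
  rw [h2]
  refine (ENNReal.toReal_mono ?_ h1).trans_eq ?_
  · exact ENNReal.mul_ne_top hw.2.ne (ENNReal.rpow_lt_top_of_nonneg (by norm_num)
      ENNReal.ofReal_ne_top).ne
  · rw [ENNReal.toReal_mul, mul_comm, ← ENNReal.toReal_rpow, Real.sqrt_eq_rpow]
    rcases le_total 0 X with h | h
    · rw [ENNReal.toReal_ofReal h]
    · have : (muI X) = 0 := by simp [muI, Ioo_eq_empty (not_lt.2 h)]
      simp [normL2, this]

theorem _root_.MeasureTheory.MemLp.integrable_muI {X : ℝ} {w : ℝ → ℝ} (hw : MemLp w 2 (muI X)) :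
    IntegrableOn w (Ioo 0 X) := hw.integrable (by norm_num)

/-- Since `u(0, t) = 0`, each slice is the integral of `∂_x u` from `0`, so the maximum norm of a
difference of slices is at most `√X` times the `L²` norm of the difference of the `∂_x u`, and the
latter is continuous in `t`. -/
theorem IsEnergySolution.isCurve {a X T : ℝ} (hX : 0 < X) {u0 u1 : ℝ → ℝ} {f u : ℝ → ℝ → ℝ}
    (h : IsEnergySolution a X T u0 u1 f u) : IsCurve X T u := by
  obtain ⟨W, hWc, hW⟩ := h.cont_dx
  have hrep : ∀ t ∈ Icc 0 T, ∀ x ∈ Icc 0 X, u x t = ∫ s in Ioo 0 X, kern 0 x s * W t s := by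
    intro t ht x hx
    have hi : IntegrableOn (W t) (Ioo 0 X) := (Lp.memLp (W t)).integrable_muI
    obtain ⟨c, hc⟩ := WeakEq.taylor hX (k := 0) (h.memH10 t ht).cont hi (hW t ht).eq
    have h0 := hc 0 ⟨le_rfl, hX.le⟩
    have hx' := hc x hx
    have hz : ∫ s in Ioo 0 X, kern 0 0 s * W t s = 0 := by
      rw [setIntegral_congr_fun (g := fun _ => 0) measurableSet_Ioo]
      · simp
      · intro s hs
        simp [kern, not_lt.2 hs.1.le]
    rw [hz, (h.memH10 t ht).left] at h0
    simp at h0 hx'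
    rw [hx', ← h0, zero_add]
  refine ⟨fun t => if ht : t ∈ Icc 0 T then
    ⟨(Icc 0 X).domRestrict fun x => u x t, (h.memH10 t ht).cont.domRestrict⟩ else 0, ?_, ?_⟩
  · rw [Metric.continuousOn_iff]
    intro t ht ε hε
    obtain ⟨δ, hδ, hd⟩ := Metric.continuousOn_iff.1 hWc t ht (ε / (Real.sqrt X + 1)) (by positivity)
    refine ⟨δ, hδ, fun s hs hst => ?_⟩
    have h1 := hd s hs hst
    rw [ContinuousMap.dist_lt_iff hε]
    intro x
    rw [dif_pos hs, dif_pos ht]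
    change dist (u x s) (u x t) < ε
    have hi : ∀ t, IntegrableOn (W t) (Ioo 0 X) := fun t => (Lp.memLp (W t)).integrable_muI
    rw [Real.dist_eq, hrep s hs x x.2, hrep t ht x x.2,
      ← integral_sub (integrable_kern_mul 0 (hi s) x.2) (integrable_kern_mul 0 (hi t) x.2)]
    have h2 : (normL2 X (fun x => W s x - W t x)).toReal = dist (W s) (W t) := by
      rw [dist_eq_norm, Lp.norm_def, normL2]
      exact congrArg _ (eLpNorm_congr_ae (Lp.coeFn_sub _ _).symm)
    have hm : MemLp (fun x => W s x - W t x) 2 (muI X) := (Lp.memLp (W s)).sub (Lp.memLp (W t))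
    calc |∫ y in Ioo 0 X, (kern 0 x y * W s y - kern 0 x y * W t y)|
        ≤ ∫ y in Ioo 0 X, |W s y - W t y| := by
          rw [← Real.norm_eq_abs]
          refine norm_integral_le_of_norm_le (g := fun y => |W s y - W t y|)
            hm.integrable_muI.norm (Filter.Eventually.of_forall fun y => ?_)
          rw [← mul_sub, norm_mul]
          refine mul_le_of_le_one_left (norm_nonneg _) ?_
          simpa using abs_kern_le (k := 0) (le_abs_self (x - y)) (abs_nonneg _)
      _ ≤ Real.sqrt X * (normL2 X (fun x => W s x - W t x)).toReal := abs_integral_le_normL2 hm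
      _ ≤ (Real.sqrt X + 1) * dist (W s) (W t) := by
          rw [h2]; exact mul_le_mul_of_nonneg_right (by linarith) dist_nonneg
      _ < ε := by
          rw [lt_div_iff₀ (by positivity)] at h1
          linarith
  · intro t ht x
    simp only [dif_pos ht]
    rfl

/-- Pairing with `ρ ∈ L²` is a bounded functional and can be composed with the `L²`-valued
derivative. Point values in `x` are not covered by this and are reached later through Peano kernels.
-/
theorem IsEnergySolution.hasDerivWithinAt_zero {a X T : ℝ} (hT : 0 ≤ T) {u0 u1 : ℝ → ℝ}
    {f u : ℝ → ℝ → ℝ} (h : IsEnergySolution a X T u0 u1 f u) {ρ : ℝ → ℝ}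
    (hρ : MemLp ρ 2 (muI X)) :
    HasDerivWithinAt (fun t => ∫ x in Ioo 0 X, ρ x * u x t) (∫ x in Ioo 0 X, ρ x * u1 x)
      (Icc 0 T) 0 := by
  obtain ⟨U, V, hU, hUV, -, hV⟩ := h.cont_dt
  have h0 : (0 : ℝ) ∈ Icc 0 T := ⟨le_rfl, hT⟩
  have e : ∀ (f : Lp ℝ 2 (muI X)) (g : ℝ → ℝ), f =ᵐ[muI X] g →
      innerSL ℝ (hρ.toLp ρ) f = ∫ x in Ioo 0 X, ρ x * g x := by
    intro f g hfg
    rw [innerSL_apply_apply, L2.inner_def]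
    refine integral_congr_ae ?_
    filter_upwards [hfg, hρ.coeFn_toLp] with x h1 h2
    rw [h1, h2]
    simp [mul_comm]
  have := (innerSL ℝ (hρ.toLp ρ)).hasFDerivAt.comp_hasDerivWithinAt (0 : ℝ) (hUV 0 h0)
  rw [e _ _ hV] at this
  exact this.congr (fun t ht => (e _ _ (hU t ht)).symm) (e _ _ (hU 0 h0)).symm

/-! ### The derivative at the initial time -/

theorem integral_kern_zero {T : ℝ} (k : ℕ) (G : ℝ → ℝ) :
    ∫ s in Ioo 0 T, kern k 0 s * G s = 0 := by
  rw [setIntegral_congr_fun (g := fun _ => 0) measurableSet_Ioo]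
  · simp
  · intro s hs
    simp [kern, not_lt.2 hs.1.le]

/-- The factor `kern 0 t s` is kept on the right: the integral is then over `(0, t)` only and tends
to zero with `t`, which matters for `k = 1`. -/
theorem abs_integral_kern_le {T : ℝ} (k : ℕ) {G : ℝ → ℝ} (hG : IntegrableOn G (Ioo 0 T)) {t : ℝ}
    (ht : t ∈ Icc 0 T) :
    |∫ s in Ioo 0 T, kern k t s * G s| ≤ t ^ k * ∫ s in Ioo 0 T, kern 0 t s * |G s| := by
  rw [← integral_const_mul, ← Real.norm_eq_abs]
  refine norm_integral_le_of_norm_le (g := fun s => t ^ k * (kern 0 t s * |G s|))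
    ((integrable_kern_mul 0 hG.abs ht).const_mul _) ?_
  filter_upwards [ae_restrict_mem measurableSet_Ioo] with s hs
  rw [norm_mul, Real.norm_eq_abs, Real.norm_eq_abs, ← mul_assoc]
  refine mul_le_mul_of_nonneg_right ?_ (abs_nonneg _)
  by_cases hst : s < t
  · have := abs_kern_le (k := k) (show t - s ≤ t by linarith [hs.1]) ht.1
    simpa [kern, hst] using this
  · simp [kern, hst]

theorem hasDerivWithinAt_integral_kern {T : ℝ} (hT : 0 ≤ T) {k : ℕ} (hk : k ≠ 0) {G : ℝ → ℝ}
    (hG : IntegrableOn G (Ioo 0 T)) :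
    HasDerivWithinAt (fun t => ∫ s in Ioo 0 T, kern k t s * G s) 0 (Icc 0 T) 0 := by
  rw [hasDerivWithinAt_iff_isLittleO, Asymptotics.isLittleO_iff]
  intro c hc
  have hcont := continuousOn_integral_kern 0 hG.abs 0 ⟨le_rfl, hT⟩
  have hlim : Filter.Tendsto (fun t => T ^ (k - 1) * ∫ s in Ioo 0 T, kern 0 t s * |G s|)
      (nhdsWithin 0 (Icc 0 T)) (nhds 0) := by
    have := (hcont.tendsto).const_mul (T ^ (k - 1))
    rwa [integral_kern_zero, mul_zero] at this
  filter_upwards [hlim.eventually (gt_mem_nhds hc), self_mem_nhdsWithin] with t h1 ht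
  simp only [integral_kern_zero, sub_zero, smul_zero, Real.norm_eq_abs, abs_of_nonneg ht.1]
  have hnn : 0 ≤ ∫ s in Ioo 0 T, kern 0 t s * |G s| := by
    refine integral_nonneg fun s => mul_nonneg ?_ (abs_nonneg _)
    unfold kern; split_ifs <;> simp
  calc _ ≤ t ^ k * ∫ s in Ioo 0 T, kern 0 t s * |G s| := abs_integral_kern_le k hG ht
    _ ≤ (t * T ^ (k - 1)) * ∫ s in Ioo 0 T, kern 0 t s * |G s| := by
        refine mul_le_mul_of_nonneg_right ?_ hnn
        obtain ⟨j, rfl⟩ := Nat.exists_eq_succ_of_ne_zero hk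
        rw [Nat.succ_eq_add_one, pow_succ', Nat.add_sub_cancel]
        exact mul_le_mul_of_nonneg_left (pow_le_pow_left₀ ht.1 ht.2 _) ht.1
    _ = t * (T ^ (k - 1) * ∫ s in Ioo 0 T, kern 0 t s * |G s|) := by ring
    _ ≤ t * c := mul_le_mul_of_nonneg_left h1.le ht.1
    _ = c * t := mul_comm _ _

theorem hasDerivAt_sum_pow (c : ℕ → ℝ) {k : ℕ} (hk : k ≠ 0) :
    HasDerivAt (fun t : ℝ => ∑ j ∈ Finset.range (k + 1), c j * t ^ j) (c 1) 0 := by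
  have : ∀ j ∈ Finset.range (k + 1), HasDerivAt (fun t : ℝ => c j * t ^ j)
      (c j * (j * 0 ^ (j - 1))) 0 := fun j _ => (hasDerivAt_pow j 0).const_mul _
  refine (HasDerivAt.fun_sum this).congr_deriv ?_
  rw [Finset.sum_eq_single 1]
  · simp
  · intro j _ hj
    rcases Nat.eq_zero_or_pos j with h | h
    · simp [h]
    · rw [zero_pow (by omega), mul_zero, mul_zero]
  · intro h
    simp at h
    omega

/-- The Taylor remainder is `o(t)` at `t = 0`, so the linear coefficient is the one-sided derivative
there. -/
theorem WeakEq.taylor_deriv {T : ℝ} (hT : 0 < T) {k : ℕ} (hk : k ≠ 0) {F G : ℝ → ℝ}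
    (hF : ContinuousOn F (Icc 0 T)) (hG : IntegrableOn G (Ioo 0 T)) (h : WeakEq T (k + 1) F G) :
    ∃ c : ℕ → ℝ, HasDerivWithinAt F (c 1) (Icc 0 T) 0 ∧
      ∀ t ∈ Icc 0 T, F t = ∑ j ∈ Finset.range (k + 1), c j * t ^ j +
        ∫ s in Ioo 0 T, kern k t s * G s := by
  obtain ⟨c, hc⟩ := h.taylor hT hF hG
  refine ⟨c, ?_, hc⟩
  have := (hasDerivAt_sum_pow c hk).hasDerivWithinAt.add
    (hasDerivWithinAt_integral_kern hT.le hk hG)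
  rw [add_zero] at this
  exact this.congr hc (hc 0 ⟨le_rfl, hT.le⟩)

/-- A weight that integrates `c₀ + c₁ t` over `(0,T)` to `c₁`. -/
noncomputable def slopeWeight (T t : ℝ) : ℝ := (12 * t - 6 * T) / T ^ 3

theorem continuous_slopeWeight (T : ℝ) : Continuous (slopeWeight T) := by
  unfold slopeWeight; fun_prop

/-- The kernel by which the second derivative enters the value at `0` of the first one. -/
noncomputable def slopeKern (T s : ℝ) : ℝ := ∫ t in Ioo 0 T, slopeWeight T t * kern 1 t s

theorem isFun_slope {T : ℝ} (hT : 0 ≤ T) :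
    IsFun T (fun F => ∫ t in Ioo 0 T, slopeWeight T t * F t) :=
  isFun_integral hT (continuous_slopeWeight T).continuousOn.integrableOn_Ioo

theorem continuous_slopeKern {T : ℝ} (hT : 0 ≤ T) : Continuous (slopeKern T) :=
  (isFun_slope hT).continuous_peano one_ne_zero

theorem slope_linear {T : ℝ} (hT : 0 < T) (a b : ℝ) :
    ∫ t in Ioo 0 T, slopeWeight T t * (a + b * t) = b := by
  rw [← integral_Ioc_eq_integral_Ioo, ← intervalIntegral.integral_of_le hT.le]
  have : ∀ t : ℝ, slopeWeight T t * (a + b * t) = (-6 * a / T ^ 2) + (12 * a / T ^ 3 -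
      6 * b / T ^ 2) * t ^ 1 + (12 * b / T ^ 3) * t ^ 2 := fun t => by
    unfold slopeWeight; field_simp; ring
  simp only [this]
  rw [intervalIntegral.integral_add, intervalIntegral.integral_add]
  · simp only [intervalIntegral.integral_const, intervalIntegral.integral_const_mul, integral_pow,
      smul_eq_mul]
    norm_num
    field_simp
    ring
  all_goals exact Continuous.intervalIntegrable (by fun_prop) _ _

/-- By Taylor's formula `F` is `c 0 + c 1 t` plus the remainder with kernel `kern 1`. Integration
against `slopeWeight` sends the linear part to `c 1` and the remainder to the integral of `G`
against `slopeKern`. The slope thus becomes a pair of integrals over `(0, T)`, which can be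
exchanged with integrals in `x`. -/
theorem WeakEq.hasDerivWithinAt_slope {T : ℝ} (hT : 0 < T) {F G : ℝ → ℝ}
    (hF : ContinuousOn F (Icc 0 T)) (hG : IntegrableOn G (Ioo 0 T)) (h : WeakEq T 2 F G) :
    HasDerivWithinAt F ((∫ t in Ioo 0 T, slopeWeight T t * F t) -
      ∫ t in Ioo 0 T, slopeKern T t * G t) (Icc 0 T) 0 := by
  obtain ⟨c, hc, hF'⟩ := h.taylor_deriv hT one_ne_zero hF hG
  have hs : IsFun T (fun F => (∫ t in Ioo 0 T, slopeWeight T t * F t)) := isFun_slope hT.le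
  have hJ := continuousOn_integral_kern 1 hG
  have hP : (∫ t in Ioo 0 T, slopeWeight T t * (F t - (c 0 + c 1 * t))) =
      ∫ t in Ioo 0 T, slopeKern T t * G t := by
    have h3 : EqOn (fun t => F t - (c 0 + c 1 * t)) (fun t => ∫ s in Ioo 0 T, kern 1 t s * G s)
        (Icc 0 T) := fun t ht => by
      have := hF' t ht
      rw [Finset.sum_range_succ, Finset.sum_range_one, pow_zero, mul_one, pow_one] at this
      simp only [this]; ring
    exact (hs.congr (hJ.congr h3) h3).trans (hs.map_integral_kern hT.le one_ne_zero hG)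
  have e := hs.map_sub (V := F) (W := fun t => c 0 + c 1 * t) hF (by fun_prop)
  simp only at e
  rw [hP, slope_linear hT] at e
  rw [e, sub_sub_cancel]
  exact hc

/-! ### The initial velocity -/

theorem _root_.Continuous.exists_bound_Ioo {T : ℝ} {b : ℝ → ℝ} (hb : Continuous b) :
    ∃ B, ∀ t ∈ Ioo 0 T, |b t| ≤ B := by
  obtain ⟨B, hB⟩ := isCompact_Icc.exists_bound_of_continuousOn (s := Icc 0 T) hb.continuousOn
  exact ⟨B, fun t ht => hB t (Ioo_subset_Icc_self ht)⟩

theorem integral_mul_integral_comm {X T : ℝ} {g : ℝ → ℝ → ℝ}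
    (hg : Integrable (fun p : ℝ × ℝ => g p.1 p.2) ((muI X).prod (muI T))) {a b : ℝ → ℝ} {A B : ℝ}
    (ha : AEStronglyMeasurable a (muI X)) (hb : AEStronglyMeasurable b (muI T))
    (hA : ∀ x ∈ Ioo 0 X, |a x| ≤ A) (hB : ∀ t ∈ Ioo 0 T, |b t| ≤ B) :
    ∫ t in Ioo 0 T, b t * ∫ x in Ioo 0 X, a x * g x t =
      ∫ x in Ioo 0 X, a x * ∫ t in Ioo 0 T, b t * g x t := by
  have hsw : Integrable (Function.uncurry fun x t => g x t * (a x * b t))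
      ((muI X).prod (muI T)) := Integrable.mul_tensor hg ha hb hA hB
  have := integral_integral_swap hsw
  simp only [← integral_const_mul]
  calc _ = ∫ t, ∫ x, g x t * (a x * b t) ∂(muI X) ∂(muI T) := by
        congr 1; ext x; congr 1; ext t; ring
    _ = _ := by
        rw [← this]; congr 1; ext x; congr 1; ext t; ring

/-- The value at `t = 0` of the time derivative of a function with second time derivative
`g₂`, recovered from the function `g₀` itself. -/
noncomputable def initSlope (T : ℝ) (g0 g2 : ℝ → ℝ → ℝ) (x : ℝ) : ℝ :=
  (∫ t in Ioo 0 T, slopeWeight T t * g0 x t) - ∫ t in Ioo 0 T, slopeKern T t * g2 x t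

theorem memLp_initSlope {X T : ℝ} (hT : 0 ≤ T) {g0 g2 : ℝ → ℝ → ℝ} (h0 : MemL21 X T g0)
    (h2 : MemL21 X T g2) : MemLp (initSlope T g0 g2) 2 (muI X) := by
  obtain ⟨B, hB⟩ := (continuous_slopeWeight T).exists_bound_Ioo (T := T)
  obtain ⟨B', hB'⟩ := (continuous_slopeKern hT).exists_bound_Ioo (T := T)
  exact (memLp_integral_mul h0 (continuous_slopeWeight T).aestronglyMeasurable hB).sub
    (memLp_integral_mul h2 (continuous_slopeKern hT).aestronglyMeasurable hB')

/-- The function `F(t) = L u(·,t)` equals the integral of `K g0` for almost every `t` and has the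
integral of `K g2` as its second weak derivative. The slope formula and Fubini put the kernel `K`
outside the time integrals. -/
theorem hasDerivWithinAt_functional {X T : ℝ} (hX : 0 < X) (hT : 0 < T) {k : ℕ}
    {u g0 g2 : ℝ → ℝ → ℝ} (hu : IsCurve X T u) (h0 : MemL21 X T g0) (h2 : MemL21 X T g2)
    (e0 : WeakEqQ X T k 0 u g0) (e2 : WeakEqQ X T k 2 u g2) {L : (ℝ → ℝ) → ℝ} {K : ℝ → ℝ}
    (hL : IsFun X L) (hR : Represents X k L K) (hK : Continuous K) :
    HasDerivWithinAt (fun t => L (fun x => u x t)) (∫ x in Ioo 0 X, K x * initSlope T g0 g2 x)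
      (Icc 0 T) 0 := by
  obtain ⟨B, hB⟩ := (continuous_slopeWeight T).exists_bound_Ioo (T := T)
  obtain ⟨B', hB'⟩ := (continuous_slopeKern hT.le).exists_bound_Ioo (T := T)
  obtain ⟨C, hC⟩ := hK.exists_bound_Ioo (T := X)
  have hKm := hK.aestronglyMeasurable (μ := muI X)
  have w0 := e0.weakEq_time hX hT hu h0.integrable hL hR hKm hC
  have w2 := e2.weakEq_time hX hT hu h2.integrable hL hR hKm hC
  have i0 := integrableOn_integral_kernel h0.integrable hKm hC
  have i2 := integrableOn_integral_kernel h2.integrable hKm hC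
  have hFc := hu.continuousOn_fun hL
  refine (w2.hasDerivWithinAt_slope hT hFc i2).congr_deriv ?_
  have s0 := integral_mul_integral_comm h0.integrable hKm
    (continuous_slopeWeight T).aestronglyMeasurable hC hB
  have s2 := integral_mul_integral_comm h2.integrable hKm
    (continuous_slopeKern hT.le).aestronglyMeasurable hC hB'
  have ae := ae_eq_of_weakEq_zero hFc.integrableOn_Ioo i0 w0
  have e : ∫ t in Ioo 0 T, slopeWeight T t * L (fun x => u x t) =
      ∫ t in Ioo 0 T, slopeWeight T t * ∫ x in Ioo 0 X, K x * g0 x t := by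
    refine integral_congr_ae ?_
    filter_upwards [ae] with t ht
    rw [ht]
  rw [e, s0, s2, ← integral_sub]
  · simp only [initSlope, mul_sub]
  · exact (memLp_integral_mul h0 (continuous_slopeWeight T).aestronglyMeasurable
      hB).integrable_muI.bdd_mul hKm ((ae_restrict_iff' measurableSet_Ioo).2 (.of_forall hC))
  · exact (memLp_integral_mul h2 (continuous_slopeKern hT.le).aestronglyMeasurable
      hB').integrable_muI.bdd_mul hKm ((ae_restrict_iff' measurableSet_Ioo).2 (.of_forall hC))

theorem HasDerivWithinAt.unique_Icc {T : ℝ} (hT : 0 < T) {F : ℝ → ℝ} {c d : ℝ}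
    (hc : HasDerivWithinAt F c (Icc 0 T) 0) (hd : HasDerivWithinAt F d (Icc 0 T) 0) : c = d :=
  (uniqueDiffOn_Icc hT 0 ⟨le_rfl, hT.le⟩).eq_deriv _ hc hd

theorem IsTestI.memLp {X : ℝ} {φ : ℝ → ℝ} (h : IsTestI X φ) : MemLp φ 2 (muI X) :=
  (h.continuous.memLp_of_hasCompactSupport h.compact).restrict _

theorem isFun_test {X : ℝ} (hX : 0 ≤ X) {φ : ℝ → ℝ} (h : IsTestI X φ) :
    IsFun X (fun W => ∫ x in Ioo 0 X, φ x * W x) :=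
  isFun_integral hX h.integrable.integrableOn

/-- The time derivative at `0` of the pairing of `u` with `φ^{(k)}` is computed in two ways: from
the `L²` initial condition it is the pairing with `u1`, from `hasDerivWithinAt_functional` it is the
pairing of `initSlope` with `(-1)^k φ`. -/
theorem IsEnergySolution.weakEq_initSlope {a X T : ℝ} (hX : 0 < X) (hT : 0 < T) {k : ℕ}
    {u0 u1 : ℝ → ℝ} {f u g0 g2 : ℝ → ℝ → ℝ} (hu : IsEnergySolution a X T u0 u1 f u)
    (h0 : MemL21 X T g0) (h2 : MemL21 X T g2)
    (e0 : WeakEqQ X T k 0 u g0) (e2 : WeakEqQ X T k 2 u g2) :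
    WeakEq X k u1 (initSlope T g0 g2) := by
  intro φ hφ
  have hL := isFun_test hX.le (hφ.iteratedDeriv k)
  have d1 := hasDerivWithinAt_functional hX hT (hu.isCurve hX) h0 h2 e0 e2 hL
    (represents_test k hφ) (hφ.continuous.const_mul _)
  have d2 := hu.hasDerivWithinAt_zero hT.le (hφ.iteratedDeriv k).memLp
  have := HasDerivWithinAt.unique_Icc hT d1 d2
  simp only [mul_comm (u1 _), ← this, mul_assoc, integral_const_mul, mul_comm (initSlope _ _ _ _)]

theorem IsEnergySolution.isL2DerivI_initSlope {a X T : ℝ} (hX : 0 < X) (hT : 0 < T) {k : ℕ}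
    {u0 u1 : ℝ → ℝ} {f u g0 g2 : ℝ → ℝ → ℝ} (hu : IsEnergySolution a X T u0 u1 f u)
    (hu1 : ContinuousOn u1 (Icc 0 X)) (h0 : MemL21 X T g0) (h2 : MemL21 X T g2)
    (e0 : WeakEqQ X T k 0 u g0) (e2 : WeakEqQ X T k 2 u g2) :
    IsL2DerivI X k u1 (initSlope T g0 g2) :=
  ⟨⟨hu1.integrableOn_Ioo.locallyIntegrableOn,
    (memLp_initSlope hT.le h0 h2).integrable_muI.locallyIntegrableOn,
    hu.weakEq_initSlope hX hT h0 h2 e0 e2⟩, memLp_initSlope hT.le h0 h2⟩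

/-- A functional that kills low degree polynomials can be differentiated in time at `t = 0`. -/
theorem IsEnergySolution.hasDerivWithinAt_peano {a X T : ℝ} (hX : 0 < X) (hT : 0 < T) {k : ℕ}
    {u0 u1 : ℝ → ℝ} {f u g0 g2 : ℝ → ℝ → ℝ} (hu : IsEnergySolution a X T u0 u1 f u)
    (hu1 : ContinuousOn u1 (Icc 0 X)) (h0 : MemL21 X T g0) (h2 : MemL21 X T g2)
    (e0 : WeakEqQ X T (k + 1) 0 u g0) (e2 : WeakEqQ X T (k + 1) 2 u g2) (hk : k ≠ 0)
    {L : (ℝ → ℝ) → ℝ} (hL : IsFun X L) (hp : KillsPoly (k + 1) L) :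
    HasDerivWithinAt (fun t => L (fun x => u x t)) (L u1) (Icc 0 T) 0 := by
  have hR := hL.represents_peano hX hk hp
  rw [hR u1 _ hu1 (memLp_initSlope hT.le h0 h2).integrable_muI
    (hu.weakEq_initSlope hX hT h0 h2 e0 e2)]
  exact hasDerivWithinAt_functional hX hT (hu.isCurve hX) h0 h2 e0 e2 hL hR (hL.continuous_peano hk)

theorem _root_.Continuous.memLp_muI {X : ℝ} {ρ : ℝ → ℝ} (h : Continuous ρ) :
    MemLp ρ 2 (muI X) := by
  obtain ⟨C, hC⟩ := h.exists_bound_Ioo (T := X)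
  exact MemLp.of_bound h.aestronglyMeasurable C
    ((ae_restrict_iff' measurableSet_Ioo).2 (.of_forall hC))

theorem IsEnergySolution.hasDerivWithinAt_qH {a X T : ℝ} (hT : 0 < T) {u0 u1 : ℝ → ℝ}
    {f u : ℝ → ℝ → ℝ} (hu : IsEnergySolution a X T u0 u1 f u) {h : ℝ} (hh : 0 < h) {i : ℕ}
    (hi : 1 ≤ i) (hX : ((i : ℝ) + 1) * h ≤ X) :
    HasDerivWithinAt (fun t => qH h (fun x => u x t) i) (qH h u1 i) (Icc 0 T) 0 := by
  simp only [qH_eq_setIntegral hh hi hX]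
  exact hu.hasDerivWithinAt_zero hT.le ((continuous_hat h i).div_const h).memLp_muI

/-- `Λ_x` kills only linear functions, so its Peano representation would need `∂_x²∂_t² u`. It is
therefore split into `lamDefect`, which kills cubics and is handled with `∂_x⁴ u` and `∂_x⁴∂_t² u`,
and averages, whose derivative is given by the `L²` initial condition. -/
theorem IsEnergySolution.hasDerivWithinAt_lamX {a X T : ℝ} (hT : 0 < T)
    {u0 u1 : ℝ → ℝ} {f u g0 g2 : ℝ → ℝ → ℝ} (hu : IsEnergySolution a X T u0 u1 f u)
    (hu1 : ContinuousOn u1 (Icc 0 X)) (h0 : MemL21 X T g0) (h2 : MemL21 X T g2)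
    (e0 : WeakEqQ X T 4 0 u g0) (e2 : WeakEqQ X T 4 2 u g2) {h : ℝ} (hh : 0 < h) {i : ℕ}
    (hi : 1 ≤ i) (hX : ((i : ℝ) + 1) * h ≤ X) :
    HasDerivWithinAt (fun t => lamX h (nodal h fun x => u x t) i) (lamX h (nodal h u1) i)
      (Icc 0 T) 0 := by
  have hX0 : 0 < X := lt_of_lt_of_le (by positivity) hX
  have d1 := hu.hasDerivWithinAt_peano hX0 hT hu1 h0 h2 e0 e2 three_ne_zero
    (isFun_lamDefect hh hi hX) (killsPoly_lamDefect hh hi)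
  have d2 := hu.hasDerivWithinAt_qH hT hh hi hX
  have d3 := hu.hasDerivWithinAt_qH hT (half_pos hh) (show 1 ≤ 2 * i by omega)
    (half_node_le hh hX)
  have := d1.add ((d2.sub d3).const_mul (16 / h ^ 2))
  refine (this.congr_deriv ?_).congr (fun t _ => ?_) ?_
  · simp only [lamDefect]; ring
  all_goals simp only [Pi.add_apply, Pi.sub_apply, lamDefect]; ring

/-! ### Parametric primitives of test functions on `Q` -/

theorem IsTestQ.exists_vanish {X T : ℝ} (hX : 0 < X) (hT : 0 < T) {φ : ℝ → ℝ → ℝ}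
    (h : IsTestQ X T φ) : ∃ α β γ δ, 0 < α ∧ β < X ∧ 0 < γ ∧ δ < T ∧
      ∀ x t, ¬(x ∈ Icc α β ∧ t ∈ Icc γ δ) → φ x t = 0 := by
  obtain ⟨α, β, h1, h2, h3⟩ := exists_Icc_of_compact_subset_Ioo hX
    (h.compact.isCompact.image continuous_fst) (by
      rintro _ ⟨p, hp, rfl⟩; exact (h.supp hp).1)
  obtain ⟨γ, δ, h4, h5, h6⟩ := exists_Icc_of_compact_subset_Ioo hT
    (h.compact.isCompact.image continuous_snd) (by
      rintro _ ⟨p, hp, rfl⟩; exact (h.supp hp).2)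
  refine ⟨α, β, γ, δ, h1, h2, h4, h5, fun x t hxt => ?_⟩
  by_contra hc
  have : (x, t) ∈ tsupport (fun p : ℝ × ℝ => φ p.1 p.2) := subset_tsupport _ hc
  exact hxt ⟨h3 ⟨_, this, rfl⟩, h6 ⟨_, this, rfl⟩⟩

theorem contDiff_iteratedDeriv_slice {φ : ℝ → ℝ → ℝ}
    (h : ContDiff ℝ (⊤ : ℕ∞) fun p : ℝ × ℝ => φ p.1 p.2) (l : ℕ) :
    ContDiff ℝ (⊤ : ℕ∞) fun p : ℝ × ℝ => iteratedDeriv l (φ p.1) p.2 := by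
  induction l with
  | zero => simpa using h
  | succ l ih =>
    have e : ∀ p : ℝ × ℝ, iteratedDeriv (l + 1) (φ p.1) p.2 =
        fderiv ℝ (fun p : ℝ × ℝ => iteratedDeriv l (φ p.1) p.2) p (0, 1) := by
      intro p
      have h1 := (ih.differentiable (by simp) p).hasFDerivAt
      have h2 : HasDerivAt (fun t => (p.1, t)) ((0 : ℝ), (1 : ℝ)) p.2 :=
        (hasDerivAt_const _ _).prodMk (hasDerivAt_id _)
      rw [iteratedDeriv_succ]
      exact (HasFDerivAt.comp_hasDerivAt p.2 h1 h2).deriv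
    simp only [e]
    exact (ih.fderiv_right (m := (⊤ : ℕ∞)) (by simp)).clm_apply contDiff_const

theorem contDiff_partialXT {φ : ℝ → ℝ → ℝ}
    (h : ContDiff ℝ (⊤ : ℕ∞) fun p : ℝ × ℝ => φ p.1 p.2) (k l : ℕ) :
    ContDiff ℝ (⊤ : ℕ∞) fun p : ℝ × ℝ => partialXT k l φ p.1 p.2 := by
  have h1 : ContDiff ℝ (⊤ : ℕ∞) fun p : ℝ × ℝ => iteratedDeriv l (φ p.2) p.1 :=
    (contDiff_iteratedDeriv_slice h l).comp (contDiff_snd.prodMk contDiff_fst)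
  exact (contDiff_iteratedDeriv_slice (φ := fun t y => iteratedDeriv l (φ y) t) h1 k).comp
    (contDiff_snd.prodMk contDiff_fst)

theorem integrable_mul_continuous {X T : ℝ} {g ψ : ℝ → ℝ → ℝ}
    (hg : Integrable (fun p : ℝ × ℝ => g p.1 p.2) ((muI X).prod (muI T)))
    (hψ : Continuous fun p : ℝ × ℝ => ψ p.1 p.2) :
    Integrable (fun p : ℝ × ℝ => g p.1 p.2 * ψ p.1 p.2) ((muI X).prod (muI T)) := by
  obtain ⟨C, hC⟩ := (isCompact_Icc.prod isCompact_Icc).exists_bound_of_continuousOn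
    (s := Icc 0 X ×ˢ Icc 0 T) hψ.continuousOn
  refine hg.mul_bdd (c := C) hψ.aestronglyMeasurable ?_
  rw [← restrict_domQ]
  filter_upwards [ae_restrict_mem (measurableSet_Ioo.prod measurableSet_Ioo)] with p hp
  exact hC p (prod_mono Ioo_subset_Icc_self Ioo_subset_Icc_self hp)

theorem IsTestQ.slice {X T : ℝ} (hX : 0 < X) (hT : 0 < T) {φ : ℝ → ℝ → ℝ} (h : IsTestQ X T φ)
    (x : ℝ) : IsTestI T (φ x) := by
  obtain ⟨α, β, γ, δ, -, -, h3, h4, h5⟩ := h.exists_vanish hX hT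
  exact IsTestI.of_vanish (h.smooth.comp (contDiff_const.prodMk contDiff_id)) h3 h4
    fun t ht => h5 x t fun hc => ht hc.2

/-- The integral is the convolution of `ψ x` with the constant `1`, evaluated at `0`. -/
theorem contDiff_integral_param {ψ : ℝ → ℝ → ℝ} {γ δ : ℝ}
    (h : ContDiff ℝ (⊤ : ℕ∞) fun p : ℝ × ℝ => ψ p.1 p.2)
    (hv : ∀ x t, t ∉ Icc γ δ → ψ x t = 0) : ContDiff ℝ (⊤ : ℕ∞) fun x => ∫ t, ψ x t := by
  have := contDiffOn_convolution_right_with_param (μ := volume) (n := (⊤ : ℕ∞))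
    (ContinuousLinearMap.mul ℝ ℝ) (s := univ) (k := Icc γ δ) (f := fun _ : ℝ => (1 : ℝ)) (g := ψ)
    isOpen_univ isCompact_Icc (fun x t _ ht => hv x t ht) (locallyIntegrable_const 1)
    h.contDiffOn
  rw [univ_prod_univ, contDiffOn_univ] at this
  have h2 := this.comp (contDiff_id.prodMk (contDiff_const (c := (0 : ℝ))))
  convert h2 using 1
  ext x
  simp only [Function.comp, convolution, ContinuousLinearMap.mul_apply', one_mul, id]
  exact (integral_sub_left_eq_self (ψ x) volume 0).symm

/-- The primitive is the convolution of `ψ x` with the Heaviside function; it may start at `0`, as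
`ψ` vanishes for `t ≤ 0`. Joint smoothness then comes from smoothness of convolutions with a
parameter. -/
theorem contDiff_primitive_param {ψ : ℝ → ℝ → ℝ} {γ δ : ℝ} (hγ : 0 < γ)
    (h : ContDiff ℝ (⊤ : ℕ∞) fun p : ℝ × ℝ => ψ p.1 p.2)
    (hv : ∀ x t, t ∉ Icc γ δ → ψ x t = 0) :
    ContDiff ℝ (⊤ : ℕ∞) fun p : ℝ × ℝ => ∫ s in (0 : ℝ)..p.2, ψ p.1 s := by
  have hH : LocallyIntegrable ((Ici (0 : ℝ)).indicator fun _ => (1 : ℝ)) :=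
    (locallyIntegrable_const 1).indicator measurableSet_Ici
  have := contDiffOn_convolution_right_with_param (μ := volume) (n := (⊤ : ℕ∞))
    (ContinuousLinearMap.mul ℝ ℝ) (s := univ) (k := Icc γ δ)
    (f := (Ici (0 : ℝ)).indicator fun _ => (1 : ℝ)) (g := ψ)
    isOpen_univ isCompact_Icc (fun x t _ ht => hv x t ht) hH h.contDiffOn
  rw [univ_prod_univ, contDiffOn_univ] at this
  convert this using 1
  ext p
  have hcont : Continuous (ψ p.1) := h.continuous.comp (Continuous.prodMk_right p.1)
  have hint : Integrable (ψ p.1) := hcont.integrable_of_hasCompactSupport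
    (HasCompactSupport.of_support_subset_isCompact (isCompact_Icc (a := γ) (b := δ)) fun t ht => by
      by_contra hc; exact ht (hv _ _ hc))
  have e1 : ∫ s in Iic (0 : ℝ), ψ p.1 s = 0 := by
    rw [setIntegral_congr_fun (g := fun _ => 0) measurableSet_Iic, integral_zero]
    intro s hs
    exact hv _ _ fun hc => by linarith [hc.1, mem_Iic.1 hs]
  have e2 := intervalIntegral.integral_Iic_sub_Iic (a := 0) (b := p.2) (μ := volume)
    hint.integrableOn hint.integrableOn
  rw [← e2, e1, sub_zero, ← integral_indicator measurableSet_Iic]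
  simp only [convolution, ContinuousLinearMap.mul_apply']
  rw [← integral_sub_left_eq_self (fun s => (Iic p.2).indicator (ψ p.1) s) volume p.2]
  refine integral_congr_ae (.of_forall fun s => ?_)
  simp only [indicator, mem_Iic, mem_Ici, sub_le_self_iff]
  split_ifs <;> simp

/-- Every test function on `Q` is a time derivative of a test function up to a tensor product. -/
theorem IsTestQ.exists_primitive {X T : ℝ} (hX : 0 < X) (hT : 0 < T) {φ : ℝ → ℝ → ℝ}
    (h : IsTestQ X T φ) {χ : ℝ → ℝ} (hχ : IsTestI T χ) (hχ1 : ∫ t in Ioo 0 T, χ t = 1) :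
    ∃ (m : ℝ → ℝ) (Φ : ℝ → ℝ → ℝ), IsTestI X m ∧ (∀ x, m x = ∫ t in Ioo 0 T, φ x t) ∧
      IsTestQ X T Φ ∧ ∀ x, deriv (Φ x) = fun t => φ x t - m x * χ t := by
  obtain ⟨α, β, γ, δ, h1, h2, h3, h4, h5⟩ := h.exists_vanish hX hT
  obtain ⟨γ', δ', h3', h4', h5'⟩ := hχ.exists_vanish hT
  have hsl := h.slice hX hT
  have hmE : ∀ x, ∫ t, φ x t = ∫ t in Ioo 0 T, φ x t := fun x =>
    (setIntegral_eq_integral_of_forall_compl_eq_zero fun t ht => (hsl x).zero_of_notMem ht).symm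
  have hm : IsTestI X fun x => ∫ t, φ x t := by
    refine IsTestI.of_vanish (contDiff_integral_param (γ := γ) (δ := δ) h.smooth
      fun x t ht => h5 x t fun hc => ht hc.2) h1 h2 fun x hx => ?_
    rw [integral_congr_ae (g := fun _ => 0), integral_zero]
    exact .of_forall fun t => h5 x t fun hc => hx hc.1
  have hψ : ContDiff ℝ (⊤ : ℕ∞) fun p : ℝ × ℝ => φ p.1 p.2 - (∫ t, φ p.1 t) * χ p.2 :=
    h.smooth.sub ((hm.smooth.comp contDiff_fst).mul (hχ.smooth.comp contDiff_snd))
  -- One time window contains the supports of both `φ` and `χ`; outside it the primitive vanishes,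
  -- since the corrected integrand has zero mean in `t`.
  have hψv : ∀ x t, t ∉ Icc (min γ γ') (max δ δ') → φ x t - (∫ t, φ x t) * χ t = 0 := by
    intro x t ht
    rw [h5 x t fun hc => ht ⟨(min_le_left _ _).trans hc.2.1, hc.2.2.trans (le_max_left _ _)⟩,
      h5' t fun hc => ht ⟨(min_le_right _ _).trans hc.1, hc.2.trans (le_max_right _ _)⟩]
    ring
  have hmin : 0 < min γ γ' := lt_min h3 h3'
  have hmax : max δ δ' < T := max_lt h4 h4'
  have hΦ := contDiff_primitive_param hmin hψ hψv
  have hint : ∀ x, IsTestI T fun t => φ x t - (∫ t, φ x t) * χ t := fun x =>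
    (hsl x).sub (hχ.const_mul _)
  refine ⟨fun x => ∫ t, φ x t, fun x t => ∫ s in (0 : ℝ)..t, (φ x s - (∫ t, φ x t) * χ s), hm,
    hmE, ?_, ?_⟩
  · refine IsTestQ.of_vanish hΦ h1 h2 hmin hmax fun x t hxt => ?_
    rw [not_and_or] at hxt
    rcases hxt with hx | ht
    · have : ∀ s, φ x s = 0 := fun s => h5 x s fun hc => hx hc.1
      simp [this]
    · have h0 : ∫ t in Ioo 0 T, (φ x t - (∫ t, φ x t) * χ t) = 0 := by
        rw [integral_sub (hsl x).integrable.integrableOn (hχ.integrable.const_mul _).integrableOn,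
          integral_const_mul, hχ1, hmE]
        ring
      have hc := (hint x).continuous
      rw [mem_Icc, not_and_or, not_le, not_le] at ht
      have hz : ∀ a b : ℝ, (∀ s ∈ uIcc a b, s ∉ Icc (min γ γ') (max δ δ')) →
          ∫ s in a..b, (φ x s - (∫ t, φ x t) * χ s) = 0 := fun a b hab => by
        rw [intervalIntegral.integral_congr (g := fun _ => 0), intervalIntegral.integral_zero]
        exact fun s hs => hψv x s (hab s hs)
      rcases ht with ht | ht
      · refine hz _ _ fun s hs hc => ?_
        rw [mem_uIcc] at hs
        have := hc.1
        rcases hs with hs | hs <;> linarith [hs.1, hs.2]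
      · have e2 := hz t T fun s hs hc => by
          rw [mem_uIcc] at hs
          have := hc.2
          rcases hs with hs | hs <;> linarith [hs.1, hs.2]
        have e3 : ∫ s in (0 : ℝ)..T, (φ x s - (∫ t, φ x t) * χ s) = 0 := by
          rw [intervalIntegral.integral_of_le hT.le, integral_Ioc_eq_integral_Ioo, h0]
        have := intervalIntegral.integral_add_adjacent_intervals
          (hc.intervalIntegrable (μ := volume) 0 t) (hc.intervalIntegrable t T)
        rw [e2, e3, add_zero] at this
        exact this
  · intro x
    ext t
    exact (intervalIntegral.integral_hasDerivAt_right ((hint x).continuous.intervalIntegrable _ _)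
      ((hint x).continuous.stronglyMeasurableAtFilter _ _)
      (hint x).continuous.continuousAt).deriv

/-! ### Intermediate time derivatives -/

/-- The primitive in time of `g` that vanishes at `t = 0`. -/
noncomputable def timePrim (T : ℝ) (g : ℝ → ℝ → ℝ) (x t : ℝ) : ℝ :=
  ∫ r in Ioo 0 T, kern 0 t r * g x r

theorem abs_kern_zero_le (t r : ℝ) : |kern 0 t r| ≤ 1 := by
  simpa using abs_kern_le (k := 0) (le_abs_self (t - r)) (abs_nonneg _)

theorem normL2_timePrim_le {X T : ℝ} {g : ℝ → ℝ → ℝ} (hg : MemL21 X T g) (t : ℝ) :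
    normL2 X (fun x => timePrim T g x t) ≤ normL21 X T g := by
  have := (normL2_integral_le hg (b := kern 0 t) (B := 1)
    (measurable_kern_right 0 t).aestronglyMeasurable fun r _ => abs_kern_zero_le t r).2
  rwa [ENNReal.ofReal_one, one_mul] at this

theorem memL21_of_le {X T : ℝ} {g : ℝ → ℝ → ℝ}
    (hm : AEStronglyMeasurable (fun p : ℝ × ℝ => g p.1 p.2) ((muI X).prod (muI T))) {C : ENNReal}
    (hC : C < ⊤) (h : ∀ t, normL2 X (fun x => g x t) ≤ C) : MemL21 X T g := by
  refine ⟨by rwa [restrict_domQ], ?_⟩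
  calc normL21 X T g ≤ ∫⁻ _ in Ioo 0 T, C := lintegral_mono h
    _ < ⊤ := by
      rw [lintegral_const]
      exact ENNReal.mul_lt_top hC (by simp)

theorem memL21_timePrim {X T : ℝ} {g : ℝ → ℝ → ℝ} (hg : MemL21 X T g) :
    MemL21 X T (timePrim T g) := by
  refine memL21_of_le ?_ hg.2 (normL2_timePrim_le hg)
  have h1 : AEStronglyMeasurable (fun q : (ℝ × ℝ) × ℝ => g q.1.1 q.2)
      (((muI X).prod (muI T)).prod (muI T)) :=
    hg.aesm.comp_quasiMeasurePreserving
      (QuasiMeasurePreserving.prodMap Measure.quasiMeasurePreserving_fst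
        (Measure.QuasiMeasurePreserving.id _))
  have h2 : AEStronglyMeasurable (fun q : (ℝ × ℝ) × ℝ => kern 0 q.1.2 q.2 * g q.1.1 q.2)
      (((muI X).prod (muI T)).prod (muI T)) :=
    ((measurable_kern 0).comp (by fun_prop :
      Measurable fun q : (ℝ × ℝ) × ℝ => (q.1.2, q.2))).aestronglyMeasurable.mul h1
  exact h2.integral_prod_right'

theorem memL21_const {X T : ℝ} {D : ℝ → ℝ} (hD : MemLp D 2 (muI X)) :
    MemL21 X T (fun x _ => D x) :=
  memL21_of_le hD.1.comp_fst hD.2 fun _ => le_rfl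

theorem MemL21.add {X T : ℝ} {g g' : ℝ → ℝ → ℝ} (h : MemL21 X T g) (h' : MemL21 X T g') :
    MemL21 X T (fun x t => g x t + g' x t) := by
  refine ⟨h.1.add h'.1, ?_⟩
  calc normL21 X T (fun x t => g x t + g' x t)
      ≤ ∫⁻ t in Ioo 0 T, (normL2 X (fun x => g x t) + normL2 X (fun x => g' x t)) := by
        refine lintegral_mono_ae ?_
        filter_upwards [ae_slice_aesm h.aesm, ae_slice_aesm h'.aesm] with t h1 h2
        exact eLpNorm_add_le h1 h2 one_le_two
    _ = normL21 X T g + normL21 X T g' := lintegral_add_left' (aemeasurable_normL2 h.aesm) _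
    _ < ⊤ := ENNReal.add_lt_top.2 ⟨h.2, h'.2⟩

/-- The part of the time derivative of order `l` that does not depend on time. -/
noncomputable def midConst (T : ℝ) (l : ℕ) (χ : ℝ → ℝ) (g0 g : ℝ → ℝ → ℝ) (x : ℝ) : ℝ :=
  (-1) ^ l * (∫ t in Ioo 0 T, iteratedDeriv l χ t * g0 x t) -
    ∫ t in Ioo 0 T, χ t * timePrim T g x t

/-- The time derivative of order `l` of `g₀`, in terms of the derivative `g` of order `l + 1`. -/
noncomputable def midDeriv (T : ℝ) (l : ℕ) (χ : ℝ → ℝ) (g0 g : ℝ → ℝ → ℝ) (x t : ℝ) : ℝ :=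
  timePrim T g x t + midConst T l χ g0 g x

theorem memLp_midConst {X T : ℝ} {l : ℕ} {χ : ℝ → ℝ} (hχ : IsTestI T χ) {g0 g : ℝ → ℝ → ℝ}
    (h0 : MemL21 X T g0) (hg : MemL21 X T g) : MemLp (midConst T l χ g0 g) 2 (muI X) := by
  obtain ⟨B, hB⟩ := (hχ.iteratedDeriv l).exists_bound
  obtain ⟨B', hB'⟩ := hχ.exists_bound
  exact ((memLp_integral_mul h0 (hχ.iteratedDeriv l).continuous.aestronglyMeasurable
    fun t _ => hB t).const_mul _).sub
    (memLp_integral_mul (memL21_timePrim hg) hχ.continuous.aestronglyMeasurable fun t _ => hB' t)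

theorem memL21_midDeriv {X T : ℝ} {l : ℕ} {χ : ℝ → ℝ} (hχ : IsTestI T χ) {g0 g : ℝ → ℝ → ℝ}
    (h0 : MemL21 X T g0) (hg : MemL21 X T g) : MemL21 X T (midDeriv T l χ g0 g) :=
  (memL21_timePrim hg).add (memL21_const (memLp_midConst hχ h0 hg))

/-- With `φ = Φ' + m χ`, the time primitive tested with `Φ'` gives `-∫ g Φ`. Its contribution
against `m χ` is cancelled by `midConst`, which enters multiplied by `∫ φ = m` and supplies the
value prescribed by `g0` instead. -/
theorem integral_midDeriv_mul_test {T : ℝ} {l : ℕ} {χ φ Φ : ℝ → ℝ} {m : ℝ}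
    {g0 g : ℝ → ℝ → ℝ} {x : ℝ} (hχ : IsTestI T χ) (hφ : IsTestI T φ) (hΦ : IsTestI T Φ)
    (hm : m = ∫ t in Ioo 0 T, φ t) (hd : deriv Φ = fun t => φ t - m * χ t)
    (hg : IntegrableOn (g x) (Ioo 0 T)) :
    ∫ t in Ioo 0 T, midDeriv T l χ g0 g x t * φ t =
      (-1) ^ l * (∫ t in Ioo 0 T, g0 x t * (m * iteratedDeriv l χ t)) -
        ∫ t in Ioo 0 T, g x t * Φ t := by
  have hJ : IntegrableOn (fun t => timePrim T g x t) (Ioo 0 T) :=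
    (continuousOn_integral_kern 0 hg).integrableOn_Ioo
  have h1 : ∫ t in Ioo 0 T, timePrim T g x t * iteratedDeriv (0 + 1) Φ t =
      (-1) ^ (0 + 1) * ∫ t in Ioo 0 T, g x t * Φ t := weakEq_integral_kern 0 hg Φ hΦ
  simp only [zero_add, iteratedDeriv_one, hd, mul_sub, pow_one] at h1
  rw [integral_sub (integrable_mul_test hJ hφ) (integrable_mul_test hJ (hχ.const_mul m))] at h1
  simp only [midDeriv, add_mul]
  rw [integral_add (integrable_mul_test hJ hφ) (hφ.integrable.const_mul _).integrableOn,
    integral_const_mul, ← hm, midConst]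
  simp only [mul_left_comm _ m, integral_const_mul] at h1 ⊢
  simp only [mul_comm (χ _), mul_comm (iteratedDeriv l χ _)]
  linarith

theorem partialXT_primitive {X T : ℝ} {k l : ℕ} {φ Φ : ℝ → ℝ → ℝ} {m χ : ℝ → ℝ}
    (hφ : IsTestQ X T φ) (hm : IsTestI X m) (hχ : IsTestI T χ)
    (hd : ∀ x, deriv (Φ x) = fun t => φ x t - m x * χ t) (x t : ℝ) :
    partialXT k (l + 1) Φ x t = partialXT k l φ x t - iteratedDeriv k m x * iteratedDeriv l χ t := by
  have hsl : ∀ y, ContDiff ℝ (⊤ : ℕ∞) (φ y) := fun y =>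
    hφ.smooth.comp (contDiff_const.prodMk contDiff_id)
  have h1 : ∀ y, iteratedDeriv (l + 1) (Φ y) t =
      iteratedDeriv l (φ y) t - m y * iteratedDeriv l χ t := by
    intro y
    rw [iteratedDeriv_succ', hd, iteratedDeriv_fun_sub, iteratedDeriv_const_mul_field]
    · exact ((hsl y).of_le (by exact_mod_cast le_top)).contDiffAt
    · exact ((hχ.const_mul _).smooth.of_le (by exact_mod_cast le_top)).contDiffAt
  have h2 : ContDiff ℝ (⊤ : ℕ∞) fun y => iteratedDeriv l (φ y) t :=
    (contDiff_iteratedDeriv_slice hφ.smooth l).comp (contDiff_id.prodMk contDiff_const)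
  unfold partialXT
  simp only [h1]
  simp only [mul_comm (m _)]
  rw [iteratedDeriv_fun_sub, iteratedDeriv_const_mul_field, mul_comm]
  · exact (h2.of_le (by exact_mod_cast le_top)).contDiffAt
  · exact ((hm.const_mul _).smooth.of_le (by exact_mod_cast le_top)).contDiffAt

/-- A test function is split as `∂_t Φ + m ⊗ χ`. On the first part the equation of order `l + 1`
tested with `Φ` applies; on the second, the `l` time derivatives fall on `χ`, and the equation
without time derivatives applies to `m ⊗ χ^{(l)}`. -/
theorem WeakEqQ.midDeriv {X T : ℝ} (hX : 0 < X) (hT : 0 < T) {k l : ℕ} {u g0 g : ℝ → ℝ → ℝ}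
    (hu : IsCurve X T u) (h0 : MemL21 X T g0) (hg : MemL21 X T g) (e0 : WeakEqQ X T k 0 u g0)
    (e1 : WeakEqQ X T k (l + 1) u g) {χ : ℝ → ℝ} (hχ : IsTestI T χ)
    (hχ1 : ∫ t in Ioo 0 T, χ t = 1) : WeakEqQ X T k l u (midDeriv T l χ g0 g) := by
  intro φ hφ
  obtain ⟨m, Φ, hm, hmE, hΦ, hd⟩ := hφ.exists_primitive hX hT hχ hχ1
  have hχl := hχ.iteratedDeriv l
  have t1 := e1 Φ hΦ
  have t0 := e0 _ (isTestQ_mul hX hT hm hχl)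
  simp only [partialXT_mul, iteratedDeriv_zero] at t0
  rw [restrict_domQ] at t0 t1 ⊢
  have hui := hu.integrable
  have c1 : Continuous fun p : ℝ × ℝ => partialXT k l φ p.1 p.2 :=
    (contDiff_partialXT hφ.smooth k l).continuous
  have c2 : Continuous fun p : ℝ × ℝ => iteratedDeriv k m p.1 * iteratedDeriv l χ p.2 :=
    ((hm.iteratedDeriv k).continuous.comp continuous_fst).mul (hχl.continuous.comp continuous_snd)
  simp only [partialXT_primitive hφ hm hχ hd, mul_sub] at t1
  rw [integral_sub (integrable_mul_continuous hui c1)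
    (integrable_mul_continuous (ψ := fun x t => iteratedDeriv k m x * iteratedDeriv l χ t) hui c2),
    t0] at t1
  have c3 : Continuous fun p : ℝ × ℝ => m p.1 * iteratedDeriv l χ p.2 :=
    (hm.continuous.comp continuous_fst).mul (hχl.continuous.comp continuous_snd)
  have i1 := integrable_mul_continuous (memL21_midDeriv (l := l) hχ h0 hg).integrable
    hφ.smooth.continuous
  have i2 := integrable_mul_continuous (ψ := fun x t => m x * iteratedDeriv l χ t)
    h0.integrable c3
  have i3 := integrable_mul_continuous hg.integrable hΦ.smooth.continuous
  have key : ∫ p, CompactWave.midDeriv T l χ g0 g p.1 p.2 * φ p.1 p.2 ∂((muI X).prod (muI T)) =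
      (-1) ^ l * (∫ p, g0 p.1 p.2 * (m p.1 * iteratedDeriv l χ p.2) ∂((muI X).prod (muI T))) -
        ∫ p, g p.1 p.2 * Φ p.1 p.2 ∂((muI X).prod (muI T)) := by
    rw [integral_prod _ i1, integral_prod _ i2, integral_prod _ i3, ← integral_const_mul,
      ← integral_sub (i2.integral_prod_left.const_mul _) i3.integral_prod_left]
    refine integral_congr_ae ?_
    filter_upwards [hg.integrable.prod_right_ae] with x hx
    exact integral_midDeriv_mul_test hχ (hφ.slice hX hT x) (hΦ.slice hX hT x) (hmE x) (hd x) hx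
  rw [key]
  have s : ((-1 : ℝ) ^ l) * (-1) ^ l = 1 := by rw [← mul_pow]; simp
  rw [add_zero, ← add_assoc, pow_succ] at t1
  rw [pow_add] at t1 ⊢
  linear_combination t1 - (-1) ^ k *
    (∫ p, g0 p.1 p.2 * (m p.1 * iteratedDeriv l χ p.2) ∂((muI X).prod (muI T))) * s

/-- The slices of `midDeriv` are bounded by norms of `midDeriv` and `g`. -/
theorem sliceNorm_midDeriv_le {X T : ℝ} (hT : 0 < T) {l : ℕ} {χ : ℝ → ℝ} (hχ : IsTestI T χ)
    {g0 g : ℝ → ℝ → ℝ} (h0 : MemL21 X T g0) (hg : MemL21 X T g) (t : ℝ) :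
    sliceNorm X (midDeriv T l χ g0 g) t ≤
      (normL21 X T (midDeriv T l χ g0 g)).toReal / T + 2 * (normL21 X T g).toReal := by
  set D := midDeriv T l χ g0 g with hD
  have hJm : ∀ t, AEStronglyMeasurable (fun x => timePrim T g x t) (muI X) := fun t =>
    (normL2_integral_le hg (b := kern 0 t) (B := 1)
      (measurable_kern_right 0 t).aestronglyMeasurable fun r _ => abs_kern_zero_le t r).1
  have hc := memLp_midConst (l := l) hχ h0 hg
  have hJ : ∀ t, MemLp (fun x => timePrim T g x t) 2 (muI X) := fun t =>
    ⟨hJm t, (normL2_timePrim_le hg t).trans_lt hg.2⟩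
  have hDm : ∀ t, MemLp (fun x => D x t) 2 (muI X) := fun t => (hJ t).add hc
  -- The part independent of time drops out of `D(t) - D(s)`, leaving two slices of the primitive,
  -- each bounded by the norm of `g`. Averaging over `s ∈ (0, T)` below produces the factor `1 / T`.
  have step : ∀ s, sliceNorm X D t ≤ sliceNorm X D s + 2 * (normL21 X T g).toReal := by
    intro s
    have e : (fun x => D x t) = (fun x => D x s) +
        ((fun x => timePrim T g x t) - fun x => timePrim T g x s) := by
      ext x; simp only [hD, midDeriv, Pi.add_apply, Pi.sub_apply]; ring
    have h1 : normL2 X (fun x => D x t) ≤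
        normL2 X (fun x => D x s) + (normL21 X T g + normL21 X T g) := by
      rw [e]
      refine (eLpNorm_add_le (hDm s).1 ((hJm t).sub (hJm s)) one_le_two).trans ?_
      refine add_le_add_right ((eLpNorm_sub_le (hJm t) (hJm s) one_le_two).trans ?_) _
      exact add_le_add (normL2_timePrim_le hg t) (normL2_timePrim_le hg s)
    have hfin : normL21 X T g + normL21 X T g ≠ ⊤ := ENNReal.add_ne_top.2 ⟨hg.2.ne, hg.2.ne⟩
    have h2 := ENNReal.toReal_mono (ENNReal.add_ne_top.2 ⟨(hDm s).2.ne, hfin⟩) h1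
    rw [ENNReal.toReal_add (hDm s).2.ne hfin, ENNReal.toReal_add hg.2.ne hg.2.ne] at h2
    simp only [sliceNorm]
    change _ ≤ (normL2 X fun x => D x s).toReal + _ at h2
    linarith
  have hDL := memL21_midDeriv (l := l) hχ h0 hg
  have hi := hDL.integrable_sliceNorm
  have hconst : ∀ {c : ℝ}, IntegrableOn (fun _ : ℝ => c) (Ioo 0 T) := fun {c} =>
    continuousOn_const.integrableOn_Ioo
  have := setIntegral_mono_on (μ := volume) (s := Ioo 0 T) (f := fun _ => sliceNorm X D t)
    (g := fun s => sliceNorm X D s + 2 * (normL21 X T g).toReal) hconst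
    (hi.add hconst) measurableSet_Ioo fun s _ => step s
  rw [integral_add hi hconst, hDL.integral_sliceNorm] at this
  simp [hT.le] at this
  rw [← sub_le_iff_le_add, le_div_iff₀ hT]
  linarith

/-! ### Discrete energy estimates -/

/-- The discrete Dirichlet form. -/
noncomputable def dirH (h : ℝ) (N : ℕ) (v w : ℕ → ℝ) : ℝ :=
  ∑ i ∈ Finset.range N, (v (i + 1) - v i) * (w (i + 1) - w i) / h

theorem sum_second_diff_mul (v w : ℕ → ℝ) (n : ℕ) :
    ∑ i ∈ Finset.Icc 1 n, (v (i - 1) - 2 * v i + v (i + 1)) * w i =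
      -(∑ i ∈ Finset.range (n + 1), (v (i + 1) - v i) * (w (i + 1) - w i)) +
        (v (n + 1) - v n) * w (n + 1) - (v 1 - v 0) * w 0 := by
  induction n with
  | zero => simp; ring
  | succ n ih =>
    rw [Finset.sum_Icc_succ_top (by omega), ih, Finset.sum_range_succ _ (n + 1)]
    simp only [Nat.add_sub_cancel]
    ring

theorem innerH_lamX {h : ℝ} (hh : 0 < h) {N : ℕ} (hN : 0 < N) (v : ℕ → ℝ) {w : ℕ → ℝ}
    (h0 : w 0 = 0) (hw : w N = 0) : innerH h N (lamX h v) w = -dirH h N v w := by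
  obtain ⟨n, rfl⟩ : ∃ n, N = n + 1 := ⟨N - 1, by omega⟩
  have := sum_second_diff_mul v w n
  rw [h0, hw] at this
  simp only [mul_zero, add_zero, sub_zero] at this
  rw [innerH, dirH, ← Finset.sum_div, Nat.add_sub_cancel]
  have e : ∀ i, lamX h v i * w i * h = ((v (i - 1) - 2 * v i + v (i + 1)) * w i) / h := fun i => by
    unfold lamX; field_simp
  simp only [e]
  rw [← Finset.sum_div, this, neg_div]

theorem innerH_add (h : ℝ) (N : ℕ) (v v' w : ℕ → ℝ) :
    innerH h N (fun i => v i + v' i) w = innerH h N v w + innerH h N v' w := by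
  simp only [innerH, ← Finset.sum_add_distrib]
  exact Finset.sum_congr rfl fun i _ => by ring

theorem innerH_const_mul (h : ℝ) (N : ℕ) (c : ℝ) (v w : ℕ → ℝ) :
    innerH h N (fun i => c * v i) w = c * innerH h N v w := by
  simp only [innerH, Finset.mul_sum]
  exact Finset.sum_congr rfl fun i _ => by ring

theorem innerH_congr {h : ℝ} {N : ℕ} {v v' : ℕ → ℝ} (w : ℕ → ℝ)
    (hv : ∀ i, 1 ≤ i → i < N → v i = v' i) : innerH h N v w = innerH h N v' w :=
  Finset.sum_congr rfl fun i hi => by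
    rw [Finset.mem_Icc] at hi
    rw [hv i hi.1 (by omega)]

theorem innerH_self_nonneg {h : ℝ} (hh : 0 < h) (N : ℕ) (w : ℕ → ℝ) : 0 ≤ innerH h N w w :=
  Finset.sum_nonneg fun _ _ => mul_nonneg (mul_self_nonneg _) hh.le

theorem dirH_self_nonneg {h : ℝ} (hh : 0 < h) (N : ℕ) (w : ℕ → ℝ) : 0 ≤ dirH h N w w :=
  Finset.sum_nonneg fun _ _ => div_nonneg (mul_self_nonneg _) hh.le

theorem sum_range_succ_eq_sum_Icc (f : ℕ → ℝ) (n : ℕ) :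
    ∑ i ∈ Finset.range n, f (i + 1) = ∑ i ∈ Finset.Icc 1 n, f i := by
  induction n with
  | zero => simp
  | succ n ih => rw [Finset.sum_range_succ, ih, Finset.sum_Icc_succ_top (by omega)]

/-- Inverse inequality: `(p - q)² ≤ 2 p² + 2 q²` on each cell, and each inner node belongs to two
cells. -/
theorem dirH_self_le {h : ℝ} (hh : 0 < h) {N : ℕ} (hN : 0 < N) {w : ℕ → ℝ}
    (h0 : w 0 = 0) (hw : w N = 0) : h ^ 2 * dirH h N w w ≤ 4 * innerH h N w w := by
  obtain ⟨n, rfl⟩ : ∃ n, N = n + 1 := ⟨N - 1, by omega⟩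
  have e1 : ∑ i ∈ Finset.range (n + 1), w i ^ 2 = ∑ i ∈ Finset.Icc 1 n, w i ^ 2 := by
    rw [Finset.sum_range_succ', h0, sum_range_succ_eq_sum_Icc fun i => w i ^ 2]
    simp
  have e2 : ∑ i ∈ Finset.range (n + 1), w (i + 1) ^ 2 = ∑ i ∈ Finset.Icc 1 n, w i ^ 2 := by
    rw [Finset.sum_range_succ, hw, sum_range_succ_eq_sum_Icc fun i => w i ^ 2]
    simp
  calc h ^ 2 * dirH h (n + 1) w w
      = h * ∑ i ∈ Finset.range (n + 1), (w (i + 1) - w i) ^ 2 := by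
        rw [dirH, Finset.mul_sum, Finset.mul_sum]
        exact Finset.sum_congr rfl fun i _ => by field_simp
    _ ≤ h * ∑ i ∈ Finset.range (n + 1), (2 * w (i + 1) ^ 2 + 2 * w i ^ 2) := by
        gcongr with i
        nlinarith [sq_nonneg (w (i + 1) + w i)]
    _ = 4 * innerH h (n + 1) w w := by
        rw [Finset.sum_add_distrib, ← Finset.mul_sum, ← Finset.mul_sum, e1, e2, innerH,
          Nat.add_sub_cancel, ← Finset.sum_mul]
        simp only [← sq]
        ring

/-- The square of the energy norm, through the Dirichlet form. -/
noncomputable def energySq (a h τ : ℝ) (N : ℕ) (δ s : ℕ → ℝ) : ℝ :=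
  innerH h N δ δ - (h ^ 2 / 12 + τ ^ 2 * a ^ 2 / 6) * dirH h N δ δ + a ^ 2 * dirH h N s s

/-- The coefficient arises from `B = 1 + (h²/6) Λ_x` and `(σ_N - 1/4) τ² a² = h²/12 - τ² a²/6`. -/
theorem energyNorm_eq {a h τ : ℝ} (ha : 0 < a) (hh : 0 < h) (hτ : 0 < τ) {N : ℕ} (hN : 0 < N)
    {y w : ℕ → ℝ} (y0 : y 0 = 0) (yN : y N = 0) (w0 : w 0 = 0) (wN : w N = 0) :
    energyNorm a h τ N y w = Real.sqrt (energySq a h τ N (fun i => (w i - y i) / τ)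
      (fun i => (w i + y i) / 2)) := by
  have hl : ∀ z : ℕ → ℝ, z 0 = 0 → z N = 0 → normSqLam h N z = dirH h N z z := by
    intro z z0 zN
    have := innerH_lamX hh hN z z0 zN
    rw [normSqLam, ← neg_inj, ← this, innerH, innerH, ← Finset.sum_neg_distrib]
    exact Finset.sum_congr rfl fun i _ => by ring
  have hb : ∀ z : ℕ → ℝ, z 0 = 0 → z N = 0 →
      normSqB h N z = innerH h N z z - h ^ 2 / 6 * dirH h N z z := by
    intro z z0 zN
    have e : normSqB h N z = innerH h N (fun i => z i + h ^ 2 / 6 * lamX h z i) z := by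
      refine innerH_congr _ fun i _ _ => ?_
      unfold avB lamX
      field_simp
      ring
    rw [e, innerH_add, innerH_const_mul, innerH_lamX hh hN z z0 zN]
    ring
  rw [energyNorm, energySq, hl, hl, hb]
  · congr 1
    unfold sigmaN
    field_simp
    ring
  all_goals simp [y0, yN, w0, wN]

/-- Under the stability condition the coefficient of the Dirichlet form is at most `(3 - ε²) h²/12`;
with the inverse inequality at most `(1 - ε²/3)` of the squared `L²_h` norm is subtracted. When `3 ≤
ε²` the stability condition itself is contradictory. -/
theorem energySq_coercive {a h τ ε : ℝ} (hh : 0 < h) {N : ℕ} (hN : 0 < N)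
    (hst : a ^ 2 * τ ^ 2 ≤ (1 - ε ^ 2 / 2) * h ^ 2) {δ s : ℕ → ℝ} (d0 : δ 0 = 0) (dN : δ N = 0) :
    ε ^ 2 / 4 * innerH h N δ δ ≤ energySq a h τ N δ s := by
  have h1 := dirH_self_le hh hN d0 dN
  have h2 := dirH_self_nonneg hh N δ
  have h3 := dirH_self_nonneg hh N s
  have h4 := innerH_self_nonneg hh N δ
  have h5 : (h ^ 2 / 12 + τ ^ 2 * a ^ 2 / 6) * dirH h N δ δ ≤
      (h ^ 2 / 12 + (1 - ε ^ 2 / 2) * h ^ 2 / 6) * dirH h N δ δ :=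
    mul_le_mul_of_nonneg_right (by linarith) h2
  have h6 : 0 ≤ a ^ 2 * dirH h N s s := by positivity
  rcases le_total (ε ^ 2) 3 with hε | hε
  · have h7 : (3 - ε ^ 2) * (h ^ 2 * dirH h N δ δ) ≤ (3 - ε ^ 2) * (4 * innerH h N δ δ) :=
      mul_le_mul_of_nonneg_left h1 (by linarith)
    unfold energySq
    nlinarith [mul_nonneg (sq_nonneg ε) h4]
  · have h8 : a ^ 2 * τ ^ 2 < 0 ∨ ε ^ 2 ≤ 2 := by
      by_contra hc
      push Not at hc
      nlinarith [sq_nonneg h, hc.1, hc.2, mul_pos hh hh]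
    rcases h8 with h8 | h8
    · exact absurd h8 (not_lt.2 (by positivity))
    · linarith

/-- A bound of `ψ` in the dual form of the norm of `L²_h`. -/
def DualBound (h : ℝ) (N : ℕ) (ψ : ℕ → ℝ) (P : ℝ) : Prop :=
  ∀ y : ℕ → ℝ, |innerH h N ψ y| ≤ P * Real.sqrt (innerH h N y y)

/-- Here `p` is the middle level, `x` and `y` are the forward and backward difference quotients, and
`p + τ x / 2`, `p - τ y / 2` are the half sums. Pairing the equation with `x + y` turns the terms in
`x - y` into differences of quadratic forms, and the cross term with `p` into the difference for the
half sums minus `τ²/4` times that of the quotients. -/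
theorem energySq_step {a h τ : ℝ} (hh : 0 < h) (hτ : 0 < τ) {N : ℕ} (hN : 0 < N)
    {p x y ψ : ℕ → ℝ} (x0 : x 0 = 0) (xN : x N = 0) (y0 : y 0 = 0) (yN : y N = 0)
    (heq : ∀ i, 1 ≤ i → i < N → (sN (fun i => (x i - y i) / τ) i -
      τ ^ 2 * a ^ 2 / 12 * lamX h (fun i => (x i - y i) / τ) i) - a ^ 2 * lamX h p i = ψ i) :
    energySq a h τ N x (fun i => p i + τ / 2 * x i) -
      energySq a h τ N y (fun i => p i - τ / 2 * y i) = τ * innerH h N ψ (fun i => x i + y i) := by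
  set z : ℕ → ℝ := fun i => x i + y i with hz
  set d : ℕ → ℝ := fun i => x i - y i with hd
  have hz0 : z 0 = 0 := by simp [hz, x0, y0]
  have hzN : z N = 0 := by simp [hz, xN, yN]
  have e1 : τ * innerH h N ψ z = innerH h N d z +
      (h ^ 2 / 12 - τ ^ 2 * a ^ 2 / 12) * innerH h N (lamX h d) z
        - a ^ 2 * τ * innerH h N (lamX h p) z := by
    rw [← innerH_const_mul, ← innerH_const_mul h N (h ^ 2 / 12 - τ ^ 2 * a ^ 2 / 12), ← innerH_add,
      ← innerH_const_mul h N (a ^ 2 * τ), innerH, innerH, innerH, ← Finset.sum_sub_distrib]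
    refine Finset.sum_congr rfl fun i hi => ?_
    rw [Finset.mem_Icc] at hi
    rw [← heq i hi.1 (by omega)]
    unfold sN lamX
    field_simp
    ring
  rw [innerH_lamX hh hN d hz0 hzN, innerH_lamX hh hN p hz0 hzN] at e1
  rw [e1]
  have e2 : innerH h N d z = innerH h N x x - innerH h N y y := by
    simp only [innerH, ← Finset.sum_sub_distrib]
    exact Finset.sum_congr rfl fun i _ => by simp only [hz, hd]; ring
  have e3 : dirH h N d z = dirH h N x x - dirH h N y y := by
    simp only [dirH, ← Finset.sum_sub_distrib]
    exact Finset.sum_congr rfl fun i _ => by simp only [hz, hd]; ring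
  have e4 : dirH h N (fun i => p i + τ / 2 * x i) (fun i => p i + τ / 2 * x i) -
      dirH h N (fun i => p i - τ / 2 * y i) (fun i => p i - τ / 2 * y i) =
      τ * dirH h N p z + τ ^ 2 / 4 * (dirH h N x x - dirH h N y y) := by
    simp only [dirH, ← Finset.sum_sub_distrib, Finset.mul_sum, ← Finset.sum_add_distrib]
    exact Finset.sum_congr rfl fun i _ => by simp only [hz]; ring
  rw [e2, e3]
  unfold energySq
  linear_combination a ^ 2 * e4

theorem sqrt_innerH_le {a h τ ε : ℝ} (hh : 0 < h) (hε : 0 < ε) {N : ℕ} (hN : 0 < N)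
    (hst : a ^ 2 * τ ^ 2 ≤ (1 - ε ^ 2 / 2) * h ^ 2) {δ s : ℕ → ℝ} (d0 : δ 0 = 0) (dN : δ N = 0) :
    Real.sqrt (innerH h N δ δ) ≤ 2 / ε * Real.sqrt (energySq a h τ N δ s) := by
  have h1 := energySq_coercive (s := s) hh hN hst d0 dN
  rw [show 2 / ε = Real.sqrt (4 / ε ^ 2) by
    rw [Real.sqrt_div (by norm_num), Real.sqrt_sq hε.le]
    congr 1
    rw [show (4 : ℝ) = 2 ^ 2 by norm_num, Real.sqrt_sq (by norm_num)],
    ← Real.sqrt_mul (by positivity)]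
  refine Real.sqrt_le_sqrt ?_
  calc innerH h N δ δ = 4 / ε ^ 2 * (ε ^ 2 / 4 * innerH h N δ δ) := by field_simp
    _ ≤ _ := mul_le_mul_of_nonneg_left h1 (by positivity)

theorem sqrt_innerH_add_le {h : ℝ} (hh : 0 < h) (N : ℕ) (x y : ℕ → ℝ) :
    Real.sqrt (innerH h N (fun i => x i + y i) (fun i => x i + y i)) ≤
      Real.sqrt (innerH h N x x) + Real.sqrt (innerH h N y y) := by
  have hx := innerH_self_nonneg hh N x
  have hy := innerH_self_nonneg hh N y
  have hcs : innerH h N x y ≤ Real.sqrt (innerH h N x x) * Real.sqrt (innerH h N y y) := by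
    rw [← Real.sqrt_mul hx]
    apply Real.le_sqrt_of_sq_le
    have := Finset.sum_mul_sq_le_sq_mul_sq (Finset.Icc 1 (N - 1)) (fun i => x i * Real.sqrt h)
      (fun i => y i * Real.sqrt h)
    have hs : Real.sqrt h * Real.sqrt h = h := Real.mul_self_sqrt hh.le
    have e : ∀ u v : ℝ, u * Real.sqrt h * (v * Real.sqrt h) = u * v * h := fun u v => by
      calc _ = u * v * (Real.sqrt h * Real.sqrt h) := by ring
        _ = _ := by rw [hs]
    have e' : ∀ u : ℝ, (u * Real.sqrt h) ^ 2 = u * u * h := fun u => by rw [sq, e]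
    simp only [e, e'] at this
    exact this
  apply Real.sqrt_le_iff.2
  refine ⟨by positivity, ?_⟩
  have e : innerH h N (fun i => x i + y i) (fun i => x i + y i) =
      innerH h N x x + 2 * innerH h N x y + innerH h N y y := by
    simp only [innerH, Finset.mul_sum, ← Finset.sum_add_distrib]
    exact Finset.sum_congr rfl fun i _ => by ring
  rw [e, add_sq, Real.sq_sqrt hx, Real.sq_sqrt hy]
  linarith

/-- Division of a difference of squares by the sum of the roots; it makes the energy recursion
linear in the norm. -/
theorem sqrt_le_sqrt_add {E' E B : ℝ} (hB : 0 ≤ B) (hE' : 0 ≤ E') (hE : 0 ≤ E)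
    (h : E' - E ≤ B * (Real.sqrt E' + Real.sqrt E)) : Real.sqrt E' ≤ Real.sqrt E + B := by
  by_contra hc
  push Not at hc
  have h1 := Real.sqrt_nonneg E
  have h2 := Real.sq_sqrt hE
  have h3 := Real.sq_sqrt hE'
  have h4 : 0 < Real.sqrt E' + Real.sqrt E := by linarith
  nlinarith [mul_lt_mul_of_pos_right (show B < Real.sqrt E' - Real.sqrt E by linarith) h4]

/-- Stability of the compact scheme in the energy norm, for zero initial data. -/
theorem energy_stability {a h τ ε : ℝ} (ha : 0 < a) (hh : 0 < h) (hτ : 0 < τ) (hε : 0 < ε)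
    {N M : ℕ} (hN : 0 < N) (hst : a ^ 2 * τ ^ 2 ≤ (1 - ε ^ 2 / 2) * h ^ 2)
    {r ψ : ℕ → ℕ → ℝ} {P : ℕ → ℝ} (r0 : ∀ i, i ≤ N → r 0 i = 0)
    (rb : ∀ m, m ≤ M → r m 0 = 0 ∧ r m N = 0)
    (main : ∀ m, 1 ≤ m → m < M → ∀ i, 1 ≤ i → i < N →
      (sN (lamT τ r m) i - τ ^ 2 * a ^ 2 / 12 * lamX h (lamT τ r m) i)
        - a ^ 2 * lamX h (r m) i = ψ m i)
    (first : ∀ i, 1 ≤ i → i < N →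
      (sN (deltaT τ r 0) i - τ ^ 2 * a ^ 2 / 12 * lamX h (deltaT τ r 0) i)
        - τ / 2 * a ^ 2 * lamX h (r 0) i = ψ 0 i)
    (hP : ∀ m, m < M → DualBound h N (ψ m) (P m)) (hP0 : ∀ m, m < M → 0 ≤ P m) (m : ℕ)
    (hm : m < M) : energyNorm a h τ N (r m) (r (m + 1)) ≤
      2 / ε * (P 0 + τ * ∑ j ∈ Finset.Icc 1 m, P j) := by
  have hb : ∀ m, m < M → (fun i => (r (m + 1) i - r m i) / τ) 0 = 0 ∧
      (fun i => (r (m + 1) i - r m i) / τ) N = 0 := fun m hm => by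
    simp [rb m hm.le, rb (m + 1) hm]
  have hE0 : ∀ m, m < M → 0 ≤ energySq a h τ N (fun i => (r (m + 1) i - r m i) / τ)
      (fun i => (r (m + 1) i + r m i) / 2) := fun m hm =>
    le_trans (mul_nonneg (by positivity) (innerH_self_nonneg hh N _))
      (energySq_coercive hh hN hst (hb m hm).1 (hb m hm).2)
  rw [energyNorm_eq ha hh hτ hN (rb m hm.le).1 (rb m hm.le).2 (rb _ hm).1 (rb _ hm).2]
  induction m with
  | zero =>
    set x : ℕ → ℝ := fun i => (r (0 + 1) i - r 0 i) / τ with hx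
    set s : ℕ → ℝ := fun i => (r (0 + 1) i + r 0 i) / 2 with hs
    have hxb := hb 0 hm
    -- Since `r` vanishes at level `0`, the half sum is `τ x / 2`. The form `a² dirH s s` then
    -- raises the Dirichlet coefficient from `-(h²/12 + τ²a²/6)` to `-(h²/12 - τ²a²/12)`, which is
    -- that of the first equation paired with `x`.
    have e1 : energySq a h τ N x s = innerH h N (ψ 0) x := by
      have e2 : innerH h N (ψ 0) x = innerH h N x x +
          (h ^ 2 / 12 - τ ^ 2 * a ^ 2 / 12) * innerH h N (lamX h x) x := by
        rw [← innerH_const_mul, ← innerH_add]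
        refine innerH_congr _ fun i hi hi' => ?_
        have hz : lamX h (r 0) i = 0 := by
          unfold lamX
          rw [r0 _ (by omega), r0 _ (by omega), r0 _ (by omega)]
          simp
        rw [← first i hi hi', hz]
        change sN x i - τ ^ 2 * a ^ 2 / 12 * lamX h x i - τ / 2 * a ^ 2 * 0 = _
        rw [sN_eq hh]
        ring
      have e3 : dirH h N s s = τ ^ 2 / 4 * dirH h N x x := by
        simp only [dirH, Finset.mul_sum]
        refine Finset.sum_congr rfl fun i hi => ?_
        rw [Finset.mem_range] at hi
        simp only [hx, hs, r0 i hi.le, r0 (i + 1) hi]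
        field_simp
        ring
      rw [e2, innerH_lamX hh hN x hxb.1 hxb.2, energySq, e3]
      ring
    have h1 : energySq a h τ N x s ≤ P 0 * (2 / ε * Real.sqrt (energySq a h τ N x s)) := by
      nth_rewrite 1 [e1]
      refine (le_abs_self _).trans ((hP 0 hm x).trans ?_)
      exact mul_le_mul_of_nonneg_left (sqrt_innerH_le hh hε hN hst hxb.1 hxb.2) (hP0 0 hm)
    have hB : 0 ≤ 2 / ε * P 0 := mul_nonneg (by positivity) (hP0 0 hm)
    -- The comparison energy is `0`: nothing precedes the first step.
    have := sqrt_le_sqrt_add hB (hE0 0 hm) le_rfl (by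
      rw [Real.sqrt_zero]
      linarith)
    simpa using this
  | succ m ih =>
    have hm' : m < M := by omega
    have ih' := ih hm'
    set x : ℕ → ℝ := fun i => (r (m + 1 + 1) i - r (m + 1) i) / τ with hx
    set y : ℕ → ℝ := fun i => (r (m + 1) i - r m i) / τ with hy
    have hxb := hb (m + 1) hm
    have hyb := hb m hm'
    have step := energySq_step (a := a) (p := r (m + 1)) (ψ := ψ (m + 1)) hh hτ hN hxb.1 hxb.2
      hyb.1 hyb.2 (fun i hi hi' => by
        have := main (m + 1) (by omega) hm i hi hi'
        have e : lamT τ r (m + 1) = fun i => (x i - y i) / τ := by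
          ext j
          simp only [lamT, hx, hy, Nat.add_sub_cancel]
          field_simp
          ring
        rw [e] at this
        exact this)
    have ex : (fun i => r (m + 1) i + τ / 2 * x i) =
        fun i => (r (m + 1 + 1) i + r (m + 1) i) / 2 := by
      ext i; simp only [hx]; field_simp; ring
    have ey : (fun i => r (m + 1) i - τ / 2 * y i) = fun i => (r (m + 1) i + r m i) / 2 := by
      ext i; simp only [hy]; field_simp; ring
    change _ - energySq a h τ N y (fun i => r (m + 1) i - τ / 2 * y i) = _ at step
    rw [ex, ey] at step
    have hB : 0 ≤ 2 / ε * (τ * P (m + 1)) := by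
      have := hP0 (m + 1) hm
      positivity
    have hs1 := sqrt_innerH_le (δ := x) (s := fun i => (r (m + 1 + 1) i + r (m + 1) i) / 2) hh hε hN hst
      hxb.1 hxb.2
    have hs2 := sqrt_innerH_le (δ := y) (s := fun i => (r (m + 1) i + r m i) / 2) hh hε hN hst
      hyb.1 hyb.2
    have := sqrt_le_sqrt_add hB (hE0 (m + 1) hm) (hE0 m hm') (by
      refine step.le.trans ?_
      calc _ ≤ τ * (P (m + 1) * (Real.sqrt (innerH h N x x) + Real.sqrt (innerH h N y y))) := by
            refine mul_le_mul_of_nonneg_left ((le_abs_self _).trans ((hP _ hm _).trans ?_)) hτ.le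
            exact mul_le_mul_of_nonneg_left (sqrt_innerH_add_le hh N x y) (hP0 _ hm)
        _ ≤ τ * (P (m + 1) * (2 / ε * _ + 2 / ε * _)) := by
            refine mul_le_mul_of_nonneg_left (mul_le_mul_of_nonneg_left (add_le_add hs1 hs2)
              (hP0 _ hm)) hτ.le
        _ = _ := by ring)
    rw [Finset.sum_Icc_succ_top (by omega)]
    calc _ ≤ _ := this
      _ ≤ 2 / ε * (P 0 + τ * ∑ j ∈ Finset.Icc 1 m, P j) + 2 / ε * (τ * P (m + 1)) :=
        add_le_add_left ih' _
      _ = _ := by ring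

/-! ### Bounds for integrals against kernels supported in mesh windows -/

/-- The kernel `b` is bounded by `β` and supported in the window of the node `i`. -/
def WindowKernel (d : ℝ) (i : ℕ) (β : ℝ) (b : ℝ → ℝ) : Prop :=
  ∀ t, |b t| ≤ (Icc (((i : ℝ) - 1) * d) (((i : ℝ) + 1) * d)).indicator (fun _ => β) t

theorem WindowKernel.abs_le {d : ℝ} {i : ℕ} {β : ℝ} {b : ℝ → ℝ} (h : WindowKernel d i β b)
    (hβ : 0 ≤ β) (t : ℝ) : |b t| ≤ β :=
  (h t).trans (indicator_le_self' (fun _ _ => hβ) t)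

theorem windowKernel_defectKern {h : ℝ} (hh : 0 < h) {i : ℕ} (hi : 1 ≤ i) :
    WindowKernel h i (24 * h ^ 3) (defectKern h i) := abs_defectKern_le hh hi

theorem windowKernel_hat {d : ℝ} (hd : 0 < d) (i : ℕ) :
    WindowKernel d i (1 / d) (fun t => hat d i t / d) := by
  intro t
  beta_reduce
  by_cases ht : t ∈ Icc (((i : ℝ) - 1) * d) (((i : ℝ) + 1) * d)
  · rw [indicator_of_mem ht, abs_of_nonneg (div_nonneg (hat_nonneg _ _ _) hd.le)]
    exact div_le_div_of_nonneg_right (hat_le_one _ _ _) hd.le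
  · rw [indicator_of_notMem ht, hat_eq_zero hd fun hc => ht (Ioo_subset_Icc_self hc)]
    simp

theorem integral_window_le {T d : ℝ} (hd : 0 < d) {i : ℕ} (hi : 1 ≤ i)
    (hT : ((i : ℝ) + 1) * d ≤ T) {β : ℝ} {b p : ℝ → ℝ} (hb : WindowKernel d i β b)
    (hp : IntegrableOn p (Ioo 0 T)) (hp0 : ∀ t, 0 ≤ p t) :
    ∫ t in Ioo 0 T, |b t| * p t ≤ β * ∫ t in (((i : ℝ) - 1) * d)..(((i : ℝ) + 1) * d), p t := by
  have hi' : (1 : ℝ) ≤ i := by exact_mod_cast hi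
  have hs : Icc (((i : ℝ) - 1) * d) (((i : ℝ) + 1) * d) ⊆ Icc 0 T :=
    Icc_subset_Icc (mul_nonneg (by linarith) hd.le) hT
  have e : ∫ t in Ioo 0 T, (Icc (((i : ℝ) - 1) * d) (((i : ℝ) + 1) * d)).indicator
      (fun t => β * p t) t = β * ∫ t in (((i : ℝ) - 1) * d)..(((i : ℝ) + 1) * d), p t := by
    rw [← integral_Icc_eq_integral_Ioo, setIntegral_indicator measurableSet_Icc,
      inter_eq_self_of_subset_right hs, integral_const_mul,
      intervalIntegral.integral_of_le (by nlinarith), integral_Icc_eq_integral_Ioc]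
  rw [← e]
  refine integral_mono_of_nonneg (.of_forall fun t => mul_nonneg (abs_nonneg _) (hp0 t))
    ((hp.const_mul β).indicator measurableSet_Icc) (.of_forall fun t => ?_)
  have := mul_le_mul_of_nonneg_right (hb t) (hp0 t)
  refine this.trans_eq ?_
  by_cases ht : t ∈ Icc (((i : ℝ) - 1) * d) (((i : ℝ) + 1) * d)
  · simp only [indicator_of_mem ht]
  · simp only [indicator_of_notMem ht, zero_mul]

theorem intervalIntegrable_of_Ioo {T α β : ℝ} {p : ℝ → ℝ} (hp : IntegrableOn p (Ioo 0 T))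
    (hα : α ∈ Icc 0 T) (hβ : β ∈ Icc 0 T) : IntervalIntegrable p volume α β := by
  have h1 : IntegrableOn p (Icc 0 T) := by
    rwa [integrableOn_Icc_iff_integrableOn_Ioo]
  exact (h1.mono_set (uIcc_subset_Icc hα hβ)).intervalIntegrable

/-- Splitting each window at its node gives two telescoping sums, each at most the full integral;
this is the factor `2`. -/
theorem sum_integral_windows_le {T d : ℝ} (hd : 0 < d) {n : ℕ} (hT : ((n : ℝ) + 1) * d ≤ T)
    {p : ℝ → ℝ} (hp : IntegrableOn p (Ioo 0 T)) (hp0 : ∀ t, 0 ≤ p t) :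
    ∑ i ∈ Finset.Icc 1 n, ∫ t in (((i : ℝ) - 1) * d)..(((i : ℝ) + 1) * d), p t ≤
      2 * ∫ t in Ioo 0 T, p t := by
  have hmem : ∀ j : ℕ, j ≤ n + 1 → (j : ℝ) * d ∈ Icc 0 T := fun j hj => by
    have : (j : ℝ) ≤ n + 1 := by exact_mod_cast hj
    exact ⟨by positivity, le_trans (mul_le_mul_of_nonneg_right this hd.le) hT⟩
  have hint : ∀ i j : ℕ, i ≤ n + 1 → j ≤ n + 1 →
      IntervalIntegrable p volume ((i : ℝ) * d) ((j : ℝ) * d) := fun i j hi hj =>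
    intervalIntegrable_of_Ioo hp (hmem i hi) (hmem j hj)
  have hle : ∀ i j : ℕ, i ≤ j → j ≤ n + 1 → ∫ t in ((i : ℝ) * d)..((j : ℝ) * d), p t ≤
      ∫ t in Ioo 0 T, p t := fun i j hij hj => by
    have hij' : (i : ℝ) ≤ j := by exact_mod_cast hij
    rw [intervalIntegral.integral_of_le (mul_le_mul_of_nonneg_right hij' hd.le),
      ← integral_Icc_eq_integral_Ioo, ← integral_Icc_eq_integral_Ioc]
    refine setIntegral_mono_set (by rwa [integrableOn_Icc_iff_integrableOn_Ioo])
      (.of_forall hp0) (Icc_subset_Icc (hmem i (by omega)).1 (hmem j hj).2).eventuallyLE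
  have e : ∀ j ∈ Finset.range n, ∫ t in ((((j + 1 : ℕ) : ℝ) - 1) * d)..((((j + 1 : ℕ) : ℝ) + 1) * d),
      p t = (∫ t in ((j : ℝ) * d)..(((j + 1 : ℕ) : ℝ) * d), p t) +
        ∫ t in (((j + 1 : ℕ) : ℝ) * d)..(((j + 1 + 1 : ℕ) : ℝ) * d), p t := fun j hj => by
    rw [Finset.mem_range] at hj
    rw [intervalIntegral.integral_add_adjacent_intervals (hint _ _ (by omega) (by omega))
      (hint _ _ (by omega) (by omega))]
    push_cast
    rw [add_sub_cancel_right]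
  rw [← sum_range_succ_eq_sum_Icc fun i : ℕ => ∫ t in (((i : ℝ) - 1) * d)..(((i : ℝ) + 1) * d), p t,
    Finset.sum_congr rfl e, Finset.sum_add_distrib,
    intervalIntegral.sum_integral_adjacent_intervals (a := fun j : ℕ => (j : ℝ) * d)
      (fun k hk => hint _ _ (by omega) (by omega)),
    intervalIntegral.sum_integral_adjacent_intervals (a := fun j : ℕ => ((j + 1 : ℕ) : ℝ) * d)
      (fun k hk => hint _ _ (by omega) (by omega))]
  have h1 := hle 0 n (by omega) (by omega)
  have h2 := hle (0 + 1) (n + 1) (by omega) (by omega)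
  linarith

/-- Cauchy–Schwarz from nonnegativity of the integral of `(w - c)²`, with `c` the mean value. -/
theorem sq_integral_le {α β : ℝ} (hαβ : α < β) {w : ℝ → ℝ} (hw : IntervalIntegrable w volume α β)
    (hw2 : IntervalIntegrable (fun x => w x ^ 2) volume α β) :
    (∫ x in α..β, w x) ^ 2 ≤ (β - α) * ∫ x in α..β, w x ^ 2 := by
  set c := (∫ x in α..β, w x) / (β - α) with hc
  have hL : 0 < β - α := sub_pos.2 hαβ
  have h0 : 0 ≤ ∫ x in α..β, (w x - c) ^ 2 :=
    intervalIntegral.integral_nonneg hαβ.le fun x _ => sq_nonneg _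
  have e : ∫ x in α..β, (w x - c) ^ 2 =
      (∫ x in α..β, w x ^ 2) - 2 * c * (∫ x in α..β, w x) + (β - α) * c ^ 2 := by
    have : ∀ x, (w x - c) ^ 2 = w x ^ 2 - 2 * c * w x + c ^ 2 := fun x => by ring
    simp only [this]
    rw [intervalIntegral.integral_add (hw2.sub (hw.const_mul _)) (by simp),
      intervalIntegral.integral_sub hw2 (hw.const_mul _), intervalIntegral.integral_const_mul,
      intervalIntegral.integral_const, smul_eq_mul]
  rw [e] at h0
  have h1 : (β - α) * c = ∫ x in α..β, w x := by rw [hc]; field_simp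
  rw [← h1] at h0 ⊢
  nlinarith [mul_nonneg hL.le h0]

theorem normL2_toReal_sq {X : ℝ} {w : ℝ → ℝ} (hw : MemLp w 2 (muI X)) :
    (normL2 X w).toReal ^ 2 = ∫ x in Ioo 0 X, w x ^ 2 := by
  have h0 : 0 ≤ ∫ x in Ioo 0 X, w x ^ 2 := integral_nonneg fun x => sq_nonneg _
  rw [normL2, hw.eLpNorm_eq_integral_rpow_norm (by norm_num) (by norm_num)]
  have e : ∀ x, ‖w x‖ ^ (2 : ENNReal).toReal = w x ^ 2 := fun x => by simp
  simp only [e]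
  rw [ENNReal.toReal_ofReal (by positivity), ← Real.rpow_natCast, ← Real.rpow_mul h0]
  norm_num

theorem dualBound_of_sum_sq {h : ℝ} (hh : 0 < h) {N : ℕ} {z : ℕ → ℝ} {P : ℝ} (hP : 0 ≤ P)
    (hz : innerH h N z z ≤ P ^ 2) : DualBound h N z P := by
  intro y
  have hy := innerH_self_nonneg hh N y
  rw [← Real.sqrt_sq hP, ← Real.sqrt_mul (sq_nonneg _)]
  apply Real.abs_le_sqrt
  refine le_trans ?_ (mul_le_mul_of_nonneg_right hz hy)
  have := Finset.sum_mul_sq_le_sq_mul_sq (Finset.Icc 1 (N - 1)) (fun i => z i * Real.sqrt h)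
    (fun i => y i * Real.sqrt h)
  have hs : Real.sqrt h * Real.sqrt h = h := Real.mul_self_sqrt hh.le
  have e : ∀ u v : ℝ, u * Real.sqrt h * (v * Real.sqrt h) = u * v * h := fun u v => by
    calc _ = u * v * (Real.sqrt h * Real.sqrt h) := by ring
      _ = _ := by rw [hs]
  have e' : ∀ u : ℝ, (u * Real.sqrt h) ^ 2 = u * u * h := fun u => by rw [sq, e]
  simp only [e, e'] at this
  exact this

/-- The dual bound is tested with `z` itself. -/
theorem DualBound.sum_sq {h : ℝ} (hh : 0 < h) {N : ℕ} {z : ℕ → ℝ} {P : ℝ}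
    (hz : DualBound h N z P) : innerH h N z z ≤ P ^ 2 := by
  have h0 := innerH_self_nonneg hh N z
  have h1 := (le_abs_self _).trans (hz z)
  have h2 := Real.sq_sqrt h0
  have h3 := Real.sqrt_nonneg (innerH h N z z)
  rcases h3.eq_or_lt with h4 | h4
  · rw [← h4] at h2; nlinarith [sq_nonneg P]
  · have h5 : Real.sqrt (innerH h N z z) ≤ P := by
      by_contra hc
      push Not at hc
      nlinarith
    rw [← h2]
    exact pow_le_pow_left₀ h3 h5 2

/-- Integrals of an `L²` function against window kernels, in the norm of `L²_h`. -/
theorem dualBound_integral_window {X h : ℝ} (hh : 0 < h) {N : ℕ} (hX : (N : ℝ) * h = X)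
    {w : ℝ → ℝ} (hw : MemLp w 2 (muI X)) {K : ℕ → ℝ → ℝ} {κ : ℝ} (hκ : 0 ≤ κ)
    (hK : ∀ i, 1 ≤ i → i < N → WindowKernel h i κ (K i)) :
    DualBound h N (fun i => ∫ x in Ioo 0 X, K i x * w x) (2 * κ * h * (normL2 X w).toReal) := by
  refine dualBound_of_sum_sq hh (by positivity) ?_
  have hwi := hw.integrable_muI
  have hw2 : IntegrableOn (fun x => w x ^ 2) (Ioo 0 X) := hw.integrable_sq
  have hXi : ∀ i : ℕ, i < N → ((i : ℝ) + 1) * h ≤ X := fun i hi => by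
    have : (i : ℝ) + 1 ≤ N := by exact_mod_cast hi
    rw [← hX]; exact mul_le_mul_of_nonneg_right this hh.le
  -- Cauchy–Schwarz on a window of length `2h` gives `2 κ² h²`; the twofold overlap of the windows
  -- doubles it to `(2 κ h)²`.
  have key : ∀ i ∈ Finset.Icc 1 (N - 1),
      (∫ x in Ioo 0 X, K i x * w x) * (∫ x in Ioo 0 X, K i x * w x) * h ≤
        2 * κ ^ 2 * h ^ 2 * ∫ t in (((i : ℝ) - 1) * h)..(((i : ℝ) + 1) * h), w t ^ 2 := by
    intro i hi
    rw [Finset.mem_Icc] at hi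
    have hi2 : i < N := by omega
    have hi1 : (1 : ℝ) ≤ i := by exact_mod_cast hi.1
    have h1 : |∫ x in Ioo 0 X, K i x * w x| ≤
        κ * ∫ t in (((i : ℝ) - 1) * h)..(((i : ℝ) + 1) * h), |w t| := by
      refine le_trans ?_ (integral_window_le hh hi.1 (hXi i hi2) (hK i hi.1 hi2) hwi.abs
        fun t => abs_nonneg _)
      simp only [← abs_mul]
      exact abs_integral_le_integral_abs
    have hm1 : ((i : ℝ) - 1) * h ∈ Icc 0 X :=
      ⟨mul_nonneg (by linarith) hh.le, by nlinarith [hXi i hi2]⟩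
    have hm2 : ((i : ℝ) + 1) * h ∈ Icc 0 X := ⟨by positivity, hXi i hi2⟩
    have h2 := sq_integral_le (show ((i : ℝ) - 1) * h < ((i : ℝ) + 1) * h by nlinarith)
      (intervalIntegrable_of_Ioo hwi.abs hm1 hm2)
      (by simpa using intervalIntegrable_of_Ioo hw2 hm1 hm2)
    simp only [sq_abs] at h2
    rw [show ((i : ℝ) + 1) * h - (i - 1) * h = 2 * h by ring] at h2
    have h3 := pow_le_pow_left₀ (abs_nonneg _) h1 2
    rw [sq_abs, mul_pow] at h3
    calc _ = (∫ x in Ioo 0 X, K i x * w x) ^ 2 * h := by ring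
      _ ≤ (κ ^ 2 * (2 * h * ∫ t in (((i : ℝ) - 1) * h)..(((i : ℝ) + 1) * h), w t ^ 2)) * h :=
        mul_le_mul_of_nonneg_right (h3.trans (mul_le_mul_of_nonneg_left h2 (sq_nonneg _))) hh.le
      _ = _ := by ring
  rcases Nat.eq_zero_or_pos N with hN | hN
  · subst hN
    simp only [innerH]
    simp
    positivity
  have hNX : (((N - 1 : ℕ) : ℝ) + 1) * h ≤ X := hXi (N - 1) (by omega)
  calc _ ≤ ∑ i ∈ Finset.Icc 1 (N - 1),
        2 * κ ^ 2 * h ^ 2 * ∫ t in (((i : ℝ) - 1) * h)..(((i : ℝ) + 1) * h), w t ^ 2 :=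
        Finset.sum_le_sum key
    _ ≤ 2 * κ ^ 2 * h ^ 2 * (2 * ∫ x in Ioo 0 X, w x ^ 2) := by
        rw [← Finset.mul_sum]
        exact mul_le_mul_of_nonneg_left (sum_integral_windows_le hh hNX hw2 fun t => sq_nonneg _)
          (by positivity)
    _ = _ := by rw [mul_pow, normL2_toReal_sq hw]; ring

/-- Minkowski's inequality for `L²_h` in dual form. -/
theorem dualBound_integral {h T : ℝ} {N : ℕ} {G : ℕ → ℝ → ℝ} {b p : ℝ → ℝ} {β : ℝ}
    (hG : ∀ i, 1 ≤ i → i < N → IntegrableOn (G i) (Ioo 0 T)) (hp : IntegrableOn p (Ioo 0 T))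
    (hb : AEStronglyMeasurable b (muI T)) (hβ : ∀ t ∈ Ioo 0 T, |b t| ≤ β)
    (h1 : ∀ᵐ t ∂(muI T), DualBound h N (fun i => G i t) (p t)) :
    DualBound h N (fun i => ∫ t in Ioo 0 T, b t * G i t) (∫ t in Ioo 0 T, |b t| * p t) := by
  intro y
  have hβ' : ∀ᵐ t ∂(muI T), ‖b t‖ ≤ β := (ae_restrict_iff' measurableSet_Ioo).2 (.of_forall hβ)
  have e : innerH h N (fun i => ∫ t in Ioo 0 T, b t * G i t) y =
      ∫ t in Ioo 0 T, b t * innerH h N (fun i => G i t) y := by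
    simp only [innerH, Finset.mul_sum]
    rw [integral_finsetSum]
    · refine Finset.sum_congr rfl fun i _ => ?_
      rw [mul_assoc, ← integral_mul_const]
      congr 1; ext t; ring
    · intro i hi
      rw [Finset.mem_Icc] at hi
      have := (hG i hi.1 (by omega)).bdd_mul hb hβ'
      refine (this.mul_const (y i * h)).congr (.of_forall fun t => ?_)
      simp only; ring
  rw [e, ← integral_mul_const]
  rw [← Real.norm_eq_abs]
  refine norm_integral_le_of_norm_le (g := fun t => |b t| * p t * Real.sqrt (innerH h N y y))
    ((hp.bdd_mul hb.norm (c := β) ?_).mul_const _) ?_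
  · filter_upwards [hβ'] with t ht
    simpa using ht
  · filter_upwards [h1] with t ht
    rw [norm_mul, mul_assoc]
    exact mul_le_mul_of_nonneg_left (ht y) (norm_nonneg _)

theorem DualBound.add {h : ℝ} {N : ℕ} {z z' : ℕ → ℝ} {P P' : ℝ} (hz : DualBound h N z P)
    (hz' : DualBound h N z' P') : DualBound h N (fun i => z i + z' i) (P + P') := by
  intro y
  rw [innerH_add, add_mul]
  exact (abs_add_le _ _).trans (add_le_add (hz y) (hz' y))

theorem DualBound.const_mul {h : ℝ} {N : ℕ} {z : ℕ → ℝ} {P : ℝ} (hz : DualBound h N z P) (c : ℝ) :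
    DualBound h N (fun i => c * z i) (|c| * P) := by
  intro y
  rw [innerH_const_mul, abs_mul, mul_assoc]
  exact mul_le_mul_of_nonneg_left (hz y) (abs_nonneg _)

theorem DualBound.mono {h : ℝ} {N : ℕ} {z : ℕ → ℝ} {P P' : ℝ} (hz : DualBound h N z P)
    (hP : P ≤ P') : DualBound h N z P' := fun y =>
  (hz y).trans (mul_le_mul_of_nonneg_right hP (Real.sqrt_nonneg _))

theorem DualBound.congr {h : ℝ} {N : ℕ} {z z' : ℕ → ℝ} {P : ℝ} (hz : DualBound h N z P)
    (e : ∀ i, 1 ≤ i → i < N → z' i = z i) : DualBound h N z' P := fun y => by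
  rw [innerH_congr y e]; exact hz y

/-- `Λ_x` is bounded in the norm of `L²_h` on functions vanishing at the end nodes. -/
theorem DualBound.lamX {h : ℝ} (hh : 0 < h) {N : ℕ} {z : ℕ → ℝ} {P : ℝ} (hP : 0 ≤ P)
    (hz : DualBound h N z P) (z0 : z 0 = 0) (zN : z N = 0) :
    DualBound h N (lamX h z) (4 / h ^ 2 * P) := by
  rcases Nat.eq_zero_or_pos N with hN | hN
  · subst hN
    intro y
    simp only [innerH]
    simp
  refine dualBound_of_sum_sq hh (by positivity) ?_
  have h1 := hz.sum_sq hh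
  obtain ⟨n, rfl⟩ : ∃ n, N = n + 1 := ⟨N - 1, by omega⟩
  have hs : ∀ f : ℕ → ℝ, innerH h (n + 1) f f = h * ∑ j ∈ Finset.range n, f (j + 1) ^ 2 := by
    intro f
    rw [sum_range_succ_eq_sum_Icc fun i => f i ^ 2, innerH, Nat.add_sub_cancel, Finset.mul_sum]
    exact Finset.sum_congr rfl fun i _ => by ring
  rw [hs] at h1 ⊢
  have b1 : ∑ j ∈ Finset.range n, z j ^ 2 ≤ ∑ j ∈ Finset.range n, z (j + 1) ^ 2 := by
    have := Finset.sum_range_succ (fun j => z j ^ 2) n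
    rw [Finset.sum_range_succ', z0] at this
    nlinarith [sq_nonneg (z n)]
  have b2 : ∑ j ∈ Finset.range n, z (j + 2) ^ 2 ≤ ∑ j ∈ Finset.range n, z (j + 1) ^ 2 := by
    have := Finset.sum_range_succ (fun j => z (j + 1) ^ 2) n
    rw [Finset.sum_range_succ', zN] at this
    nlinarith [sq_nonneg (z 1)]
  -- Cauchy–Schwarz with the weights `1, 2, 1`, whose sum is `4`. The same weights, after shifting
  -- the indices, give the second factor `4` in `b4`.
  have b3 : ∑ j ∈ Finset.range n, CompactWave.lamX h z (j + 1) ^ 2 ≤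
      4 / h ^ 4 * ∑ j ∈ Finset.range n, (z j ^ 2 + 2 * z (j + 1) ^ 2 + z (j + 2) ^ 2) := by
    rw [Finset.mul_sum]
    refine Finset.sum_le_sum fun j _ => ?_
    simp only [CompactWave.lamX, Nat.add_sub_cancel]
    rw [div_pow, div_mul_eq_mul_div, ← pow_mul]
    refine div_le_div_of_nonneg_right ?_ (by positivity)
    nlinarith [sq_nonneg (z j + z (j + 1)), sq_nonneg (z (j + 2) + z (j + 1)),
      sq_nonneg (z j - z (j + 2))]
  have b4 : ∑ j ∈ Finset.range n, (z j ^ 2 + 2 * z (j + 1) ^ 2 + z (j + 2) ^ 2) ≤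
      4 * ∑ j ∈ Finset.range n, z (j + 1) ^ 2 := by
    rw [Finset.sum_add_distrib, Finset.sum_add_distrib, ← Finset.mul_sum]
    linarith
  calc _ ≤ h * (4 / h ^ 4 * (4 * ∑ j ∈ Finset.range n, z (j + 1) ^ 2)) :=
        mul_le_mul_of_nonneg_left (b3.trans (mul_le_mul_of_nonneg_left b4 (by positivity))) hh.le
    _ = 16 / h ^ 4 * (h * ∑ j ∈ Finset.range n, z (j + 1) ^ 2) := by ring
    _ ≤ 16 / h ^ 4 * P ^ 2 := mul_le_mul_of_nonneg_left h1 (by positivity)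
    _ = _ := by field_simp; ring

/-! ### Truncation error of the three-level equation -/

/-- The wave equation holds almost everywhere, with the weak second derivatives. -/
theorem IsEnergySolution.ae_free_term {a X T : ℝ} (hX : 0 < X) {u0 u1 : ℝ → ℝ}
    {f u u02 u20 : ℝ → ℝ → ℝ} (hu : IsEnergySolution a X T u0 u1 f u) (hf : MemL21 X T f)
    (h02 : MemL21 X T u02) (h20 : MemL21 X T u20) (e02 : WeakEqQ X T 0 2 u u02)
    (e20 : WeakEqQ X T 2 0 u u20) :
    ∀ᵐ t ∂(muI T), ∀ᵐ x ∂(muI X), f x t = u02 x t - a ^ 2 * u20 x t := by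
  have hui := (hu.isCurve hX).integrable
  set d : ℝ × ℝ → ℝ := fun p => f p.1 p.2 - (u02 p.1 p.2 - a ^ 2 * u20 p.1 p.2) with hd
  have hdi : Integrable d ((muI X).prod (muI T)) :=
    hf.integrable.sub (h02.integrable.sub (h20.integrable.const_mul _))
  have hU : IsOpen (domQ X T) := isOpen_Ioo.prod isOpen_Ioo
  have key : ∀ᵐ p, p ∈ domQ X T → d p = 0 := by
    refine hU.ae_eq_zero_of_integral_contDiff_smul_eq_zero ?_ ?_
    · refine IntegrableOn.locallyIntegrableOn ?_
      rwa [IntegrableOn, restrict_domQ]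
    · intro g hg hc hs
      have ht : IsTestQ X T fun x t => g (x, t) := ⟨hg, hc, hs⟩
      have E := hu.eqn _ ht
      have E1 := e02 _ ht
      have E2 := e20 _ ht
      have s1 : ∫ p, g p • d p = ∫ p in domQ X T, g p • d p := by
        refine (setIntegral_eq_integral_of_forall_compl_eq_zero fun p hp => ?_).symm
        rw [image_eq_zero_of_notMem_tsupport fun h => hp (hs h), zero_smul]
      rw [s1]
      simp only [restrict_domQ] at *
      have c1 := (contDiff_partialXT (φ := fun x t => g (x, t)) ht.smooth 0 2).continuous
      have c2 := (contDiff_partialXT (φ := fun x t => g (x, t)) ht.smooth 2 0).continuous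
      have i1 := integrable_mul_continuous hui c1
      have i2 := integrable_mul_continuous hui c2
      have i3 := integrable_mul_continuous hf.integrable (ψ := fun x t => g (x, t)) hg.continuous
      have i4 := integrable_mul_continuous h02.integrable (ψ := fun x t => g (x, t)) hg.continuous
      have i5 := integrable_mul_continuous h20.integrable (ψ := fun x t => g (x, t)) hg.continuous
      have t1 : (fun p : ℝ × ℝ => u p.1 p.2 * (partialXT 0 2 (fun x t => g (x, t)) p.1 p.2 -
          a ^ 2 * partialXT 2 0 (fun x t => g (x, t)) p.1 p.2)) = fun p =>
          u p.1 p.2 * partialXT 0 2 (fun x t => g (x, t)) p.1 p.2 -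
          a ^ 2 * (u p.1 p.2 * partialXT 2 0 (fun x t => g (x, t)) p.1 p.2) := by
        ext p; ring
      have t2 : (fun p => g p • d p) = fun p : ℝ × ℝ => f p.1 p.2 * g (p.1, p.2) -
          (u02 p.1 p.2 * g (p.1, p.2) - a ^ 2 * (u20 p.1 p.2 * g (p.1, p.2))) := by
        ext p; simp only [hd, smul_eq_mul, Prod.mk.eta]; ring
      rw [t1, integral_sub i1 (i2.const_mul _), integral_const_mul, E1, E2] at E
      have i6 : Integrable (fun p : ℝ × ℝ => u02 p.1 p.2 * g (p.1, p.2) -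
          a ^ 2 * (u20 p.1 p.2 * g (p.1, p.2))) ((muI X).prod (muI T)) := i4.sub (i5.const_mul _)
      rw [t2, integral_sub i3 i6, integral_sub i4 (i5.const_mul _), integral_const_mul, ← E]
      ring
  have key2 : ∀ᵐ p ∂((muI X).prod (muI T)), d p = 0 := by
    rw [← restrict_domQ]
    exact (ae_restrict_iff' hU.measurableSet).2 key
  -- The swap makes `t` the outer variable, so that the equation is available on almost every time
  -- slice.
  have key3 := Measure.ae_ae_of_ae_prod
    ((Measure.measurePreserving_swap (μ := muI T) (ν := muI X)).quasiMeasurePreserving.ae key2)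
  filter_upwards [key3] with t ht
  filter_upwards [ht] with x hx
  exact sub_eq_zero.1 hx

/-- The weight of the time average `q_τ`. -/
noncomputable def timeWeight (τ : ℝ) (m : ℕ) (t : ℝ) : ℝ :=
  if m = 0 then 2 / τ * hat τ 0 t else hat τ m t / τ

theorem timeWeight_zero (τ : ℝ) : timeWeight τ 0 = fun t => 2 / τ * hat τ 0 t := by
  ext t; simp [timeWeight]

theorem timeWeight_of_pos (τ : ℝ) {m : ℕ} (hm : 1 ≤ m) :
    timeWeight τ m = fun t => hat τ m t / τ := by
  ext t; simp [timeWeight, show m ≠ 0 by omega]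

theorem continuous_timeWeight (τ : ℝ) (m : ℕ) : Continuous (timeWeight τ m) := by
  rcases Nat.eq_zero_or_pos m with rfl | hm
  · rw [timeWeight_zero]; exact continuous_const.mul (continuous_hat _ _)
  · rw [timeWeight_of_pos τ hm]; exact (continuous_hat _ _).div_const _

theorem qTau_eq_setIntegral {T τ : ℝ} (hτ : 0 < τ) {m : ℕ} (hT : ((m : ℝ) + 1) * τ ≤ T)
    (z : ℝ → ℝ) : qTau τ z m = ∫ t in Ioo 0 T, timeWeight τ m t * z t := by
  rcases Nat.eq_zero_or_pos m with rfl | hm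
  · have hT' : τ ≤ T := by simpa using hT
    rw [timeWeight_zero, qTau, if_pos rfl, intervalIntegral.integral_of_le hτ.le,
      integral_Ioc_eq_integral_Ioo, ← integral_const_mul]
    have e := setIntegral_eq_of_subset_of_forall_sdiff_eq_zero (μ := volume) measurableSet_Ioo
      (Ioo_subset_Ioo_right hT' : Ioo 0 τ ⊆ Ioo 0 T)
      (f := fun t => 2 / τ * hat τ 0 t * z t) fun t ht => by
        rw [hat_eq_zero hτ fun hc => ht.2 ⟨ht.1.1, by simpa using hc.2⟩]; simp
    rw [e]
    exact setIntegral_congr_fun measurableSet_Ioo fun t _ => by ring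
  · rw [timeWeight_of_pos τ hm, ← qH_eq_setIntegral hτ hm hT, qTau, if_neg (by omega), qH]

theorem fMesh_eq {X T h τ : ℝ} (hh : 0 < h) (hτ : 0 < τ) {i m : ℕ} (hi : 1 ≤ i)
    (hX : ((i : ℝ) + 1) * h ≤ X) (hT : ((m : ℝ) + 1) * τ ≤ T) {f : ℝ → ℝ → ℝ}
    (hf : MemL21 X T f) : fMesh h τ f m i =
      ∫ t in Ioo 0 T, timeWeight τ m t * ∫ x in Ioo 0 X, hat h i x / h * f x t := by
  have ca := (continuous_hat h i).div_const h
  have cb := continuous_timeWeight τ m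
  obtain ⟨A, hA⟩ := ca.exists_bound_Ioo (T := X)
  obtain ⟨B, hB⟩ := cb.exists_bound_Ioo (T := T)
  rw [integral_mul_integral_comm hf.integrable ca.aestronglyMeasurable cb.aestronglyMeasurable
    hA hB, fMesh, qH_eq_setIntegral hh hi hX]
  simp only [qTau_eq_setIntegral hτ hT]

theorem integrableOn_mul_continuous {T : ℝ} {b G : ℝ → ℝ} (hb : Continuous b)
    (hG : IntegrableOn G (Ioo 0 T)) : IntegrableOn (fun t => b t * G t) (Ioo 0 T) := by
  obtain ⟨B, hB⟩ := hb.exists_bound_Ioo (T := T)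
  exact hG.bdd_mul hb.aestronglyMeasurable ((ae_restrict_iff' measurableSet_Ioo).2 (.of_forall hB))

/-- The mesh free term through weighted averages of the second derivatives of the solution. -/
theorem IsEnergySolution.fMesh_eq_sub {a X T : ℝ} {u0 u1 : ℝ → ℝ}
    {f u u02 u20 : ℝ → ℝ → ℝ} (hu : IsEnergySolution a X T u0 u1 f u) (hf : MemL21 X T f)
    (h02 : MemL21 X T u02) (h20 : MemL21 X T u20) (e02 : WeakEqQ X T 0 2 u u02)
    (e20 : WeakEqQ X T 2 0 u u20) {h τ : ℝ} (hh : 0 < h) (hτ : 0 < τ) {i m : ℕ} (hi : 1 ≤ i)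
    (hX : ((i : ℝ) + 1) * h ≤ X) (hT : ((m : ℝ) + 1) * τ ≤ T) : fMesh h τ f m i =
      (∫ t in Ioo 0 T, timeWeight τ m t * ∫ x in Ioo 0 X, hat h i x / h * u02 x t) -
        a ^ 2 * ∫ t in Ioo 0 T, timeWeight τ m t * ∫ x in Ioo 0 X, hat h i x / h * u20 x t := by
  have hX0 : 0 < X := lt_of_lt_of_le (by positivity) hX
  have ca := (continuous_hat h i).div_const h
  have cb := continuous_timeWeight τ m
  obtain ⟨A, hA⟩ := ca.exists_bound_Ioo (T := X)
  have j1 := integrableOn_mul_continuous cb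
    (integrableOn_integral_kernel h02.integrable ca.aestronglyMeasurable hA)
  have j2 := integrableOn_mul_continuous cb
    (integrableOn_integral_kernel h20.integrable ca.aestronglyMeasurable hA)
  rw [fMesh_eq hh hτ hi hX hT hf, ← integral_const_mul, ← integral_sub j1 (j2.const_mul _)]
  refine integral_congr_ae ?_
  filter_upwards [hu.ae_free_term hX0 hf h02 h20 e02 e20, h02.ae_memLp, h20.ae_memLp]
    with t ht m1 m2
  have k1 := integrableOn_mul_continuous ca m1.integrable_muI
  have k2 := integrableOn_mul_continuous ca m2.integrable_muI
  have : ∫ x in Ioo 0 X, hat h i x / h * f x t = ∫ x in Ioo 0 X,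
      (hat h i x / h * u02 x t - a ^ 2 * (hat h i x / h * u20 x t)) := by
    refine integral_congr_ae ?_
    filter_upwards [ht] with x hx
    rw [hx]; ring
  rw [this, integral_sub k1 (k2.const_mul _), integral_const_mul]
  ring

/-- The truncation error of the three-level equation. -/
theorem IsEnergySolution.truncation_main {a X T : ℝ} {u0 u1 : ℝ → ℝ}
    {f u u02 u20 u42 u24 : ℝ → ℝ → ℝ} (hu : IsEnergySolution a X T u0 u1 f u)
    (hf : MemL21 X T f) (h02 : MemL21 X T u02) (h20 : MemL21 X T u20) (h42 : MemL21 X T u42)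
    (h24 : MemL21 X T u24) (e02 : WeakEqQ X T 0 2 u u02) (e20 : WeakEqQ X T 2 0 u u20)
    (e42 : WeakEqQ X T 4 2 u u42) (e24 : WeakEqQ X T 2 4 u u24) {h τ : ℝ} (hh : 0 < h)
    (hτ : 0 < τ) {i m : ℕ} (hi : 1 ≤ i) (hX : ((i : ℝ) + 1) * h ≤ X) (hm : 1 ≤ m)
    (hT : ((m : ℝ) + 1) * τ ≤ T) :
    (sN (lamT τ (fun m i => u (i * h) (m * τ)) m) i -
        τ ^ 2 * a ^ 2 / 12 * lamX h (lamT τ (fun m i => u (i * h) (m * τ)) m) i) -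
      a ^ 2 * lamX h (fun i => u (i * h) (m * τ)) i - fMesh h τ f m i =
    (∫ t in Ioo 0 T, hat τ m t / τ * ∫ x in Ioo 0 X, defectKern h i x * u42 x t) -
      a ^ 2 * ∫ t in Ioo 0 T, defectKern τ m t * ∫ x in Ioo 0 X, hat h i x / h * u24 x t := by
  have hX0 : 0 < X := lt_of_lt_of_le (by positivity) hX
  have hT0 : 0 < T := lt_of_lt_of_le (by positivity) hT
  have hc := hu.isCurve hX0
  have ch := (continuous_hat h i).div_const h
  have cd := continuous_defectKern hh hi
  obtain ⟨A, hA⟩ := ch.exists_bound_Ioo (T := X)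
  obtain ⟨B, hB⟩ := cd.exists_bound_Ioo (T := X)
  have LN := isFun_numDefect hh hi hX
  have LL := isFun_lamX hh hX
  have LQ := isFun_integral hX0.le (ρ := fun x => hat h i x / h) ch.continuousOn.integrableOn_Ioo
  -- Four identities in time: `rF` and `rQ` express `Λ_t` of `(s_N - q_h) u` and of `q_h u`; `rH`
  -- and `rZ` express the Numerov defect in time and `q_τ` of `Λ_x u`.
  have rF := represents_lamX hτ hm hT _ _ (hc.continuousOn_fun LN)
    (integrableOn_integral_kernel h42.integrable cd.aestronglyMeasurable hB)
    (e42.weakEq_time hX0 hT0 hc h42.integrable LN (represents_numDefect hh hi hX)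
      cd.aestronglyMeasurable hB)
  have rQ := represents_lamX hτ hm hT _ _ (hc.continuousOn_fun LQ)
    (integrableOn_integral_kernel h02.integrable ch.aestronglyMeasurable hA)
    (e02.weakEq_time hX0 hT0 hc h02.integrable LQ (represents_zero _)
      ch.aestronglyMeasurable hA)
  have rH := represents_numDefect hτ hm hT _ _ (hc.continuousOn_fun LL)
    (integrableOn_integral_kernel h24.integrable ch.aestronglyMeasurable hA)
    (e24.weakEq_time hX0 hT0 hc h24.integrable LL (represents_lamX hh hi hX)
      ch.aestronglyMeasurable hA)
  have rZ := represents_zero (fun t => hat τ m t / τ) _ _ (hc.continuousOn_fun LL)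
    (integrableOn_integral_kernel h20.integrable ch.aestronglyMeasurable hA)
    (e20.weakEq_time hX0 hT0 hc h20.integrable LL (represents_lamX hh hi hX)
      ch.aestronglyMeasurable hA)
  -- The average of `∂_t² u` in the free term cancels `Λ_t q_h u`. The term with `τ² a²/12`
  -- completes `Λ_x u` to its Numerov average in time, from which `q_τ Λ_x u` is subtracted.
  rw [hu.fMesh_eq_sub hf h02 h20 e02 e20 hh hτ hi hX hT, timeWeight_of_pos τ hm, ← rF, ← rQ, ← rH,
    ← rZ, numDefect, qH_eq_setIntegral hτ hm hT,
    sN_eq hτ (nodal τ fun t => lamX h (nodal h fun x => u x t) i) m]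
  simp only [numDefect, qH_eq_setIntegral hh hi hX, nodal, lamX, lamT, sN]
  ring

/-- Minkowski's inequality in time reduces the claim to the bound for window kernels on each slice.
-/
theorem dualBound_space_time {X T h : ℝ} (hh : 0 < h) {N : ℕ} (hX : (N : ℝ) * h = X)
    {g : ℝ → ℝ → ℝ} (hg : MemL21 X T g) {K : ℕ → ℝ → ℝ} {κ : ℝ} (hκ : 0 ≤ κ)
    (hK : ∀ i, 1 ≤ i → i < N → WindowKernel h i κ (K i))
    (hKc : ∀ i, 1 ≤ i → i < N → Continuous (K i)) {b : ℝ → ℝ} (hb : Continuous b) :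
    DualBound h N (fun i => ∫ t in Ioo 0 T, b t * ∫ x in Ioo 0 X, K i x * g x t)
      (2 * κ * h * ∫ t in Ioo 0 T, |b t| * sliceNorm X g t) := by
  obtain ⟨β, hβ⟩ := hb.exists_bound_Ioo (T := T)
  refine (dualBound_integral (p := fun t => 2 * κ * h * sliceNorm X g t) (fun i h1 h2 => ?_)
    (hg.integrable_sliceNorm.const_mul _) hb.aestronglyMeasurable hβ ?_).mono ?_
  · exact integrableOn_integral_kernel hg.integrable (hKc i h1 h2).aestronglyMeasurable
      fun x _ => (hK i h1 h2).abs_le hκ x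
  · filter_upwards [hg.ae_memLp] with t ht
    exact dualBound_integral_window hh hX ht hκ hK
  · rw [← integral_const_mul]
    refine (integral_congr_ae (.of_forall fun t => ?_)).le
    ring

/-! ### Truncation error of the first time step -/

theorem hat_zero_of_nonneg {τ t : ℝ} (hτ : 0 < τ) (ht : 0 ≤ t) :
    τ * hat τ 0 t = max (τ - t) 0 := by
  rw [hat, Nat.cast_zero, sub_zero, abs_of_nonneg (by positivity), mul_max_of_nonneg _ _ hτ.le]
  congr 1
  · field_simp
  · simp

/-- The forward difference at `t = 0` through the derivative and a weighted average. -/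
theorem WeakEq.forward_diff {T τ d : ℝ} (hτ : 0 < τ) (hT : τ ≤ T) {F G : ℝ → ℝ}
    (hF : ContinuousOn F (Icc 0 T)) (hG : IntegrableOn G (Ioo 0 T)) (h : WeakEq T 2 F G)
    (hd : HasDerivWithinAt F d (Icc 0 T) 0) :
    (F τ - F 0) / τ = d + ∫ t in Ioo 0 T, hat τ 0 t * G t := by
  have hT0 := hτ.trans_le hT
  obtain ⟨c, h1, h2⟩ := h.taylor_deriv hT0 one_ne_zero hF hG
  rw [h2 τ ⟨hτ.le, hT⟩, h2 0 ⟨le_rfl, hT0.le⟩, integral_kern_zero, HasDerivWithinAt.unique_Icc hT0 hd h1]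
  have : ∫ s in Ioo 0 T, kern 1 τ s * G s = τ * ∫ t in Ioo 0 T, hat τ 0 t * G t := by
    rw [← integral_const_mul]
    refine setIntegral_congr_fun measurableSet_Ioo fun t ht => ?_
    rw [← mul_assoc, hat_zero_of_nonneg hτ ht.1.le, kern_one]
  rw [this, eq_comm, eq_div_iff hτ.ne']
  simp [Finset.sum_range_succ]
  ring

theorem integral_hat_zero {T τ : ℝ} (hτ : 0 < τ) (hT : τ ≤ T) (W : ℝ → ℝ) :
    ∫ t in Ioo 0 T, hat τ 0 t * W t = ∫ t in (0 : ℝ)..τ, (1 - t / τ) * W t := by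
  have e := setIntegral_eq_of_subset_of_forall_sdiff_eq_zero (μ := volume) measurableSet_Ioo
    (Ioo_subset_Ioo_right hT : Ioo 0 τ ⊆ Ioo 0 T)
    (f := fun t => hat τ 0 t * W t) fun t ht => by
      rw [hat_eq_zero hτ fun hc => ht.2 ⟨ht.1.1, by simpa using hc.2⟩]; simp
  rw [e, intervalIntegral.integral_of_le hτ.le, integral_Ioc_eq_integral_Ioo]
  refine setIntegral_congr_fun measurableSet_Ioo fun t ht => ?_
  have h1 : t / τ ≤ 1 := (div_le_one hτ).2 ht.2.le
  rw [hat, Nat.cast_zero, sub_zero, abs_of_nonneg (div_nonneg ht.1.le hτ.le),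
    max_eq_left (by linarith)]

theorem integral_hat_zero_quadratic {T τ : ℝ} (hτ : 0 < τ) (hT : τ ≤ T) (a b c : ℝ) :
    ∫ t in Ioo 0 T, hat τ 0 t * (a + b * t + c * t ^ 2) =
      a * (τ / 2) + b * (τ ^ 2 / 6) + c * (τ ^ 3 / 12) := by
  rw [integral_hat_zero hτ hT]
  have hd : ∀ t ∈ uIcc 0 τ, HasDerivAt (fun t => a * t + (b - a / τ) / 2 * t ^ 2 +
      (c - b / τ) / 3 * t ^ 3 - c / τ / 4 * t ^ 4) ((1 - t / τ) * (a + b * t + c * t ^ 2)) t := by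
    intro t _
    have := ((((hasDerivAt_id t).const_mul a).add
      ((hasDerivAt_pow 2 t).const_mul ((b - a / τ) / 2))).add
      ((hasDerivAt_pow 3 t).const_mul ((c - b / τ) / 3))).sub
      ((hasDerivAt_pow 4 t).const_mul (c / τ / 4))
    exact this.congr_deriv (by push_cast; ring)
  rw [intervalIntegral.integral_eq_sub_of_hasDerivAt hd
    (Continuous.intervalIntegrable (by fun_prop) _ _)]
  field_simp
  ring

/-- The quadrature functional in the truncation error of the first equation. -/
noncomputable def startDefect (T τ : ℝ) (W : ℝ → ℝ) : ℝ :=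
  τ / 12 * (W τ - W 0) + τ / 2 * W 0 - ∫ t in Ioo 0 T, hat τ 0 t * W t

theorem isFun_startDefect {T τ : ℝ} (hτ : 0 < τ) (hT : τ ≤ T) : IsFun T (startDefect T τ) := by
  have hT0 := hτ.trans_le hT
  have h1 := isFun_eval (X := T) (p := τ) ⟨hτ.le, hT⟩
  have h2 := isFun_eval (X := T) (p := (0 : ℝ)) ⟨le_rfl, hT0.le⟩
  exact (((h1.sub h2).const_mul _).add (h2.const_mul _)).sub
    (isFun_integral hT0.le (continuous_hat τ 0).continuousOn.integrableOn_Ioo)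

/-- For `s ≥ τ` the truncated power vanishes on `[0, τ]`, which is all the functional sees.
Otherwise it is at most `τ²/2` there, and the two terms add up to `τ³/24 + τ³/4`. -/
theorem abs_startDefect_kern_le {T τ : ℝ} (hτ : 0 < τ) (hT : τ ≤ T) {s : ℝ} (hs : s ∈ Ioo 0 T) :
    |startDefect T τ (fun t => kern 2 t s)| ≤ (Ioo 0 τ).indicator (fun _ => τ ^ 3) s := by
  have h0 : kern 2 0 s = 0 := by rw [kern, if_neg (not_lt.2 hs.1.le)]
  simp only [startDefect, h0]
  by_cases hsτ : s < τ
  · rw [indicator_of_mem (show s ∈ Ioo 0 τ from ⟨hs.1, hsτ⟩)]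
    have hk : ∀ t, t ≤ τ → |kern 2 t s| ≤ τ ^ 2 / 2 := by
      intro t ht
      rw [kern]
      split_ifs with hst
      · rw [abs_of_nonneg (div_nonneg (by positivity) (by positivity))]
        have : (t - s) ^ 2 ≤ τ ^ 2 := pow_le_pow_left₀ (by linarith) (by linarith [hs.1]) 2
        norm_num [Nat.factorial]
        linarith
      · simp; positivity
    have h1 : |∫ t in Ioo 0 T, hat τ 0 t * kern 2 t s| ≤ τ ^ 3 / 4 := by
      have := integral_hat_zero_quadratic hτ hT (τ ^ 2 / 2) 0 0
      simp only [zero_mul, add_zero] at this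
      rw [show τ ^ 3 / 4 = τ ^ 2 / 2 * (τ / 2) by ring, ← this, ← Real.norm_eq_abs]
      refine norm_integral_le_of_norm_le
        (integrableOn_mul_continuous (continuous_hat τ 0) (integrableOn_const (by simp))) ?_
      refine .of_forall fun t => ?_
      rw [norm_mul, Real.norm_eq_abs, abs_of_nonneg (hat_nonneg _ _ _), Real.norm_eq_abs]
      rcases le_or_gt t τ with ht | ht
      · exact mul_le_mul_of_nonneg_left (hk t ht) (hat_nonneg _ _ _)
      · rw [hat_eq_zero hτ fun hc => by simp at hc; linarith]; simp
    have h2 := hk τ le_rfl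
    rw [abs_le] at h1 h2 ⊢
    have h3 : 0 < τ ^ 3 := by positivity
    constructor <;> nlinarith [h1.1, h1.2, h2.1, h2.2]
  · push Not at hsτ
    rw [indicator_of_notMem (s := Ioo 0 τ) fun hc => absurd hc.2 (not_lt.2 hsτ)]
    have hk : ∀ t, t ≤ τ → kern 2 t s = 0 := fun t ht => by
      rw [kern, if_neg (by linarith)]
    have h1 : ∀ t, hat τ 0 t * kern 2 t s = 0 := by
      intro t
      rcases le_or_gt t τ with ht | ht
      · rw [hk t ht, mul_zero]
      · rw [hat_eq_zero hτ fun hc => by simp at hc; linarith, zero_mul]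
    simp [h1, hk τ le_rfl]

/-- The functional kills `1` and `t²` and sends `t` to `τ²/12 - τ²/6 = -τ²/12`. For `H = Λ_x u` the
term with the slope is what the correction `(τ²/12) a² Λ_x u_1` in `u_{1h}` compensates. -/
theorem WeakEq.startDefect_eq {T τ d : ℝ} (hτ : 0 < τ) (hT : τ ≤ T) {H G : ℝ → ℝ}
    (hH : ContinuousOn H (Icc 0 T)) (hG : IntegrableOn G (Ioo 0 T)) (h : WeakEq T 3 H G)
    (hd : HasDerivWithinAt H d (Icc 0 T) 0) :
    startDefect T τ H = -(τ ^ 2 / 12 * d) +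
      ∫ s in Ioo 0 T, startDefect T τ (fun t => kern 2 t s) * G s := by
  have hT0 := hτ.trans_le hT
  have hL := isFun_startDefect hτ hT
  obtain ⟨c, h1, h2⟩ := h.taylor_deriv hT0 two_ne_zero hH hG
  have hp : Continuous fun t : ℝ => c 0 + c 1 * t + c 2 * t ^ 2 := by fun_prop
  have hJ := continuousOn_integral_kern (X := T) 2 hG
  rw [hL.congr hH (W := fun t => (c 0 + c 1 * t + c 2 * t ^ 2) +
    ∫ s in Ioo 0 T, kern 2 t s * G s) (fun t ht => by
      rw [h2 t ht]; simp [Finset.sum_range_succ]), hL.map_add hp.continuousOn hJ,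
    hL.map_integral_kern hT0.le two_ne_zero hG, HasDerivWithinAt.unique_Icc hT0 hd h1]
  congr 1
  rw [startDefect, integral_hat_zero_quadratic hτ hT]
  ring

/-- The truncation error of the equation at the first time step. -/
theorem IsEnergySolution.truncation_first {a X T : ℝ} {u0 u1 : ℝ → ℝ}
    {f u u02 u20 u40 u42 u23 : ℝ → ℝ → ℝ} (hu : IsEnergySolution a X T u0 u1 f u)
    (hu1 : ContinuousOn u1 (Icc 0 X)) (hf : MemL21 X T f) (h02 : MemL21 X T u02)
    (h20 : MemL21 X T u20) (h40 : MemL21 X T u40) (h42 : MemL21 X T u42)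
    (h23 : MemL21 X T u23) (e02 : WeakEqQ X T 0 2 u u02) (e20 : WeakEqQ X T 2 0 u u20)
    (e40 : WeakEqQ X T 4 0 u u40) (e42 : WeakEqQ X T 4 2 u u42) (e23 : WeakEqQ X T 2 3 u u23)
    {h τ : ℝ} (hh : 0 < h) (hτ : 0 < τ) {i : ℕ} (hi : 1 ≤ i) (hX : ((i : ℝ) + 1) * h ≤ X)
    (hT : τ ≤ T) (u1h : ℕ → ℝ) :
    (sN (deltaT τ (fun m i => u (i * h) (m * τ)) 0) i -
        τ ^ 2 * a ^ 2 / 12 * lamX h (deltaT τ (fun m i => u (i * h) (m * τ)) 0) i) -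
      τ / 2 * a ^ 2 * lamX h (fun i => u (i * h) ((0 : ℕ) * τ)) i -
      (u1h i + τ / 2 * fMesh h τ f 0 i) =
    (u1Mesh0 a h τ u1 i - u1h i) +
      (∫ t in Ioo 0 T, hat τ 0 t * ∫ x in Ioo 0 X, defectKern h i x * u42 x t) -
      a ^ 2 * ∫ t in Ioo 0 T, startDefect T τ (fun s => kern 2 s t) *
        ∫ x in Ioo 0 X, hat h i x / h * u23 x t := by
  have hX0 : 0 < X := lt_of_lt_of_le (by positivity) hX
  have hT0 : 0 < T := hτ.trans_le hT
  have hc := hu.isCurve hX0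
  have ch := (continuous_hat h i).div_const h
  have cd := continuous_defectKern hh hi
  obtain ⟨A, hA⟩ := ch.exists_bound_Ioo (T := X)
  obtain ⟨B, hB⟩ := cd.exists_bound_Ioo (T := X)
  have LN := isFun_numDefect hh hi hX
  have LL := isFun_lamX hh hX
  have LQ := isFun_integral hX0.le (ρ := fun x => hat h i x / h) ch.continuousOn.integrableOn_Ioo
  have dF := hu.hasDerivWithinAt_peano hX0 hT0 hu1 h40 h42 e40 e42 three_ne_zero LN
    (killsPoly_numDefect hh hi)
  have dH := hu.hasDerivWithinAt_lamX hT0 hu1 h40 h42 e40 e42 hh hi hX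
  have dQ := hu.hasDerivWithinAt_zero hT0.le ch.memLp_muI
  have rF := (e42.weakEq_time hX0 hT0 hc h42.integrable LN (represents_numDefect hh hi hX)
    cd.aestronglyMeasurable hB).forward_diff hτ hT (hc.continuousOn_fun LN)
    (integrableOn_integral_kernel h42.integrable cd.aestronglyMeasurable hB) dF
  have rQ := (e02.weakEq_time hX0 hT0 hc h02.integrable LQ (represents_zero _)
    ch.aestronglyMeasurable hA).forward_diff hτ hT (hc.continuousOn_fun LQ)
    (integrableOn_integral_kernel h02.integrable ch.aestronglyMeasurable hA) dQ
  have rH := (e23.weakEq_time hX0 hT0 hc h23.integrable LL (represents_lamX hh hi hX)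
    ch.aestronglyMeasurable hA).startDefect_eq hτ hT (hc.continuousOn_fun LL)
    (integrableOn_integral_kernel h23.integrable ch.aestronglyMeasurable hA) dH
  have rZ := represents_zero (hat τ 0) _ _ (hc.continuousOn_fun LL)
    (integrableOn_integral_kernel h20.integrable ch.aestronglyMeasurable hA)
    (e20.weakEq_time hX0 hT0 hc h20.integrable LL (represents_lamX hh hi hX)
      ch.aestronglyMeasurable hA)
  have ef := hu.fMesh_eq_sub hf h02 h20 e02 e20 hh hτ hi hX (m := 0) (by simpa using hT)
  simp only [timeWeight_zero, mul_assoc, integral_const_mul] at ef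
  have s1 : sN (deltaT τ (fun m i => u (i * h) (m * τ)) 0) i =
      (numDefect h i (fun x => u x τ) - numDefect h i (fun x => u x 0)) / τ +
      ((∫ x in Ioo 0 X, hat h i x / h * u x τ) - ∫ x in Ioo 0 X, hat h i x / h * u x 0) / τ := by
    simp only [numDefect, qH_eq_setIntegral hh hi hX, nodal, sN, deltaT]
    simp only [zero_add, Nat.cast_one, one_mul, Nat.cast_zero, zero_mul]
    ring
  have s2 : lamX h (deltaT τ (fun m i => u (i * h) (m * τ)) 0) i =
      (lamX h (nodal h fun x => u x τ) i - lamX h (nodal h fun x => u x 0) i) / τ := by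
    simp only [nodal, lamX, deltaT]
    simp only [zero_add, Nat.cast_one, one_mul, Nat.cast_zero, zero_mul]
    ring
  have s3 : lamX h (fun i => u (i * h) ((0 : ℕ) * τ)) i = lamX h (nodal h fun x => u x 0) i := by
    simp only [nodal, lamX, Nat.cast_zero, zero_mul]
  have s4 : u1Mesh0 a h τ u1 i = numDefect h i u1 + (∫ x in Ioo 0 X, hat h i x / h * u1 x) +
      τ ^ 2 / 12 * a ^ 2 * lamX h (nodal h u1) i := by
    rw [u1Mesh0, numDefect, qH_eq_setIntegral hh hi hX]; ring
  simp only [startDefect] at rH rZ ⊢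
  rw [s1, s2, s3, s4, rF, rQ, ef]
  have c1 : ∀ y : ℝ, τ ^ 2 * a ^ 2 / 12 * (y / τ) = a ^ 2 * (τ / 12 * y) := fun y => by
    field_simp
  have c2 : ∀ y : ℝ, τ / 2 * (2 / τ * y) = y := fun y => by field_simp
  rw [c1, mul_sub (τ / 2), mul_left_comm (τ / 2) (a ^ 2), c2, c2, ← rZ]
  -- The averages of `∂_t² u` have cancelled, the factor `τ/2` undoing the `2/τ` of `q_τ` at `t =
  -- 0`. What remains of the terms in `Λ_x u` is `-a²` times the start functional, and its slope
  -- part completes `s_N u_1` to `u1Mesh0`.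
  linear_combination -a ^ 2 * rH

/-! ### Consistency of the choices of the initial velocity data -/

theorem windowKernel_avgDefect {X h : ℝ} (hh : 0 < h) {i : ℕ} (hi : 1 ≤ i)
    (hX : ((i : ℝ) + 1) * h ≤ X) :
    WindowKernel h i (6 * h) fun s => avgDefect h i fun x => kern 1 x s := by
  intro s
  have := (isFun_avgDefect hh hi hX).peano_bound one_ne_zero (killsPoly_avgDefect hh i)
    (windowBound_avgDefect hh i) (by nlinarith) s
  rwa [show 3 * (((i : ℝ) + 1) * h - (i - 1) * h) ^ 1 = 6 * h by ring] at this

theorem dualBound_numDefect {X h : ℝ} (hh : 0 < h) {N : ℕ} (hX : (N : ℝ) * h = X)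
    {w g : ℝ → ℝ} (hw : ContinuousOn w (Icc 0 X)) (hg : MemLp g 2 (muI X)) (e : WeakEq X 4 w g) :
    DualBound h N (fun i => numDefect h i w) (48 * h ^ 4 * (normL2 X g).toReal) := by
  refine ((dualBound_integral_window hh hX hg (κ := 24 * h ^ 3) (by positivity)
    fun i h1 _ => windowKernel_defectKern hh h1).congr fun i h1 h2 => ?_).mono (by
      exact le_of_eq (by ring))
  refine represents_numDefect hh h1 ?_ w g hw hg.integrable_muI e
  rw [← hX]
  exact mul_le_mul_of_nonneg_right (by exact_mod_cast h2) hh.le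

theorem dualBound_lamX_nodal {X h : ℝ} (hh : 0 < h) {N : ℕ} (hX : (N : ℝ) * h = X)
    {w g : ℝ → ℝ} (hw : ContinuousOn w (Icc 0 X)) (hg : MemLp g 2 (muI X)) (e : WeakEq X 2 w g) :
    DualBound h N (lamX h (nodal h w)) (2 * (normL2 X g).toReal) := by
  refine ((dualBound_integral_window hh hX hg (κ := 1 / h) (by positivity)
    fun i _ _ => windowKernel_hat hh i).congr fun i h1 h2 => ?_).mono (by
      exact le_of_eq (by field_simp))
  refine represents_lamX hh h1 ?_ w g hw hg.integrable_muI e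
  rw [← hX]
  exact mul_le_mul_of_nonneg_right (by exact_mod_cast h2) hh.le

theorem dualBound_avgDefect {X h : ℝ} (hh : 0 < h) {N : ℕ} (hX : (N : ℝ) * h = X)
    {w g : ℝ → ℝ} (hw : ContinuousOn w (Icc 0 X)) (hg : MemLp g 2 (muI X)) (e : WeakEq X 2 w g) :
    DualBound h N (fun i => avgDefect h i w) (12 * h ^ 2 * (normL2 X g).toReal) := by
  have hXi : ∀ i : ℕ, i < N → ((i : ℝ) + 1) * h ≤ X := fun i h2 => by
    rw [← hX]
    exact mul_le_mul_of_nonneg_right (by exact_mod_cast h2) hh.le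
  refine ((dualBound_integral_window hh hX hg (κ := 6 * h) (by positivity)
    fun i h1 h2 => windowKernel_avgDefect hh h1 (hXi i h2)).congr fun i h1 h2 => ?_).mono (by
      exact le_of_eq (by ring))
  have hX0 : 0 < X := lt_of_lt_of_le (by positivity) (hXi i h2)
  exact (isFun_avgDefect hh h1 (hXi i h2)).represents_peano hX0 one_ne_zero
    (killsPoly_avgDefect hh i) w g hw hg.integrable_muI e

theorem WeakEq.of_second {X : ℝ} {w w2 g : ℝ → ℝ} (h2 : WeakEq X 2 w w2) (h4 : WeakEq X 4 w g) :
    WeakEq X 2 w2 g := by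
  intro φ hφ
  have e1 := h2 _ (hφ.iteratedDeriv 2)
  have e2 := h4 φ hφ
  have e3 : iteratedDeriv 2 (iteratedDeriv 2 φ) = iteratedDeriv 4 φ := by
    simp only [iteratedDeriv_eq_iterate]; rfl
  rw [e3, e2] at e1
  linarith

/-- A mesh function continued by zero to the end nodes. -/
noncomputable def zeroEnds (N : ℕ) (z : ℕ → ℝ) (i : ℕ) : ℝ := if 1 ≤ i ∧ i < N then z i else 0

theorem zeroEnds_of_inner {N : ℕ} (z : ℕ → ℝ) {i : ℕ} (h1 : 1 ≤ i) (h2 : i < N) :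
    zeroEnds N z i = z i := if_pos ⟨h1, h2⟩

theorem DualBound.lamX_zeroEnds {h : ℝ} (hh : 0 < h) {N : ℕ} {z : ℕ → ℝ} {P : ℝ} (hP : 0 ≤ P)
    (hz : DualBound h N z P) : DualBound h N (CompactWave.lamX h (zeroEnds N z)) (4 / h ^ 2 * P) :=
  (hz.congr fun _ => zeroEnds_of_inner z).lamX hh hP (by simp [zeroEnds]) (by simp [zeroEnds])

/-- At inner nodes `w - q_h w` is the Numerov defect minus `(h²/12) Λ_x w`, and `Λ_x w = q_h w2` is
the nodal value of `w2` plus its average defect. At the end nodes all terms are zero because `w` and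
`w2` vanish there, so `Λ_x` can be applied to the identity up to the boundary. -/
theorem lamX_qH0_sub {X h : ℝ} (hh : 0 < h) {N : ℕ} (hX : (N : ℝ) * h = X) {w w2 : ℝ → ℝ}
    (hw : ContinuousOn w (Icc 0 X)) (hw2 : ContinuousOn w2 (Icc 0 X)) (e2 : WeakEq X 2 w w2)
    (w0 : w 0 = 0) (wX : w X = 0) (v0 : w2 0 = 0) (vX : w2 X = 0) {i : ℕ} (hi : i < N) :
    lamX h (nodal h w) i - lamX h (qH0 h N w) i =
      lamX h (zeroEnds N fun i => numDefect h i w) i - h ^ 2 / 12 * (lamX h (nodal h w2) i +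
        lamX h (zeroEnds N fun i => avgDefect h i w2) i) := by
  have key : ∀ j, j ≤ N → nodal h w j - qH0 h N w j = zeroEnds N (fun i => numDefect h i w) j -
      h ^ 2 / 12 * (nodal h w2 j + zeroEnds N (fun i => avgDefect h i w2) j) := by
    intro j hj
    by_cases hin : 1 ≤ j ∧ j < N
    · have hXj : ((j : ℝ) + 1) * h ≤ X := by
        rw [← hX]
        exact mul_le_mul_of_nonneg_right (by exact_mod_cast hin.2) hh.le
      have e := represents_lamX hh hin.1 hXj w w2 hw hw2.integrableOn_Ioo e2
      rw [← qH_eq_setIntegral hh hin.1 hXj] at e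
      simp only at e
      rw [zeroEnds_of_inner _ hin.1 hin.2, zeroEnds_of_inner _ hin.1 hin.2, qH0, if_pos hin,
        numDefect, avgDefect, sN_eq hh, e]
      ring
    · rw [qH0, zeroEnds, zeroEnds, if_neg hin, if_neg hin, if_neg hin]
      have hj' : j = 0 ∨ j = N := by omega
      rcases hj' with rfl | rfl
      · simp [nodal, w0, v0]
      · simp [nodal, hX, wX, vX]
  have h1 := key (i - 1) (by omega)
  have h2 := key i hi.le
  have h3 := key (i + 1) hi
  simp only [lamX]
  linear_combination (h1 - 2 * h2 + h3) / h ^ 2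

/-- The data are compared with `s_N u_1 + (τ²/12) a² Λ_x u_1`. The first choice differs by a Numerov
defect (`48 h⁴`), the second not at all. The third adds `(τ² a²/12) Λ_x (u_1 - q_h u_1)`, where the
two powers lost to `Λ_x` return from `a² τ² ≤ h²`; its constant `(192 + 50/12)/12` is below `17`. -/
theorem dualBound_u1 {a X h τ : ℝ} (hh : 0 < h) {N : ℕ} (hX : (N : ℝ) * h = X)
    (hst : a ^ 2 * τ ^ 2 ≤ h ^ 2) {u1 g : ℝ → ℝ} {u1h : ℕ → ℝ} (hu1 : ContinuousOn u1 (Icc 0 X))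
    (hg : MemLp g 2 (muI X)) (e : WeakEq X 4 u1 g) (hc : IsU1Choice a X h τ N u1 u1h) :
    DualBound h N (fun i => u1Mesh0 a h τ u1 i - u1h i) (65 * h ^ 4 * (normL2 X g).toReal) := by
  have hN := dualBound_numDefect hh hX hu1 hg e
  have hD : 0 ≤ (normL2 X g).toReal := ENNReal.toReal_nonneg
  have h4 : 0 ≤ h ^ 4 * (normL2 X g).toReal := by positivity
  rcases hc with hc | hc | ⟨⟨hl, hr, w, hw, hw2, w0, wX⟩, hc⟩
  · refine (hN.congr fun i h1 h2 => ?_).mono (by linarith)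
    rw [hc i h1 h2, u1Mesh0, u1Mesh1, numDefect]; ring
  · refine ((hN.const_mul 0).congr fun i h1 h2 => ?_).mono (by rw [abs_zero]; linarith)
    rw [hc i h1 h2]; ring
  · have e2 : WeakEq X 2 u1 w := hw2.eq
    have e4 := e2.of_second e
    have hA := (hN.lamX_zeroEnds hh (by positivity))
    have hC := ((dualBound_lamX_nodal hh hX hw hg e4).add
      ((dualBound_avgDefect hh hX hw hg e4).lamX_zeroEnds hh (by positivity))).const_mul
      (-(h ^ 2 / 12))
    refine ((hN.add ((hA.add hC).const_mul (τ ^ 2 / 12 * a ^ 2))).congr fun i h1 h2 => ?_).mono ?_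
    · have := lamX_qH0_sub hh hX hu1 hw e2 hl hr w0 wX h2
      rw [hc i h1 h2, u1Mesh0, u1Mesh2, qH0, if_pos ⟨h1, h2⟩]
      rw [numDefect]
      linear_combination τ ^ 2 / 12 * a ^ 2 * this
    · have k1 : |τ ^ 2 / 12 * a ^ 2| ≤ h ^ 2 / 12 := by
        rw [abs_of_nonneg (by positivity)]; linarith
      have k2 : 4 / h ^ 2 * (48 * h ^ 4 * (normL2 X g).toReal) + |-(h ^ 2 / 12)| *
          (2 * (normL2 X g).toReal + 4 / h ^ 2 * (12 * h ^ 2 * (normL2 X g).toReal)) =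
          (192 + 50 / 12) * h ^ 2 * (normL2 X g).toReal := by
        rw [abs_neg, abs_of_nonneg (by positivity)]
        field_simp
        ring
      rw [k2]
      have k3 := mul_le_mul_of_nonneg_right k1
        (show 0 ≤ (192 + 50 / 12) * h ^ 2 * (normL2 X g).toReal by positivity)
      nlinarith

/-! ### Assembling the error estimate -/

theorem integral_hat_zero_sliceNorm_le {X T τ : ℝ} {g : ℝ → ℝ → ℝ} (hg : MemL21 X T g) :
    ∫ t in Ioo 0 T, |hat τ 0 t| * sliceNorm X g t ≤ (normL21 X T g).toReal := by
  rw [← hg.integral_sliceNorm]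
  refine integral_mono_ae (integrableOn_mul_continuous (continuous_hat τ 0).abs
    hg.integrable_sliceNorm) hg.integrable_sliceNorm (.of_forall fun t => ?_)
  simp only [abs_of_nonneg (hat_nonneg τ 0 t)]
  exact mul_le_of_le_one_left (sliceNorm_nonneg _ _ _) (hat_le_one _ _ _)

/-- The kernel has size `τ³` on an interval of length `τ`. The fourth power needs a bound on the
slices uniform in `t`; the `L¹` norm in time alone would give only `τ³`. -/
theorem integral_startDefect_sliceNorm_le {X T τ S : ℝ} (hτ : 0 < τ) (hT : τ ≤ T)
    {g : ℝ → ℝ → ℝ} (hg : MemL21 X T g) (hS : ∀ t, sliceNorm X g t ≤ S) :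
    ∫ t in Ioo 0 T, |startDefect T τ fun s => kern 2 s t| * sliceNorm X g t ≤ τ ^ 4 * S := by
  have hi : ∫ t in Ioo 0 T, (Ioo 0 τ).indicator (fun _ => τ ^ 3 * S) t = τ ^ 4 * S := by
    rw [setIntegral_indicator measurableSet_Ioo,
      inter_eq_self_of_subset_right (Ioo_subset_Ioo_right hT), setIntegral_const]
    simp [hτ.le]
    ring
  rw [← hi]
  refine setIntegral_mono_on (integrableOn_mul_continuous
    ((isFun_startDefect hτ hT).continuous_peano two_ne_zero).abs hg.integrable_sliceNorm)
    ((integrable_const _).indicator measurableSet_Ioo) measurableSet_Ioo fun t ht => ?_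
  refine (mul_le_mul (abs_startDefect_kern_le hτ hT ht) (hS t) (sliceNorm_nonneg _ _ _)
    (indicator_nonneg (fun _ _ => by positivity) _)).trans (le_of_eq ?_)
  by_cases h : t ∈ Ioo 0 τ <;> simp [h]

/-- The error estimate for given mixed derivatives of the solution. -/
theorem IsEnergySolution.error_bound {a X T ε : ℝ} (ha : 0 < a) (hε : 0 < ε) {u0 u1 : ℝ → ℝ}
    {f u u02 u20 u40 u42 u24 u23 : ℝ → ℝ → ℝ} {g : ℝ → ℝ}
    (hu : IsEnergySolution a X T u0 u1 f u)
    (hu1 : ContinuousOn u1 (Icc 0 X)) (hf : MemL21 X T f) (h02 : MemL21 X T u02)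
    (h20 : MemL21 X T u20) (h40 : MemL21 X T u40) (h42 : MemL21 X T u42) (h24 : MemL21 X T u24)
    (h23 : MemL21 X T u23) (hg : MemLp g 2 (muI X)) (e02 : WeakEqQ X T 0 2 u u02)
    (e20 : WeakEqQ X T 2 0 u u20)
    (e40 : WeakEqQ X T 4 0 u u40) (e42 : WeakEqQ X T 4 2 u u42) (e24 : WeakEqQ X T 2 4 u u24)
    (e23 : WeakEqQ X T 2 3 u u23) (eg : WeakEq X 4 u1 g) {S : ℝ}
    (hS : ∀ t, sliceNorm X u23 t ≤ S) {h τ : ℝ} (hh : 0 < h)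
    (hτ : 0 < τ) {N M : ℕ} (hN : 0 < N) (hX : (N : ℝ) * h = X) (hT : (M : ℝ) * τ = T)
    (hst : a ^ 2 * τ ^ 2 ≤ (1 - ε ^ 2 / 2) * h ^ 2) {u1h : ℕ → ℝ} {v : ℕ → ℕ → ℝ}
    (hc : IsU1Choice a X h τ N u1 u1h) (hv : IsSchemeSolution a h τ N M u0 u1h (fMesh h τ f) v)
    {m : ℕ} (hm : m < M) :
    energyNorm a h τ N (meshError h τ u v m) (meshError h τ u v (m + 1)) ≤
      2 / ε * h ^ 4 * (144 * (normL21 X T u42).toReal + 96 / a ^ 2 * (normL21 X T u24).toReal +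
        2 / a ^ 2 * S + 65 * (normL2 X g).toReal) := by
  set A := (normL21 X T u42).toReal with hA
  set B := (normL21 X T u24).toReal with hB
  set D := (normL2 X g).toReal with hD
  have hA0 : 0 ≤ A := ENNReal.toReal_nonneg
  have hB0 : 0 ≤ B := ENNReal.toReal_nonneg
  have hD0 : 0 ≤ D := ENNReal.toReal_nonneg
  have hS0 : 0 ≤ S := (sliceNorm_nonneg X u23 0).trans (hS 0)
  have hst' : a ^ 2 * τ ^ 2 ≤ h ^ 2 := by nlinarith [mul_nonneg (sq_nonneg ε) (sq_nonneg h)]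
  have hXi : ∀ i : ℕ, i < N → ((i : ℝ) + 1) * h ≤ X := fun i h2 => by
    rw [← hX]
    exact mul_le_mul_of_nonneg_right (by exact_mod_cast h2) hh.le
  have hTj : ∀ j : ℕ, j < M → ((j : ℝ) + 1) * τ ≤ T := fun i h2 => by
    rw [← hT]
    exact mul_le_mul_of_nonneg_right (by exact_mod_cast h2) hτ.le
  have hX0 : 0 < X := by rw [← hX]; positivity
  have hMpos : 0 < M := by omega
  have hT0 : 0 < T := by rw [← hT]; positivity
  have hτT : τ ≤ T := by simpa using hTj 0 hMpos
  set r := meshError h τ u v with hr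
  set win : (ℝ → ℝ → ℝ) → ℕ → ℝ := fun w j =>
    ∫ t in (((j : ℝ) - 1) * τ)..(((j : ℝ) + 1) * τ), sliceNorm X w t with hwin
  have win0 : ∀ w j, 0 ≤ win w j := fun w j =>
    intervalIntegral.integral_nonneg (by nlinarith) fun t _ => sliceNorm_nonneg _ _ _
  -- For `j ≥ 1` the bounds are integrals over windows in time, so that `τ ∑ P j` is controlled by
  -- norms over the whole time interval; `P 0` enters the stability estimate without `τ` and must be
  -- of order `h⁴` by itself.
  set P : ℕ → ℝ := fun j => if j = 0 then 65 * h ^ 4 * D + 48 * h ^ 4 * A + a ^ 2 * (2 * τ ^ 4 * S)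
    else 48 * h ^ 4 / τ * win u42 j + a ^ 2 * (48 * τ ^ 3 * win u24 j) with hP
  set ψ : ℕ → ℕ → ℝ := fun j i => if j = 0 then
      (sN (deltaT τ r 0) i - τ ^ 2 * a ^ 2 / 12 * lamX h (deltaT τ r 0) i)
        - τ / 2 * a ^ 2 * lamX h (r 0) i
    else (sN (lamT τ r j) i - τ ^ 2 * a ^ 2 / 12 * lamX h (lamT τ r j) i)
        - a ^ 2 * lamX h (r j) i with hψ
  have hP0 : ∀ j, j < M → 0 ≤ P j := by
    intro j _
    simp only [hP]
    split_ifs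
    · positivity
    · have := win0 u42 j
      have := win0 u24 j
      positivity
  have rb : ∀ j, j ≤ M → r j 0 = 0 ∧ r j N = 0 := by
    intro j hj
    have ht : (j : ℝ) * τ ∈ Icc 0 T := ⟨by positivity, by
      rw [← hT]; exact mul_le_mul_of_nonneg_right (by exact_mod_cast hj) hτ.le⟩
    have hm := hu.memH10 _ ht
    have hl := hm.left
    have hr' := hm.right
    -- The scheme prescribes boundary values only for `j ≥ 1`; at level `0` they come from `u0`,
    -- which agrees with `u(·,0)`.
    have hvb : v j 0 = 0 ∧ v j N = 0 := by
      rcases Nat.eq_zero_or_pos j with rfl | hj0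
      · have h0 := hu.memH10 0 ⟨le_rfl, hT0.le⟩
        have l0 := h0.left
        have r0 := h0.right
        simp only [hu.init 0 ⟨le_rfl, hX0.le⟩, hu.init X ⟨hX0.le, le_rfl⟩] at l0 r0
        rw [hv.init 0 (by omega), hv.init N le_rfl]
        simp [nodal, hX, l0, r0]
      · exact hv.bdry j hj0 hj
    simp only [hr, meshError, hX, hvb.1, hvb.2, Nat.cast_zero, zero_mul]
    exact ⟨by linarith, by linarith⟩
  have r0 : ∀ i, i ≤ N → r 0 i = 0 := by
    intro i hi
    have : (i : ℝ) * h ∈ Icc 0 X := ⟨by positivity, by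
      rw [← hX]; exact mul_le_mul_of_nonneg_right (by exact_mod_cast hi) hh.le⟩
    simp only [hr, meshError, Nat.cast_zero, zero_mul, hv.init i hi, nodal, hu.init _ this, sub_self]
  have hdual : ∀ j, j < M → DualBound h N (ψ j) (P j) := by
    intro j hj
    rcases Nat.eq_zero_or_pos j with rfl | hj0
    · have b1 := dualBound_u1 (a := a) (τ := τ) hh hX hst' hu1 hg eg hc
      have b2 := (dualBound_space_time hh hX h42 (κ := 24 * h ^ 3) (by positivity)
        (fun i h1 _ => windowKernel_defectKern hh h1) (fun i h1 _ => continuous_defectKern hh h1)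
        (continuous_hat τ 0)).mono (P' := 48 * h ^ 4 * A) (by
          have := mul_le_mul_of_nonneg_left (integral_hat_zero_sliceNorm_le (τ := τ) h42)
            (show 0 ≤ 48 * h ^ 4 by positivity)
          calc _ = 48 * h ^ 4 * ∫ t in Ioo 0 T, |hat τ 0 t| * sliceNorm X u42 t := by ring
            _ ≤ _ := this)
      have b3 := (dualBound_space_time hh hX h23 (κ := 1 / h) (by positivity)
        (fun i _ _ => windowKernel_hat hh i) (fun i _ _ => (continuous_hat h i).div_const h)
        ((isFun_startDefect hτ hτT).continuous_peano two_ne_zero)).mono (P' := 2 * τ ^ 4 * S) (by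
          have := mul_le_mul_of_nonneg_left (integral_startDefect_sliceNorm_le hτ hτT h23 hS)
            (show (0 : ℝ) ≤ 2 by norm_num)
          calc _ = 2 * ∫ t in Ioo 0 T, |startDefect T τ fun s => kern 2 s t| *
                sliceNorm X u23 t := by field_simp
            _ ≤ _ := this
            _ = _ := by ring)
      refine (((b1.add b2).add (b3.const_mul (-a ^ 2))).congr fun i h1 h2 => ?_).mono (by
        simp only [hP, if_true, abs_neg, abs_of_nonneg (sq_nonneg a)]; exact le_rfl)
      have t1 := hu.truncation_first hu1 hf h02 h20 h40 h42 h23 e02 e20 e40 e42 e23 hh hτ h1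
        (hXi i h2) hτT u1h
      have t2 := hv.first i h1 h2
      simp only [hψ, if_true, hr, meshError, deltaT, sN, lamX] at t1 t2 ⊢
      linear_combination t1 - t2
    · have b2 := (dualBound_space_time hh hX h42 (κ := 24 * h ^ 3) (by positivity)
        (fun i h1 _ => windowKernel_defectKern hh h1) (fun i h1 _ => continuous_defectKern hh h1)
        ((continuous_hat τ j).div_const τ)).mono (P' := 48 * h ^ 4 / τ * win u42 j) (by
          have := mul_le_mul_of_nonneg_left (integral_window_le hτ hj0 (hTj j hj)
            (windowKernel_hat hτ j) h42.integrable_sliceNorm (sliceNorm_nonneg X u42))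
            (show 0 ≤ 48 * h ^ 4 by positivity)
          calc _ = 48 * h ^ 4 * ∫ t in Ioo 0 T, |hat τ j t / τ| * sliceNorm X u42 t := by ring
            _ ≤ _ := this
            _ = _ := by simp only [hwin]; ring)
      have b3 := (dualBound_space_time hh hX h24 (κ := 1 / h) (by positivity)
        (fun i _ _ => windowKernel_hat hh i) (fun i _ _ => (continuous_hat h i).div_const h)
        (continuous_defectKern hτ hj0)).mono (P' := 48 * τ ^ 3 * win u24 j) (by
          have := mul_le_mul_of_nonneg_left (integral_window_le hτ hj0 (hTj j hj)
            (windowKernel_defectKern hτ hj0) h24.integrable_sliceNorm (sliceNorm_nonneg X u24))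
            (show (0 : ℝ) ≤ 2 by norm_num)
          calc _ = 2 * ∫ t in Ioo 0 T, |defectKern τ j t| * sliceNorm X u24 t := by field_simp
            _ ≤ _ := this
            _ = _ := by simp only [hwin]; ring)
      refine ((b2.add (b3.const_mul (-a ^ 2))).congr fun i h1 h2 => ?_).mono (by
        simp only [hP, if_neg hj0.ne', abs_neg, abs_of_nonneg (sq_nonneg a)]; exact le_rfl)
      have t1 := hu.truncation_main hf h02 h20 h42 h24 e02 e20 e42 e24 hh hτ h1
        (hXi i h2) hj0 (hTj j hj)
      have t2 := hv.main j hj0 hj i h1 h2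
      simp only [hψ, if_neg hj0.ne', hr, meshError, lamT, sN, lamX] at t1 t2 ⊢
      linear_combination t1 - t2
  have key := energy_stability ha hh hτ hε hN hst (r := r) (ψ := ψ) (P := P) r0 rb
    (fun j h1 _ i _ _ => by simp only [hψ, if_neg (show j ≠ 0 by omega)])
    (fun i _ _ => by simp only [hψ, if_true]) hdual hP0 m hm
  refine key.trans ?_
  have sum : ∀ w, MemL21 X T w → ∑ j ∈ Finset.Icc 1 m, win w j ≤ 2 * (normL21 X T w).toReal :=
    fun w hw => by
      rw [← hw.integral_sliceNorm]
      exact sum_integral_windows_le hτ (hTj m hm) hw.integrable_sliceNorm (sliceNorm_nonneg X w)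
  have eP : τ * ∑ j ∈ Finset.Icc 1 m, P j = 48 * h ^ 4 * ∑ j ∈ Finset.Icc 1 m, win u42 j +
      48 * (a ^ 2 * τ ^ 4) * ∑ j ∈ Finset.Icc 1 m, win u24 j := by
    rw [Finset.mul_sum, Finset.mul_sum, Finset.mul_sum, ← Finset.sum_add_distrib]
    refine Finset.sum_congr rfl fun j hj => ?_
    rw [Finset.mem_Icc] at hj
    simp only [hP, if_neg (show j ≠ 0 by omega)]
    field_simp
  -- The stability condition converts the time step powers into `h⁴`.
  have hτ4 : a ^ 2 * τ ^ 4 ≤ h ^ 4 / a ^ 2 := by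
    rw [le_div_iff₀ (by positivity)]
    calc _ = (a ^ 2 * τ ^ 2) ^ 2 := by ring
      _ ≤ (h ^ 2) ^ 2 := pow_le_pow_left₀ (by positivity) hst' 2
      _ = _ := by ring
  have e0 : P 0 = 65 * h ^ 4 * D + 48 * h ^ 4 * A + 2 * (a ^ 2 * τ ^ 4) * S := by
    simp only [hP, if_true]; ring
  rw [mul_assoc (2 / ε)]
  refine mul_le_mul_of_nonneg_left ?_ (by positivity)
  rw [e0, eP]
  have q1 := mul_le_mul_of_nonneg_left (sum u42 h42) (show 0 ≤ 48 * h ^ 4 by positivity)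
  have q2 : 48 * (a ^ 2 * τ ^ 4) * ∑ j ∈ Finset.Icc 1 m, win u24 j ≤
      48 * (h ^ 4 / a ^ 2) * (2 * B) :=
    mul_le_mul (by linarith) (sum u24 h24) (Finset.sum_nonneg fun j _ => win0 _ _) (by positivity)
  have q3 := mul_le_mul_of_nonneg_right hτ4 hS0
  -- The twofold overlap of the windows gives `96 A` and `96 B / a²`; the first step adds `48 A`, so
  -- that `A` gets `144`.
  calc _ ≤ 65 * h ^ 4 * D + 48 * h ^ 4 * A + 2 * (h ^ 4 / a ^ 2 * S) +
        (48 * h ^ 4 * (2 * A) + 48 * (h ^ 4 / a ^ 2) * (2 * B)) := by linarith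
    _ = _ := by ring

end CompactWave

theorem mainTheorem3 (a X T ε₀ : ℝ) (ha : 0 < a) (hX : 0 < X) (hT : 0 < T)
    (hε₀ : 0 < ε₀) (hε₀_le : ε₀ ≤ 1) :
    ∃ c : ℝ, 0 < c ∧
      ∀ (N M : ℕ) (h τ : ℝ), 0 < N → 0 < M → h = X / N → τ = T / M →
      a ^ 2 * τ ^ 2 ≤ (1 - ε₀ ^ 2 / 2) * h ^ 2 →
      ∀ (u0 u1 : ℝ → ℝ) (f u : ℝ → ℝ → ℝ),
      MemH10 X u0 → ContinuousOn u1 (Icc 0 X) → MemL21 X T f →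
      IsEnergySolution a X T u0 u1 f u →
      (∃ g, IsL21DerivQ X T 2 0 u g) → (∃ g, IsL21DerivQ X T 0 2 u g) →
      (∃ g, IsL21DerivQ X T 4 0 u g) → (∃ g, IsL21DerivQ X T 0 4 u g) →
      ∀ u42 u24 : ℝ → ℝ → ℝ, IsL21DerivQ X T 4 2 u u42 → IsL21DerivQ X T 2 4 u u24 →
      ∃ (u23 : ℝ → ℝ → ℝ) (d4u1 : ℝ → ℝ),
        IsL21DerivQ X T 2 3 u u23 ∧ IsL2DerivI X 4 u1 d4u1 ∧
        ∀ (u1h : ℕ → ℝ) (v : ℕ → ℕ → ℝ),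
          IsU1Choice a X h τ N u1 u1h →
          IsSchemeSolution a h τ N M u0 u1h (fMesh h τ f) v →
          ∀ m, 1 ≤ m → m ≤ M →
            energyNorm a h τ N (meshError h τ u v (m - 1)) (meshError h τ u v m) ≤
              c * h ^ 4 * ((normL21 X T u42).toReal + (normL21 X T u24).toReal
                + (normL21 X T u23).toReal + (normL2 X d4u1).toReal) := by
  -- The slice bound `C / T + 2 B` replaces the supremum in `error_bound`. Hence `B` gets `(96 + 4)
  -- / a²`, `C` gets `2 / (a² T)`, and `144` also covers the `65` of the initial data.
  refine ⟨2 / ε₀ * (144 + 100 / a ^ 2 + 2 / (a ^ 2 * T)), by positivity, ?_⟩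
  intro N M h τ hN hM hh hτ hst u0 u1 f u _ hu1 hf hu h20 h02 h40 _ u42 u24 h42 h24
  obtain ⟨u20, e20, h20⟩ := h20
  obtain ⟨u02, e02, h02⟩ := h02
  obtain ⟨u40, e40, h40⟩ := h40
  obtain ⟨e42, h42⟩ := h42
  obtain ⟨e24, h24⟩ := h24
  have hN' : (0 : ℝ) < N := by exact_mod_cast hN
  have hM' : (0 : ℝ) < M := by exact_mod_cast hM
  have hh0 : 0 < h := by rw [hh]; positivity
  have hτ0 : 0 < τ := by rw [hτ]; positivity
  have hX' : (N : ℝ) * h = X := by rw [hh]; field_simp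
  have hT' : (M : ℝ) * τ = T := by rw [hτ]; field_simp
  obtain ⟨χ, hχ, hχ1⟩ := exists_test_integral_one hT
  -- The third time derivative of `∂_x² u` is interpolated between `∂_x² u` and `∂_x²∂_t⁴ u`.
  have m23 := memL21_midDeriv (l := 3) hχ h20 h24
  have e23 : WeakEqQ X T 2 3 u (midDeriv T 3 χ u20 u24) :=
    WeakEqQ.midDeriv hX hT (hu.isCurve hX) h20 h24 e20.eq e24.eq hχ hχ1
  have d4 := hu.isL2DerivI_initSlope hX hT hu1 h40 h42 e40.eq e42.eq
  refine ⟨midDeriv T 3 χ u20 u24, initSlope T u40 u42, ⟨⟨e20.locInt, ?_, e23⟩, m23⟩, d4, ?_⟩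
  · refine IntegrableOn.locallyIntegrableOn ?_
    rw [IntegrableOn, restrict_domQ]
    exact m23.integrable
  intro u1h v hc hv m hm1 hmM
  obtain ⟨m, rfl⟩ : ∃ n, m = n + 1 := ⟨m - 1, by omega⟩
  rw [Nat.add_sub_cancel]
  refine (hu.error_bound ha hε₀ hu1 hf h02 h20 h40 h42 h24 m23 d4.2 e02.eq e20.eq e40.eq e42.eq
    e24.eq e23 d4.1.eq (sliceNorm_midDeriv_le hT hχ h20 h24) hh0 hτ0 hN hX' hT' hst hc hv
    (by omega)).trans ?_
  generalize hA : (normL21 X T u42).toReal = A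
  generalize hB : (normL21 X T u24).toReal = B
  generalize hC : (normL21 X T (midDeriv T 3 χ u20 u24)).toReal = C
  generalize hD : (normL2 X (initSlope T u40 u42)).toReal = D
  have hA0 : 0 ≤ A := hA ▸ ENNReal.toReal_nonneg
  have hB0 : 0 ≤ B := hB ▸ ENNReal.toReal_nonneg
  have hC0 : 0 ≤ C := hC ▸ ENNReal.toReal_nonneg
  have hD0 : 0 ≤ D := hD ▸ ENNReal.toReal_nonneg
  have h1 : 0 ≤ 1 / a ^ 2 := by positivity
  have h2 : 0 ≤ 1 / (a ^ 2 * T) := by positivity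
  have e : 144 * A + 96 / a ^ 2 * B + 2 / a ^ 2 * (C / T + 2 * B) + 65 * D =
      144 * A + 100 * (1 / a ^ 2) * B + 2 * (1 / (a ^ 2 * T)) * C + 65 * D := by
    field_simp
    ring
  rw [e, show 2 / ε₀ * (144 + 100 / a ^ 2 + 2 / (a ^ 2 * T)) * h ^ 4 * (A + B + C + D) =
    2 / ε₀ * h ^ 4 * ((144 + 100 * (1 / a ^ 2) + 2 * (1 / (a ^ 2 * T))) * (A + B + C + D)) by ring]
  refine mul_le_mul_of_nonneg_left ?_ (by positivity)
  generalize 1 / a ^ 2 = p at *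
  generalize 1 / (a ^ 2 * T) = q at *
  nlinarith [mul_nonneg h1 hA0, mul_nonneg h1 hC0, mul_nonneg h1 hD0, mul_nonneg h2 hA0,
    mul_nonneg h2 hB0, mul_nonneg h2 hD0]
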